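/- Let $m,n\ge 1$ be integers, $N=m+n$, and $0\le s<1$. For $\alpha>0$ let $E_\alpha=\{x=(y,z)\in\mathbb R^m\times\mathbb R^n : |z|>\alpha|y|\}$ and $C_\alpha=\partial E_\alpha=\{(y,z) : |z|=\alpha|y|\}$. Let $\Sigma=C_m^n(s)$ be the cone $C_\alpha$ whose opening $\alpha>0$ is determined as follows. If $0<s<1$, then $C_\alpha$ is a nonlocal minimal cone, i.e. $$\text{p.v.}\int_{\mathbb R^N}\frac{\chi_{E_\alpha}(x)-\chi_{\mathbb R^N\setminus E_\alpha}(x)}{|x-p|^{N+s}}\,dx=0\qquad\text{for all }p\in C_\alpha\setminus\{0\}.$$ If $s=0$, then $\alpha$ is the opening of the limiting cone, i.e. $$\int_\alpha^\infty\frac{t^{n-1}}{(1+t^2)^{N/2}}\,dt-\int_0^\alpha\frac{t^{n-1}}{(1+t^2)^{N/2}}\,dt=0.$$ Integrals over $\Sigma$ are taken with respect to the $(N-1)$-dimensional surface measure, and $\text{p.v.}$ means the limit as $\delta\to0^+$ of the integrals outside the ball of radius $\delta$ about the singular point. Then the principal value $$H(m,n,s)=\text{p.v.}\int_{\Sigma}\frac{1-|y|^{-\frac{N-2-s}{2}}}{|\hat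 p-y|^{N+s}}\,dy$$ exists for every $\hat p\in\Sigma$ with $|\hat p|=1$ and does not depend on $\hat p$. For every $\phi\in C_0^\infty(\Sigma\setminus\{0\})$ both integrals below are finite and $$H(m,n,s)\int_\Sigma\frac{\phi(x)^2}{|x|^{1+s}}\,dx\le\frac12\int_\Sigma\int_\Sigma\frac{(\phi(x)-\phi(y))^2}{|x-y|^{N+s}}\,dx\,dy.$$ Moreover $H(m,n,s)$ is the best possible constant: if $c\in\mathbb R$ and the inequality holds with $c$ in place of $H(m,n,s)$ for all $\phi\in C_0^\infty(\Sigma\setminus\{0\})$, then $c\le H(m,n,s)$. -/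

import Mathlib

open MeasureTheory Set Filter Topology
open scoped ContDiff

noncomputable section

namespace NonlocalCone

/-- `ℝ^N = ℝ^m × ℝ^n`, `N = m + n`, with the Euclidean norm; points are `x = (y, z)` with
`y = x.fst` and `z = x.snd`. -/
abbrev Space (m n : ℕ) : Type :=
  WithLp 2 (EuclideanSpace ℝ (Fin m) × EuclideanSpace ℝ (Fin n))

/-- The solid cone `E_α = {|z| > α |y|}`. -/
def solidCone (m n : ℕ) (α : ℝ) : Set (Space m n) :=
  {x | α * ‖x.fst‖ < ‖x.snd‖}

/-- The cone `C_α = {|z| = α |y|}`. -/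
def cone (m n : ℕ) (α : ℝ) : Set (Space m n) :=
  {x | ‖x.snd‖ = α * ‖x.fst‖}

/-- `p.v. ∫ f dμ = L`, with principal value at the point `p`: the function `f` is integrable
outside every ball centred at `p`, and the integrals over the complements of the balls of
radius `δ` tend to `L` as `δ → 0`. -/
def HasPrincipalValue {m n : ℕ} (μ : Measure (Space m n)) (f : Space m n → ℝ)
    (p : Space m n) (L : ℝ) : Prop :=
  (∀ δ : ℝ, 0 < δ → IntegrableOn f (Metric.ball p δ)ᶜ μ) ∧
    Tendsto (fun δ : ℝ => ∫ x in (Metric.ball p δ)ᶜ, f x ∂μ) (𝓝[>] 0) (𝓝 L)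

/-- The integrand `(χ_E(x) - χ_{ℝ^N ∖ E}(x)) / |x - p|^{N+s}` of the nonlocal mean curvature
of `∂E` at `p`. -/
def curvatureIntegrand {m n : ℕ} (s : ℝ) (E : Set (Space m n)) (p x : Space m n) : ℝ :=
  (E.indicator 1 x - Eᶜ.indicator 1 x) / ‖x - p‖ ^ ((m : ℝ) + n + s)

/-- `C_α` is a nonlocal minimal cone: the nonlocal mean curvature of `C_α = ∂E_α` vanishes at
every point other than the vertex. -/
def IsNonlocalMinimal (m n : ℕ) (s α : ℝ) : Prop :=
  ∀ p ∈ cone m n α, p ≠ 0 →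
    HasPrincipalValue volume (curvatureIntegrand s (solidCone m n α) p) p 0

/-- The equation for the opening of the limiting cone as `s → 0`. -/
def IsLimitOpening (m n : ℕ) (α : ℝ) : Prop :=
  (∫ t in Ioi α, t ^ (n - 1) / (1 + t ^ 2) ^ (((m : ℝ) + n) / 2))
    - (∫ t in Ioc 0 α, t ^ (n - 1) / (1 + t ^ 2) ^ (((m : ℝ) + n) / 2)) = 0

/-- `α` is the opening of the cone `C_m^n(s)`, `0 ≤ s < 1`: for `s > 0` the cone `C_α` is
nonlocal minimal; for `s = 0` it is the limiting cone. -/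
def IsOpening (m n : ℕ) (s α : ℝ) : Prop :=
  0 < α ∧ (0 < s → IsNonlocalMinimal m n s α) ∧ (s = 0 → IsLimitOpening m n α)

/-- The surface measure of `C_α`: the `(N-1)`-dimensional Hausdorff measure, normalized so as to
agree with the Lebesgue measure on `(N-1)`-dimensional subspaces. -/
def surfaceMeasure (m n : ℕ) (α : ℝ) : Measure (Space m n) :=
  (μHE[m + n - 1]).restrict (cone m n α)

/-- `φ ∈ C_0^∞(Σ ∖ {0})`, `Σ = C_α`: near each point of the hypersurface `Σ ∖ {0}` the function
`φ` coincides on `Σ` with a smooth function of the ambient space, and it vanishes on `Σ` outside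
a compact subset of `Σ ∖ {0}`. The values of `φ` off `Σ` play no role. -/
def IsTest (m n : ℕ) (α : ℝ) (φ : Space m n → ℝ) : Prop :=
  (∀ x ∈ cone m n α \ {0}, ∃ g : Space m n → ℝ, ContDiff ℝ ∞ g ∧ φ =ᶠ[𝓝[cone m n α] x] g) ∧
    ∃ K : Set (Space m n), IsCompact K ∧ K ⊆ cone m n α \ {0} ∧ ∀ x ∈ cone m n α \ K, φ x = 0

/-- The integrand `(1 - |y|^{-(N-2-s)/2}) / |p - y|^{N+s}` of the constant `H(m,n,s)`. -/
def hardyConstantIntegrand {m n : ℕ} (s : ℝ) (p y : Space m n) : ℝ :=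
  (1 - ‖y‖ ^ (-(((m : ℝ) + n - 2 - s) / 2))) / ‖p - y‖ ^ ((m : ℝ) + n + s)

/-- `φ(x)^2 / |x|^{1+s}`. -/
def weightDensity {m n : ℕ} (s : ℝ) (φ : Space m n → ℝ) (x : Space m n) : ℝ :=
  φ x ^ 2 / ‖x‖ ^ (1 + s)

/-- `(φ(x) - φ(y))^2 / |x - y|^{N+s}`. -/
def energyDensity {m n : ℕ} (s : ℝ) (φ : Space m n → ℝ) (x y : Space m n) : ℝ :=
  (φ x - φ y) ^ 2 / ‖x - y‖ ^ ((m : ℝ) + n + s)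

/-- The Hardy inequality on `Σ = C_α` with constant `c`, for all `φ ∈ C_0^∞(Σ ∖ {0})`. -/
def HardyInequality (m n : ℕ) (s α c : ℝ) : Prop :=
  ∀ φ : Space m n → ℝ, IsTest m n α φ →
    c * ∫ x, weightDensity s φ x ∂surfaceMeasure m n α ≤
      1 / 2 * ∫ x, ∫ y, energyDensity s φ x y ∂surfaceMeasure m n α ∂surfaceMeasure m n α

end NonlocalCone

end

set_option linter.unusedSectionVars false

/-! In logarithmic polar coordinates x = e^t w, with w in the link of the cone, dilations become
translations in t. The surface measure is homogeneous of degree N - 1, hence equals e^{(N-1)t} dt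
dσ(w). With a = (N+s)/2, the kernel |x-y|^{-(N+s)} equals e^{-a(t+t')} K(t'-t, |w-w'|), where K(τ,
r) = (2 cosh τ - 2 + r²)^{-a} is even in τ. Put γ = (N-2-s)/2 = N - 1 - a and φ = e^{-γt} ψ. Then
the weighted norm is ∫ ψ², and for τ = t'-t the energy is ∬ (e^{γτ} ψ² + e^{-γτ} ψ'² - 2ψψ') K.

Away from the diagonal the bracket is (ψ-ψ')² + (e^{γτ}-1) ψ² + (e^{-γτ}-1) ψ'². Evenness of K
replaces both exponentials by cosh γτ. The group O(m) × O(n) acts transitively on the link, so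
integrating out one variable gives a constant, in the limit H = ∫ (cosh γτ - 1) K dτ dσ. Thus half
the energy is H ∫ ψ² plus half of ∬ (ψ-ψ')² K, which is the inequality
(`IsAngular.integral_offDiagonal_polarEnergy`, `IsAngular.polarConstant_mul_le`). For ψ = η(εt) the
remainder is O(ε) while ∫ ψ² is at least of order 1/ε, so H is optimal
(`exists_le_polarConstant_add`).

The same H is the principal value: the integrand becomes (e^{γτ}-1) K, that is, cosh γτ - 1 plus the
odd function sinh γτ. A Euclidean ball about p is not symmetric in τ, but the asymmetric part is a
shell so thin that the sinh part contributes O(δ^{1-s})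
(`IsAngular.exists_abs_integral_ballKernel_sinh_le`).

Convergence rests on the growth r^{N-2} of the σ-measure of caps, deduced from the fact that the
cone is locally a Lipschitz graph (`exists_antilipschitz_chart`, `IsAngular.integrable_majorant`).
-/

noncomputable section

open scoped Pointwise

namespace NonlocalCone

/-! ### Polar decomposition of homogeneous measures. -/

section Polar

variable {V : Type*} [NormedAddCommGroup V] [NormedSpace ℝ V] [MeasurableSpace V] [BorelSpace V]

/-- Logarithmic polar coordinates `(t, ω) ↦ e^t ω`. -/
def expPolar (z : ℝ × V) : V := Real.exp z.1 • z.2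

/-- The inverse `x ↦ (log |x|, x / |x|)` of `expPolar` away from the origin. -/
def logPolar (x : V) : ℝ × V := (Real.log ‖x‖, ‖x‖⁻¹ • x)

/-- The measure `|x|^{-d} μ` in logarithmic polar coordinates. -/
def cylinderMeasure (μ : Measure V) (d : ℝ) : Measure (ℝ × V) :=
  (μ.withDensity fun x => ENNReal.ofReal (‖x‖ ^ (-d))).map logPolar

/-- The angular part of a measure that is homogeneous of degree `d`. -/
def angularMeasure (μ : Measure V) (d : ℝ) : Measure V :=
  ((cylinderMeasure μ d).restrict (Icc 0 1 ×ˢ univ)).map Prod.snd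

/-- `μ` is homogeneous of degree `d`, has no mass at the origin and is finite on annuli. -/
structure IsHomogeneous (μ : Measure V) (d : ℝ) : Prop where
  singleton_zero : μ {0} = 0
  map_smul : ∀ t : ℝ, μ.map (fun x => Real.exp t • x) = ENNReal.ofReal (Real.exp (-d * t)) • μ
  annulus : ∀ R : ℝ, μ {x | x ≠ 0 ∧ |Real.log ‖x‖| ≤ R} < ⊤

theorem expPolar_logPolar {x : V} (hx : x ≠ 0) : expPolar (logPolar x) = x := by
  have : 0 < ‖x‖ := norm_pos_iff.2 hx
  simp [expPolar, logPolar, Real.exp_log this, smul_smul, this.ne']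

theorem logPolar_exp_smul (t : ℝ) {x : V} (hx : x ≠ 0) :
    logPolar (Real.exp t • x) = (t + (logPolar x).1, (logPolar x).2) := by
  have hx' : ‖x‖ ≠ 0 := norm_ne_zero_iff.2 hx
  have ht := Real.exp_ne_zero t
  simp only [logPolar, norm_smul, Real.norm_eq_abs, Real.abs_exp, Real.log_mul ht hx',
    Real.log_exp, mul_inv, smul_smul, Prod.mk.injEq, true_and]
  congr 1
  field_simp

theorem measurable_logPolar [SecondCountableTopology V] :
    Measurable (logPolar : V → ℝ × V) := by
  unfold logPolar; fun_prop

theorem measurable_expPolar [SecondCountableTopology V] :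
    Measurable (expPolar : ℝ × V → V) := by
  unfold expPolar; fun_prop

variable [SecondCountableTopology V] {μ : Measure V} {d : ℝ}

theorem lintegral_cylinderMeasure {f : ℝ × V → ENNReal} (hf : Measurable f) :
    ∫⁻ z, f z ∂cylinderMeasure μ d =
      ∫⁻ x, ENNReal.ofReal (‖x‖ ^ (-d)) * f (logPolar x) ∂μ := by
  rw [cylinderMeasure, lintegral_map hf measurable_logPolar,
    lintegral_withDensity_eq_lintegral_mul _ (by fun_prop)
      (show Measurable fun x : V => f (logPolar x) from hf.comp measurable_logPolar)]
  rfl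

theorem cylinderMeasure_apply {A : Set (ℝ × V)} (hA : MeasurableSet A) :
    cylinderMeasure μ d A = ∫⁻ x in logPolar ⁻¹' A, ENNReal.ofReal (‖x‖ ^ (-d)) ∂μ := by
  rw [cylinderMeasure, Measure.map_apply measurable_logPolar hA,
    withDensity_apply _ (measurable_logPolar hA)]

theorem IsHomogeneous.ae_ne_zero (hμ : IsHomogeneous μ d) : ∀ᵐ x ∂μ, x ≠ 0 :=
  measure_eq_zero_iff_ae_notMem.1 hμ.singleton_zero

/-- A dilation by e^t is a translation in log |x|. It produces the factor e^{-dt} in the measure and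
the same factor in the density |x|^{-d}, and the two cancel. -/
theorem IsHomogeneous.map_add_cylinderMeasure (hμ : IsHomogeneous μ d) (t : ℝ) :
    (cylinderMeasure μ d).map (fun z => (t + z.1, z.2)) = cylinderMeasure μ d := by
  have hm : Measurable (fun z : ℝ × V => (t + z.1, z.2)) := by fun_prop
  refine Measure.ext_of_lintegral _ fun f hf => ?_
  rw [lintegral_map hf hm,
    lintegral_cylinderMeasure (show Measurable fun z : ℝ × V => f (t + z.1, z.2) from hf.comp hm),
    lintegral_cylinderMeasure hf]
  have hF : Measurable fun x : V => ENNReal.ofReal (‖x‖ ^ (-d)) * f (logPolar x) :=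
    (by fun_prop : Measurable fun x : V => ENNReal.ofReal (‖x‖ ^ (-d))).mul
      (hf.comp measurable_logPolar)
  have h1 := lintegral_map (μ := μ) hF (measurable_const_smul (Real.exp t))
  have h2 : ∫⁻ x, ENNReal.ofReal (‖Real.exp t • x‖ ^ (-d)) * f (logPolar (Real.exp t • x)) ∂μ
      = ENNReal.ofReal (Real.exp (-d * t)) *
        ∫⁻ x, ENNReal.ofReal (‖x‖ ^ (-d)) * f (t + (logPolar x).1, (logPolar x).2) ∂μ := by
    rw [← lintegral_const_mul _ (by
      exact (by fun_prop : Measurable fun x : V => ENNReal.ofReal (‖x‖ ^ (-d))).mul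
        ((hf.comp hm).comp measurable_logPolar))]
    refine lintegral_congr_ae ?_
    filter_upwards [hμ.ae_ne_zero] with x hx
    rw [logPolar_exp_smul t hx, norm_smul, Real.norm_eq_abs, Real.abs_exp,
      Real.mul_rpow (Real.exp_pos t).le (norm_nonneg x), ← Real.exp_mul,
      ENNReal.ofReal_mul (Real.exp_pos _).le, mul_assoc, mul_comm t (-d)]
  have h3 := hμ.map_smul t
  simp only [h3, lintegral_smul_measure, smul_eq_mul] at h1
  rw [h2] at h1
  exact ((ENNReal.mul_right_inj (by simp [Real.exp_pos]) ENNReal.ofReal_ne_top).1 h1).symm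

theorem IsHomogeneous.cylinderMeasure_lt_top (hμ : IsHomogeneous μ d) (R : ℝ) :
    cylinderMeasure μ d (Icc (-R) R ×ˢ univ) < ⊤ := by
  rw [cylinderMeasure_apply (measurableSet_Icc.prod .univ)]
  have hsub : logPolar ⁻¹' (Icc (-R) R ×ˢ (univ : Set V)) ≤ᵐ[μ]
      {x : V | x ≠ 0 ∧ |Real.log ‖x‖| ≤ R} := by
    filter_upwards [hμ.ae_ne_zero] with x hx h
    exact ⟨hx, abs_le.2 h.1⟩
  refine (lintegral_mono_set' hsub).trans_lt ?_
  refine lt_of_le_of_lt (setLIntegral_mono' (g := fun _ => ENNReal.ofReal (Real.exp (|d| * R)))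
    ((measurableSet_singleton (0 : V)).compl.inter
      (measurableSet_le (f := fun x : V => |Real.log ‖x‖|) (g := fun _ => R) (by fun_prop)
        (by fun_prop))) fun x hx => ?_) ?_
  · refine ENNReal.ofReal_le_ofReal ?_
    rw [Real.rpow_def_of_pos (norm_pos_iff.2 hx.1)]
    refine Real.exp_le_exp.2 ?_
    calc Real.log ‖x‖ * -d ≤ |Real.log ‖x‖ * -d| := le_abs_self _
      _ = |d| * |Real.log ‖x‖| := by rw [abs_mul, abs_neg, mul_comm]
      _ ≤ |d| * R := by gcongr; exact hx.2
  · rw [setLIntegral_const]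
    exact ENNReal.mul_lt_top ENNReal.ofReal_lt_top (hμ.annulus R)

theorem angularMeasure_apply {A : Set V} (hA : MeasurableSet A) :
    angularMeasure μ d A = cylinderMeasure μ d (Icc 0 1 ×ˢ A) := by
  rw [angularMeasure, Measure.map_apply measurable_snd hA,
    Measure.restrict_apply (measurable_snd hA)]
  congr 1
  ext z
  simp [and_comm]

theorem IsHomogeneous.isFiniteMeasure (hμ : IsHomogeneous μ d) :
    IsFiniteMeasure (angularMeasure μ d) := by
  refine ⟨?_⟩
  rw [angularMeasure_apply .univ]
  refine (measure_mono ?_).trans_lt (hμ.cylinderMeasure_lt_top 1)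
  exact prod_mono (Icc_subset_Icc (by norm_num) le_rfl) subset_rfl

/-- A homogeneous measure is a product in logarithmic polar coordinates. -/
theorem IsHomogeneous.cylinderMeasure_eq_prod (hμ : IsHomogeneous μ d) :
    cylinderMeasure μ d = (volume : Measure ℝ).prod (angularMeasure μ d) := by
  have := hμ.isFiniteMeasure
  symm
  refine Measure.prod_eq fun B A hB hA => ?_
  -- For a fixed angular set A this is a translation invariant, locally finite measure on the line,
  -- hence a multiple of Lebesgue measure.
  set ν : Measure ℝ := ((cylinderMeasure μ d).restrict (univ ×ˢ A)).map Prod.fst with hν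
  have hνB : ∀ {B : Set ℝ}, MeasurableSet B → ν B = cylinderMeasure μ d (B ×ˢ A) := by
    intro B hB
    rw [hν, Measure.map_apply measurable_fst hB, Measure.restrict_apply (measurable_fst hB)]
    congr 1
    ext z
    simp
  have hinv : ν.IsAddLeftInvariant := by
    refine ⟨fun t => ?_⟩
    ext B hB
    rw [Measure.map_apply (by fun_prop) hB, hνB hB, hνB (by exact measurable_const_add t hB)]
    conv_rhs => rw [← hμ.map_add_cylinderMeasure t]
    rw [Measure.map_apply (by fun_prop) (hB.prod hA)]
    rfl
  have hfin : IsFiniteMeasureOnCompacts ν := by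
    refine ⟨fun K hK => ?_⟩
    obtain ⟨R, hR⟩ := hK.isBounded.subset_closedBall 0
    rw [hνB hK.measurableSet]
    refine (measure_mono (prod_mono (hR.trans ?_) (subset_univ A))).trans_lt
      (hμ.cylinderMeasure_lt_top R)
    rw [Real.closedBall_eq_Icc]
    simp
  obtain ⟨c, hc⟩ : ∃ c : NNReal, ν = c • (volume : Measure ℝ) :=
    ⟨_, Measure.isAddLeftInvariant_eq_smul ν volume⟩
  -- The window [0, 1] defining the angular measure has length one, so the Haar constant is the
  -- angular mass of A.
  have h1 : (angularMeasure μ d) A = c := by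
    rw [angularMeasure_apply hA, ← hνB measurableSet_Icc, hc, Measure.smul_apply,
      ENNReal.smul_def, smul_eq_mul, Real.volume_Icc]
    simp
  rw [h1, ← hνB hB, hc, Measure.smul_apply, ENNReal.smul_def, smul_eq_mul, mul_comm]

/-- Integration in logarithmic polar coordinates. -/
theorem IsHomogeneous.map_expPolar (hμ : IsHomogeneous μ d) :
    (((volume : Measure ℝ).prod (angularMeasure μ d)).withDensity
      fun z => ENNReal.ofReal (Real.exp (d * z.1))).map expPolar = μ := by
  have hw : Measurable fun z : ℝ × V => ENNReal.ofReal (Real.exp (d * z.1)) := by fun_prop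
  refine Measure.ext_of_lintegral _ fun f hf => ?_
  rw [lintegral_map hf measurable_expPolar,
    lintegral_withDensity_eq_lintegral_mul _ hw
      (show Measurable fun z : ℝ × V => f (expPolar z) from hf.comp measurable_expPolar),
    ← hμ.cylinderMeasure_eq_prod,
    lintegral_cylinderMeasure (hw.mul
      (show Measurable fun z : ℝ × V => f (expPolar z) from hf.comp measurable_expPolar))]
  refine lintegral_congr_ae ?_
  filter_upwards [hμ.ae_ne_zero] with x hx
  have hx' : 0 < ‖x‖ := norm_pos_iff.2 hx
  simp only [Pi.mul_apply, expPolar_logPolar hx]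
  rw [← mul_assoc, ← ENNReal.ofReal_mul (by positivity)]
  have : ‖x‖ ^ (-d) * Real.exp (d * (logPolar x).1) = 1 := by
    simp only [logPolar]
    rw [Real.rpow_def_of_pos hx', ← Real.exp_add]
    simp [mul_comm]
  rw [this]
  simp

theorem IsHomogeneous.ae_angularMeasure (hμ : IsHomogeneous μ d) {P : V → Prop}
    (hP : MeasurableSet {w | P w}) (h : ∀ᵐ x ∂μ, x ≠ 0 → P (‖x‖⁻¹ • x)) :
    ∀ᵐ w ∂angularMeasure μ d, P w := by
  rw [ae_iff]
  have hc : MeasurableSet {w | ¬ P w} := hP.compl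
  rw [angularMeasure_apply hc, cylinderMeasure_apply (measurableSet_Icc.prod hc)]
  refine setLIntegral_measure_zero _ _ ?_
  refine measure_eq_zero_iff_ae_notMem.2 ?_
  filter_upwards [h, hμ.ae_ne_zero] with x hx h0 hmem
  exact hmem.2 (hx h0)

theorem IsHomogeneous.integrable_iff (hμ : IsHomogeneous μ d) {f : V → ℝ} (hf : Measurable f) :
    Integrable f μ ↔ Integrable (fun z : ℝ × V => Real.exp (d * z.1) * f (expPolar z))
      ((volume : Measure ℝ).prod (angularMeasure μ d)) := by
  conv_lhs => rw [← hμ.map_expPolar]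
  rw [integrable_map_measure hf.aestronglyMeasurable measurable_expPolar.aemeasurable,
    integrable_withDensity_iff_integrable_smul' (by fun_prop) (by simp)]
  simp only [ENNReal.toReal_ofReal (Real.exp_pos _).le, smul_eq_mul, Function.comp]

theorem IsHomogeneous.integral_eq (hμ : IsHomogeneous μ d) {f : V → ℝ} (hf : Measurable f) :
    ∫ x, f x ∂μ = ∫ z, Real.exp (d * z.1) * f (expPolar z)
      ∂((volume : Measure ℝ).prod (angularMeasure μ d)) := by
  conv_lhs => rw [← hμ.map_expPolar]
  rw [integral_map measurable_expPolar.aemeasurable hf.aestronglyMeasurable,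
    integral_withDensity_eq_integral_toReal_smul (by fun_prop) (by simp)]
  simp only [ENNReal.toReal_ofReal (Real.exp_pos _).le, smul_eq_mul]

theorem IsHomogeneous.map_expPolar_prod (hμ : IsHomogeneous μ d) :
    ((((volume : Measure ℝ).prod (angularMeasure μ d)).prod
      ((volume : Measure ℝ).prod (angularMeasure μ d))).withDensity
      fun z => ENNReal.ofReal (Real.exp (d * z.1.1)) * ENNReal.ofReal (Real.exp (d * z.2.1))).map
      (Prod.map expPolar expPolar) = μ.prod μ := by
  have := hμ.isFiniteMeasure
  have hw : Measurable fun z : ℝ × V => ENNReal.ofReal (Real.exp (d * z.1)) := by fun_prop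
  have hs : SFinite ((((volume : Measure ℝ).prod (angularMeasure μ d)).withDensity
      fun z => ENNReal.ofReal (Real.exp (d * z.1)))) := inferInstance
  rw [← prod_withDensity hw hw, ← Measure.map_prod_map _ _ measurable_expPolar measurable_expPolar,
    hμ.map_expPolar]

theorem IsHomogeneous.integrable_prod_iff (hμ : IsHomogeneous μ d) {F : V × V → ℝ}
    (hF : Measurable F) :
    Integrable F (μ.prod μ) ↔ Integrable (fun z : (ℝ × V) × (ℝ × V) =>
        Real.exp (d * z.1.1) * Real.exp (d * z.2.1) * F (expPolar z.1, expPolar z.2))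
      (((volume : Measure ℝ).prod (angularMeasure μ d)).prod
        ((volume : Measure ℝ).prod (angularMeasure μ d))) := by
  have hm := (measurable_expPolar (V := V)).prodMap (measurable_expPolar (V := V))
  rw [← hμ.map_expPolar_prod,
    integrable_map_measure hF.aestronglyMeasurable hm.aemeasurable,
    integrable_withDensity_iff_integrable_smul' (by fun_prop)
      (.of_forall fun z => ENNReal.mul_lt_top ENNReal.ofReal_lt_top ENNReal.ofReal_lt_top)]
  simp only [ENNReal.toReal_mul, ENNReal.toReal_ofReal (Real.exp_pos _).le, smul_eq_mul,
    Function.comp, Prod.map]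

theorem IsHomogeneous.integral_prod_eq (hμ : IsHomogeneous μ d) {F : V × V → ℝ}
    (hF : Measurable F) :
    ∫ z, F z ∂(μ.prod μ) = ∫ z : (ℝ × V) × (ℝ × V),
        Real.exp (d * z.1.1) * Real.exp (d * z.2.1) * F (expPolar z.1, expPolar z.2)
      ∂(((volume : Measure ℝ).prod (angularMeasure μ d)).prod
        ((volume : Measure ℝ).prod (angularMeasure μ d))) := by
  have hm := (measurable_expPolar (V := V)).prodMap (measurable_expPolar (V := V))
  rw [← hμ.map_expPolar_prod,
    integral_map hm.aemeasurable hF.aestronglyMeasurable,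
    integral_withDensity_eq_integral_toReal_smul (by fun_prop)
      (.of_forall fun z => ENNReal.mul_lt_top ENNReal.ofReal_lt_top ENNReal.ofReal_lt_top)]
  simp only [ENNReal.toReal_mul, ENNReal.toReal_ofReal (Real.exp_pos _).le, smul_eq_mul, Prod.map]

end Polar

/-! ### Caps and isometries of the angular measure. -/

section AngularMeasure

variable {V : Type*} [NormedAddCommGroup V] [NormedSpace ℝ V] [MeasurableSpace V] [BorelSpace V]
  [SecondCountableTopology V] {μ : Measure V} {d : ℝ}

/-- Spherical caps are controlled by balls. -/
theorem IsHomogeneous.mul_angularMeasure_closedBall_le (hμ : IsHomogeneous μ d) (hd : 0 ≤ d)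
    {p : V} {r : ℝ} (hr0 : 0 ≤ r) (hr1 : r ≤ 1) :
    ENNReal.ofReal r * angularMeasure μ d (Metric.closedBall p r)
      ≤ μ (Metric.closedBall p (3 * r)) := by
  have := hμ.isFiniteMeasure
  have h1 : ENNReal.ofReal r * angularMeasure μ d (Metric.closedBall p r)
      = cylinderMeasure μ d (Icc 0 r ×ˢ Metric.closedBall p r) := by
    rw [hμ.cylinderMeasure_eq_prod, Measure.prod_prod, Real.volume_Icc, sub_zero]
  rw [h1, cylinderMeasure_apply (measurableSet_Icc.prod measurableSet_closedBall)]
  have hm : MeasurableSet ((logPolar : V → ℝ × V) ⁻¹' (Icc 0 r ×ˢ Metric.closedBall p r)) :=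
    measurable_logPolar (measurableSet_Icc.prod measurableSet_closedBall)
  -- If log |x| lies in [0, r] and x/|x| is within r of p, then |x| - 1 ≤ e^r - 1 ≤ 2r puts x within
  -- 3r of p. Since |x| ≥ 1, the density |x|^{-d} is at most 1 there.
  have key : ∀ x : V, x ≠ 0 → x ∈ logPolar ⁻¹' (Icc 0 r ×ˢ Metric.closedBall p r) →
      1 ≤ ‖x‖ ∧ x ∈ Metric.closedBall p (3 * r) := by
    rintro x hx ⟨⟨h0, h2⟩, h3⟩
    simp only [logPolar, Metric.mem_closedBall, dist_eq_norm] at h0 h2 h3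
    have hx' : 0 < ‖x‖ := norm_pos_iff.2 hx
    have hx1 : 1 ≤ ‖x‖ := (Real.log_nonneg_iff hx').1 h0
    refine ⟨hx1, ?_⟩
    have h4 : ‖x‖ ≤ Real.exp r := by
      rw [← Real.exp_log hx']; exact Real.exp_le_exp.2 h2
    have h5 : Real.exp r - 1 ≤ 2 * r := by
      have := Real.abs_exp_sub_one_le (x := r) (by rwa [abs_of_nonneg hr0])
      rw [abs_of_nonneg hr0] at this
      exact (le_abs_self _).trans this
    have h6 : ‖x - ‖x‖⁻¹ • x‖ = ‖x‖ - 1 := by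
      have : x - ‖x‖⁻¹ • x = (1 - ‖x‖⁻¹) • x := by rw [sub_smul, one_smul]
      rw [this, norm_smul, Real.norm_of_nonneg (sub_nonneg.2 (inv_le_one_of_one_le₀ hx1)),
        sub_mul, one_mul, inv_mul_cancel₀ hx'.ne']
    rw [Metric.mem_closedBall, dist_eq_norm]
    calc ‖x - p‖ = ‖(x - ‖x‖⁻¹ • x) + (‖x‖⁻¹ • x - p)‖ := by rw [sub_add_sub_cancel]
      _ ≤ ‖x - ‖x‖⁻¹ • x‖ + ‖‖x‖⁻¹ • x - p‖ := norm_add_le _ _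
      _ ≤ 3 * r := by rw [h6]; linarith
  calc ∫⁻ x in logPolar ⁻¹' (Icc 0 r ×ˢ Metric.closedBall p r), ENNReal.ofReal (‖x‖ ^ (-d)) ∂μ
      ≤ ∫⁻ x in logPolar ⁻¹' (Icc 0 r ×ˢ Metric.closedBall p r), 1 ∂μ := by
        refine setLIntegral_mono_ae' hm ?_
        filter_upwards [hμ.ae_ne_zero] with x hx hmem
        rw [ENNReal.ofReal_le_one]
        exact Real.rpow_le_one_of_one_le_of_nonpos (key x hx hmem).1 (by linarith)
    _ = μ (logPolar ⁻¹' (Icc 0 r ×ˢ Metric.closedBall p r)) := setLIntegral_one _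
    _ ≤ μ (Metric.closedBall p (3 * r)) := by
        refine measure_mono_ae ?_
        filter_upwards [hμ.ae_ne_zero] with x hx hmem
        exact (key x hx hmem).2

theorem measurePreserving_angularMeasure (R : V ≃ₗᵢ[ℝ] V) (hR : μ.map R = μ) :
    MeasurePreserving R (angularMeasure μ d) (angularMeasure μ d) := by
  have hRm : Measurable R := R.continuous.measurable
  refine ⟨hRm, ?_⟩
  ext A hA
  have hS := measurableSet_Icc (a := (0 : ℝ)) (b := 1)
  rw [Measure.map_apply hRm hA, angularMeasure_apply hA, angularMeasure_apply (hRm hA),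
    cylinderMeasure_apply (hS.prod hA), cylinderMeasure_apply (hS.prod (hRm hA))]
  conv_rhs => rw [← hR]
  rw [setLIntegral_map (measurable_logPolar (hS.prod hA)) (by fun_prop) hRm]
  have hset : R ⁻¹' (logPolar ⁻¹' (Icc (0 : ℝ) 1 ×ˢ A)) =
      logPolar ⁻¹' (Icc (0 : ℝ) 1 ×ˢ (R ⁻¹' A)) := by
    ext x
    simp [logPolar]
  rw [hset]
  simp

theorem IsHomogeneous.angularMeasure_ne_zero (hμ : IsHomogeneous μ d) (h : μ ≠ 0) :
    angularMeasure μ d ≠ 0 := by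
  intro h0
  refine h ?_
  rw [← hμ.map_expPolar, h0]
  simp

end AngularMeasure

/-! ### Hausdorff measure under Lipschitz maps, and hyperplane coordinates. -/

section Hausdorff

/-- Bounds the area of a piece of the cone by the volume of its image in a chart. -/
theorem euclideanHausdorffMeasure_le_image {X Y : Type*} [MetricSpace X] [MeasurableSpace X]
    [BorelSpace X] [MetricSpace Y] [MeasurableSpace Y] [BorelSpace Y] {f : X → Y} {S : Set X}
    {K : NNReal} (k : ℕ) (h : ∀ x ∈ S, ∀ y ∈ S, dist x y ≤ K * dist (f x) (f y)) :
    (μHE[k] : Measure X) S ≤ (K : ENNReal) ^ k * (μHE[k] : Measure Y) (f '' S) := by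
  have ha : AntilipschitzWith K (S.domRestrict f) :=
    AntilipschitzWith.of_le_mul_dist fun x y => h x x.2 y y.2
  have h1 := ha.le_hausdorffMeasure_image (d := (k : ℝ)) (by positivity) univ
  rw [image_univ, range_domRestrict] at h1
  have h2 : (μH[(k : ℝ)] : Measure X) S = (μH[(k : ℝ)] : Measure S) univ := by
    rw [← isometry_subtype_coe.hausdorffMeasure_image (Or.inl (by positivity)) univ]
    simp
  rw [Measure.euclideanHausdorffMeasure_def, Measure.euclideanHausdorffMeasure_def,
    Measure.smul_apply, Measure.smul_apply, h2, ENNReal.smul_def, ENNReal.smul_def, smul_eq_mul,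
    smul_eq_mul, mul_left_comm]
  gcongr
  simpa using h1

theorem euclideanHausdorffMeasure_image_le {X Y : Type*} [MetricSpace X] [MeasurableSpace X]
    [BorelSpace X] [MetricSpace Y] [MeasurableSpace Y] [BorelSpace Y] {f : X → Y}
    (hf : LipschitzWith 1 f) (k : ℕ) (S : Set X) :
    (μHE[k] : Measure Y) (f '' S) ≤ (μHE[k] : Measure X) S := by
  have h1 := hf.hausdorffMeasure_image_le (d := (k : ℝ)) (by positivity) S
  rw [Measure.euclideanHausdorffMeasure_def, Measure.euclideanHausdorffMeasure_def,
    Measure.smul_apply, Measure.smul_apply]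
  rw [ENNReal.smul_def, ENNReal.smul_def, smul_eq_mul, smul_eq_mul]
  gcongr
  simpa using h1

/-- Orthonormal coordinates on the hyperplane orthogonal to a unit vector. -/
theorem exists_hyperplane_coordinates {V : Type*} [NormedAddCommGroup V] [InnerProductSpace ℝ V]
    [FiniteDimensional ℝ V] {k : ℕ} (hk : Module.finrank ℝ V = k + 1) {e : V} (he : ‖e‖ = 1) :
    ∃ (i : EuclideanSpace ℝ (Fin k) →ₗᵢ[ℝ] V) (f : V →L[ℝ] EuclideanSpace ℝ (Fin k)),
      (∀ w, f (i w) = w) ∧ (∀ w, inner ℝ e (i w) = 0) ∧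
        ∀ h, i (f h) = h - inner ℝ e h • e := by
  have : Fact (Module.finrank ℝ V = k + 1) := ⟨hk⟩
  have he0 : e ≠ 0 := norm_ne_zero_iff.1 (by rw [he]; norm_num)
  let b := OrthonormalBasis.fromOrthogonalSpanSingleton (𝕜 := ℝ) k he0
  let W := (Submodule.span ℝ {e})ᗮ
  refine ⟨W.subtypeₗᵢ.comp b.repr.symm.toLinearIsometry,
    (b.repr.toContinuousLinearEquiv : W →L[ℝ] EuclideanSpace ℝ (Fin k)).comp
      W.orthogonalProjectionOnto, fun w => ?_, fun w => ?_, fun h => ?_⟩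
  · simp [W]
  · exact Submodule.mem_orthogonal_singleton_iff_inner_right.1 (b.repr.symm w).2
  · have := Submodule.starProjection_orthogonal_val (K := Submodule.span ℝ {e}) h
    simp only [ContinuousLinearMap.coe_comp, Function.comp, LinearIsometry.coe_comp]
    simp [W, Submodule.starProjection_singleton, he]

end Hausdorff

/-! ### Geometry of the cone: local charts, area growth, symmetries. -/

section Geometry

variable {m n : ℕ} {α : ℝ}

theorem isClosed_cone : IsClosed (cone m n α) := by
  unfold cone
  exact isClosed_eq (by fun_prop) (by fun_prop)

theorem measurableSet_cone : MeasurableSet (cone m n α) := isClosed_cone.measurableSet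

theorem smul_mem_cone {x : Space m n} (hx : x ∈ cone m n α) (r : ℝ) : r • x ∈ cone m n α := by
  simp only [cone, mem_ofPred_eq, WithLp.smul_fst, WithLp.smul_snd, norm_smul] at hx ⊢
  rw [hx]; ring

theorem smul_mem_cone_iff {x : Space m n} {r : ℝ} (hr : r ≠ 0) :
    r • x ∈ cone m n α ↔ x ∈ cone m n α := by
  refine ⟨fun h => ?_, fun h => smul_mem_cone h r⟩
  simpa [smul_smul, hr] using smul_mem_cone h r⁻¹

/-- `|z| / |x|` for a nonzero point `x = (y, z)` of the cone. -/
def coneSine (α : ℝ) : ℝ := α / √(1 + α ^ 2)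

theorem coneSine_pos (hα : 0 < α) : 0 < coneSine α := by unfold coneSine; positivity

theorem norm_sq_of_mem_cone {x : Space m n} (hx : x ∈ cone m n α) :
    ‖x‖ ^ 2 = (1 + α ^ 2) * ‖x.fst‖ ^ 2 := by
  have h : ‖x.snd‖ = α * ‖x.fst‖ := hx
  rw [WithLp.prod_norm_sq_eq_of_L2, h]; ring

theorem norm_eq_of_mem_cone {x : Space m n} (hx : x ∈ cone m n α) :
    ‖x‖ = √(1 + α ^ 2) * ‖x.fst‖ := by
  rw [← Real.sqrt_sq (norm_nonneg x), norm_sq_of_mem_cone hx, Real.sqrt_mul (by positivity),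
    Real.sqrt_sq (norm_nonneg _)]

theorem norm_snd_of_mem_cone {x : Space m n} (hx : x ∈ cone m n α) :
    ‖x.snd‖ = coneSine α * ‖x‖ := by
  have h : ‖x.snd‖ = α * ‖x.fst‖ := hx
  have : √(1 + α ^ 2) ≠ 0 := by positivity
  rw [h, norm_eq_of_mem_cone hx, coneSine]
  field_simp

theorem finrank_space : Module.finrank ℝ (Space m n) = m + n := by
  rw [LinearEquiv.finrank_eq (WithLp.linearEquiv 2 ℝ _), Module.finrank_prod]
  simp

/-- The bilinear form vanishing on the cone. -/
def coneForm (α : ℝ) (v w : Space m n) : ℝ :=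
  α ^ 2 * inner ℝ v.fst w.fst - inner ℝ v.snd w.snd

theorem norm_fst_le (x : Space m n) : ‖x.fst‖ ≤ ‖x‖ := by
  have := WithLp.prod_norm_sq_eq_of_L2 x
  exact le_of_sq_le_sq (by nlinarith [sq_nonneg ‖x.snd‖]) (norm_nonneg x)

theorem norm_snd_le (x : Space m n) : ‖x.snd‖ ≤ ‖x‖ := by
  have := WithLp.prod_norm_sq_eq_of_L2 x
  exact le_of_sq_le_sq (by nlinarith [sq_nonneg ‖x.fst‖]) (norm_nonneg x)

theorem abs_coneForm_le (v w : Space m n) :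
    |coneForm α v w| ≤ (1 + α ^ 2) * (‖v‖ * ‖w‖) := by
  have h1 : |inner ℝ v.fst w.fst| ≤ ‖v‖ * ‖w‖ :=
    (abs_real_inner_le_norm _ _).trans (by gcongr <;> apply norm_fst_le)
  have h2 : |inner ℝ v.snd w.snd| ≤ ‖v‖ * ‖w‖ :=
    (abs_real_inner_le_norm _ _).trans (by gcongr <;> apply norm_snd_le)
  calc |coneForm α v w| ≤ |α ^ 2 * inner ℝ v.fst w.fst| + |inner ℝ v.snd w.snd| := abs_sub _ _
    _ ≤ α ^ 2 * (‖v‖ * ‖w‖) + ‖v‖ * ‖w‖ := by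
        rw [abs_mul, abs_of_nonneg (sq_nonneg α)]; gcongr
    _ = _ := by ring

/-- Polarization: for the form B, B(x-y, x+y) = B(x,x) - B(y,y), and both terms vanish on the cone.
This relation controls the slope of chords in the chart. -/
theorem coneForm_sub_add {x y : Space m n} (hx : x ∈ cone m n α) (hy : y ∈ cone m n α) :
    coneForm α (x - y) (x + y) = 0 := by
  have h1 : ‖x.snd‖ = α * ‖x.fst‖ := hx
  have h2 : ‖y.snd‖ = α * ‖y.fst‖ := hy
  simp only [coneForm, WithLp.sub_fst, WithLp.add_fst, WithLp.sub_snd, WithLp.add_snd,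
    inner_add_right, inner_sub_left, real_inner_self_eq_norm_sq]
  rw [h1, h2, real_inner_comm y.fst x.fst, real_inner_comm y.snd x.snd]
  ring

theorem snd_ne_zero_of_mem_cone (hα : 0 < α) {p : Space m n} (hp : p ∈ cone m n α) (h0 : p ≠ 0) :
    0 < ‖p.snd‖ := by
  rw [norm_snd_of_mem_cone hp]
  exact mul_pos (coneSine_pos hα) (norm_pos_iff.2 h0)

/-- The cone is locally a Lipschitz graph over a hyperplane. -/
theorem exists_antilipschitz_chart (hm : 1 ≤ m) (hα : 0 < α) {p : Space m n}
    (hp : p ∈ cone m n α) (h0 : p ≠ 0) :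
    ∃ f : Space m n →L[ℝ] EuclideanSpace ℝ (Fin (m + n - 1)), (∀ x, ‖f x‖ ≤ ‖x‖) ∧
      ∀ x ∈ cone m n α ∩ Metric.closedBall p (coneSine α * ‖p‖ / 2),
      ∀ y ∈ cone m n α ∩ Metric.closedBall p (coneSine α * ‖p‖ / 2),
        ‖x - y‖ ≤ (1 + (1 + α ^ 2) * (2 / coneSine α + 1)) * ‖f x - f y‖ := by
  have hc := coneSine_pos hα
  have hb := snd_ne_zero_of_mem_cone hα hp h0
  have hbeq := norm_snd_of_mem_cone hp
  set b := ‖p.snd‖ with hbdef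
  -- The chart is the orthogonal projection along the direction of the z-component of p, which is
  -- transversal to the cone at p.
  set e : Space m n := WithLp.toLp 2 (0, b⁻¹ • p.snd) with hedef
  have he : ‖e‖ = 1 := by
    have : ‖e‖ ^ 2 = 1 := by
      rw [WithLp.prod_norm_sq_eq_of_L2]
      simp [e, norm_smul, ← hbdef, abs_of_pos hb, hb.ne']
    nlinarith [norm_nonneg e]
  have hinner : ∀ x : Space m n, inner ℝ e x = inner ℝ e.snd x.snd := by
    intro x
    rw [WithLp.prod_inner_apply]
    change inner ℝ (0 : EuclideanSpace ℝ (Fin m)) x.fst + inner ℝ e.snd x.snd = _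
    rw [inner_zero_left, zero_add]
  have hep : inner ℝ e p = b := by
    rw [hinner]
    change inner ℝ (b⁻¹ • p.snd) p.snd = b
    rw [inner_smul_left, real_inner_self_eq_norm_sq, ← hbdef]
    simp; field_simp
  obtain ⟨i, f, hfi, hei, hif⟩ :=
    exists_hyperplane_coordinates (V := Space m n) (k := m + n - 1) (e := e)
      (by rw [finrank_space]; omega) he
  have hnf : ∀ h, ‖f h‖ = ‖h - inner ℝ e h • e‖ := fun h => by rw [← hif, i.norm_map]
  have hdecomp : ∀ h, ‖h‖ ^ 2 = ‖f h‖ ^ 2 + (inner ℝ e h) ^ 2 := by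
    intro h
    rw [hnf, norm_sub_sq_real, inner_smul_right, norm_smul, he, real_inner_comm]
    simp only [Real.norm_eq_abs, mul_one, sq_abs]
    ring
  refine ⟨f, fun h => ?_, ?_⟩
  · exact le_of_sq_le_sq (by nlinarith [hdecomp h, sq_nonneg (inner ℝ e h)]) (norm_nonneg h)
  rintro x ⟨hx, hxp⟩ y ⟨hy, hyp⟩
  rw [Metric.mem_closedBall, dist_eq_norm, ← hbeq] at hxp hyp
  have hlow : ∀ x : Space m n, ‖x - p‖ ≤ b / 2 → b / 2 ≤ inner ℝ e x := by
    intro x hx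
    have h1 : inner ℝ e x = b + inner ℝ e (x - p) := by rw [inner_sub_right, hep]; ring
    have h2 := abs_real_inner_le_norm e (x - p)
    rw [he, one_mul] at h2
    have := (abs_le.1 (h2.trans hx)).1
    linarith
  have hnorm : ∀ x : Space m n, ‖x - p‖ ≤ b / 2 → ‖x‖ ≤ ‖p‖ + b / 2 := by
    intro x hx
    have := norm_add_le p (x - p)
    rw [add_sub_cancel] at this
    linarith
  set a := inner ℝ e (x - y) with ha
  set v := x - y - a • e with hv
  -- Here x - y = v + a e with v orthogonal to e. The form vanishes on (x-y, x+y) and equals -⟨e, ·⟩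
  -- against e. Near p the product ⟨e, x+y⟩ is at least b, so |a| is controlled by ‖v‖.
  have h1 : coneForm α v (x + y) = a * inner ℝ e (x + y) := by
    have h2 := coneForm_sub_add hx hy
    have h3 : coneForm α v (x + y) = coneForm α (x - y) (x + y) - a * coneForm α e (x + y) := by
      simp only [coneForm, hv, WithLp.sub_fst, WithLp.sub_snd, WithLp.smul_fst, WithLp.smul_snd,
        inner_sub_left, real_inner_smul_left]
      ring
    have h4 : coneForm α e (x + y) = - inner ℝ e (x + y) := by
      rw [hinner, coneForm]
      change α ^ 2 * inner ℝ (0 : EuclideanSpace ℝ (Fin m)) (x + y).fst - _ = _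
      rw [inner_zero_left]; ring
    rw [h3, h2, h4]; ring
  have h2 : |a| * b ≤ (1 + α ^ 2) * (‖v‖ * (b * (2 / coneSine α + 1))) := by
    have h3 : b ≤ inner ℝ e (x + y) := by
      rw [inner_add_right]; linarith [hlow x hxp, hlow y hyp]
    have h4 : ‖x + y‖ ≤ b * (2 / coneSine α + 1) := by
      have : b * (2 / coneSine α + 1) = 2 * ‖p‖ + b := by rw [hbeq]; field_simp
      rw [this]
      linarith [norm_add_le x y, hnorm x hxp, hnorm y hyp]
    calc |a| * b ≤ |a| * |inner ℝ e (x + y)| := by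
          gcongr; exact h3.trans (le_abs_self _)
      _ = |coneForm α v (x + y)| := by rw [h1, abs_mul]
      _ ≤ (1 + α ^ 2) * (‖v‖ * ‖x + y‖) := abs_coneForm_le _ _
      _ ≤ _ := by gcongr
  have h3 : |a| ≤ (1 + α ^ 2) * (2 / coneSine α + 1) * ‖v‖ := by
    refine le_of_mul_le_mul_right (h2.trans (le_of_eq ?_)) hb
    ring
  rw [← map_sub, hnf, ← ha, ← hv]
  calc ‖x - y‖ = ‖v + a • e‖ := by rw [hv, sub_add_cancel]
    _ ≤ ‖v‖ + ‖a • e‖ := norm_add_le _ _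
    _ = ‖v‖ + |a| := by rw [norm_smul, he, mul_one, Real.norm_eq_abs]
    _ ≤ _ := by linarith

/-- The surface measure of small balls centred on the cone. -/
theorem exists_surfaceMeasure_closedBall_le (hm : 1 ≤ m) (hα : 0 < α) :
    ∃ C : ENNReal, C ≠ ⊤ ∧ ∀ p ∈ cone m n α, p ≠ 0 → ∀ r : ℝ, 0 ≤ r → r ≤ coneSine α * ‖p‖ / 2 →
      surfaceMeasure m n α (Metric.closedBall p r) ≤ C * ENNReal.ofReal r ^ (m + n - 1) := by
  have hc := coneSine_pos hα
  set K : NNReal := ⟨1 + (1 + α ^ 2) * (2 / coneSine α + 1), by positivity⟩ with hK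
  refine ⟨(K : ENNReal) ^ (m + n - 1) *
    volume (Metric.ball (0 : EuclideanSpace ℝ (Fin (m + n - 1))) 1),
    ENNReal.mul_ne_top (by simp) measure_ball_lt_top.ne, fun p hp h0 r hr hr' => ?_⟩
  obtain ⟨f, hf1, hf⟩ := exists_antilipschitz_chart hm hα hp h0
  rw [surfaceMeasure, Measure.restrict_apply measurableSet_closedBall, inter_comm]
  have hsub : cone m n α ∩ Metric.closedBall p r ⊆
      cone m n α ∩ Metric.closedBall p (coneSine α * ‖p‖ / 2) :=
    inter_subset_inter_right _ (Metric.closedBall_subset_closedBall hr')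
  refine (euclideanHausdorffMeasure_le_image (f := f) (K := K) _ fun x hx y hy => ?_).trans ?_
  · rw [dist_eq_norm, dist_eq_norm]
    exact hf x (hsub hx) y (hsub hy)
  · rw [mul_assoc]
    gcongr
    rw [EuclideanSpace.euclideanHausdorffMeasure_eq_volume]
    have : f '' (cone m n α ∩ Metric.closedBall p r) ⊆ Metric.closedBall (f p) r := by
      rintro _ ⟨x, hx, rfl⟩
      have := hx.2
      rw [Metric.mem_closedBall, dist_eq_norm] at this ⊢
      rw [← map_sub]
      exact (hf1 _).trans this
    refine (measure_mono this).trans ?_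
    rw [Measure.addHaar_closedBall _ _ hr, finrank_euclideanSpace_fin, ENNReal.ofReal_pow hr,
      mul_comm]

theorem surfaceMeasure_compl_cone : surfaceMeasure m n α (cone m n α)ᶜ = 0 := by
  rw [surfaceMeasure, Measure.restrict_apply measurableSet_cone.compl]
  simp

theorem ae_mem_cone : ∀ᵐ x ∂surfaceMeasure m n α, x ∈ cone m n α :=
  ae_restrict_mem measurableSet_cone

theorem surfaceMeasure_lt_top_of_isCompact (hm : 1 ≤ m) (hα : 0 < α) {S : Set (Space m n)}
    (hS : IsCompact S) (h0 : (0 : Space m n) ∉ S) : surfaceMeasure m n α S < ⊤ := by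
  refine hS.measure_lt_top_of_nhdsWithin fun x hx => ?_
  refine Measure.FiniteAtFilter.filter_mono nhdsWithin_le_nhds ?_
  have hx0 : x ≠ 0 := fun h => h0 (h ▸ hx)
  by_cases hxc : x ∈ cone m n α
  · obtain ⟨C, hC, hball⟩ := exists_surfaceMeasure_closedBall_le (n := n) hm hα
    have hpos : 0 < coneSine α * ‖x‖ / 2 := by
      have := coneSine_pos hα
      have := norm_pos_iff.2 hx0
      positivity
    refine ⟨_, Metric.closedBall_mem_nhds x hpos, (hball x hxc hx0 _ hpos.le le_rfl).trans_lt ?_⟩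
    exact ENNReal.mul_lt_top hC.lt_top (by simp)
  · exact ⟨_, isClosed_cone.isOpen_compl.mem_nhds hxc, by simp [surfaceMeasure_compl_cone]⟩

theorem isHomogeneous_surfaceMeasure (hm : 1 ≤ m) (hn : 1 ≤ n) (hα : 0 < α) :
    IsHomogeneous (surfaceMeasure m n α) ((m : ℝ) + n - 1) where
  singleton_zero := by
    have : (μHE[m + n - 1] : Measure (Space m n)) {0} = 0 := by
      have := Measure.nullSingletonClass_hausdorff (Space m n) (d := ((m + n - 1 : ℕ) : ℝ))
        (by norm_cast; omega)
      rw [Measure.euclideanHausdorffMeasure_def, Measure.smul_apply, measure_singleton, smul_zero]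
    exact Measure.restrict_le_self.absolutelyContinuous this
  map_smul t := by
    have ht := Real.exp_ne_zero t
    ext A hA
    have hm' : Measurable fun x : Space m n => Real.exp t • x := by fun_prop
    rw [Measure.map_apply hm' hA, Measure.smul_apply, surfaceMeasure,
      Measure.restrict_apply (hm' hA), Measure.restrict_apply hA]
    have hset : (fun x : Space m n => Real.exp t • x) ⁻¹' A ∩ cone m n α
        = (Real.exp t)⁻¹ • (A ∩ cone m n α) := by
      ext x
      rw [Set.mem_inv_smul_set_iff₀ ht]
      simp [smul_mem_cone_iff ht]
    rw [hset, Measure.euclideanHausdorffMeasure_smul₀ _ (inv_ne_zero ht), ENNReal.smul_def,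
      smul_eq_mul, smul_eq_mul]
    congr 1
    have h1 : ‖(Real.exp t)⁻¹‖ₑ = ENNReal.ofReal (Real.exp (-t)) := by
      rw [← Real.exp_neg, Real.enorm_of_nonneg (Real.exp_pos _).le]
    rw [ENNReal.coe_pow, ← enorm_eq_nnnorm, h1, ← ENNReal.ofReal_pow (Real.exp_pos _).le,
      ← Real.exp_nat_mul, Nat.cast_sub (by omega)]
    push_cast
    congr 2
    ring
  annulus R := by
    refine (measure_mono ?_).trans_lt (surfaceMeasure_lt_top_of_isCompact hm hα
      (S := Metric.closedBall 0 (Real.exp R) \ Metric.ball 0 (Real.exp (-R)))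
      ((isCompact_closedBall _ _).diff Metric.isOpen_ball) (by simp [Real.exp_pos]))
    rintro x ⟨hx, h⟩
    have hx' := norm_pos_iff.2 hx
    obtain ⟨h1, h2⟩ := abs_le.1 h
    simp only [Set.mem_sdiff, mem_closedBall_zero_iff, mem_ball_zero_iff, not_lt]
    exact ⟨(Real.log_le_iff_le_exp hx').1 h2, (Real.le_log_iff_exp_le hx').1 h1⟩

/-- Orthogonal projection along a unit vector e of the z-space does not increase area. The image of
the cone contains the nonempty open set where |z| < α|y|: moving such a point by a suitable multiple
of e reaches the cone. -/
theorem surfaceMeasure_ne_zero (hm : 1 ≤ m) (hn : 1 ≤ n) (hα : 0 < α) :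
    surfaceMeasure m n α ≠ 0 := by
  let e₂ : EuclideanSpace ℝ (Fin n) := EuclideanSpace.single ⟨0, hn⟩ 1
  have he₂ : ‖e₂‖ = 1 := by simp [e₂]
  let e₁ : EuclideanSpace ℝ (Fin m) := EuclideanSpace.single ⟨0, hm⟩ 1
  have he₁ : ‖e₁‖ = 1 := by simp [e₁]
  let e : Space m n := WithLp.toLp 2 (0, e₂)
  have he : ‖e‖ = 1 := by
    have : ‖e‖ ^ 2 = 1 := by rw [WithLp.prod_norm_sq_eq_of_L2]; simp [e, he₂]
    nlinarith [norm_nonneg e]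
  obtain ⟨i, f, hfi, hei, hif⟩ :=
    exists_hyperplane_coordinates (V := Space m n) (k := m + n - 1) (e := e)
      (by rw [finrank_space]; omega) he
  have hinner : ∀ x : Space m n, inner ℝ e x = inner ℝ e₂ x.snd := by
    intro x
    rw [WithLp.prod_inner_apply]
    change inner ℝ (0 : EuclideanSpace ℝ (Fin m)) x.fst + inner ℝ e₂ x.snd = _
    rw [inner_zero_left, zero_add]
  have hfe : f e = 0 := by
    apply i.injective
    rw [hif, real_inner_self_eq_norm_sq, he]; simp
  have hlip : LipschitzWith 1 f := by
    refine LipschitzWith.of_dist_le_mul fun x y => ?_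
    rw [dist_eq_norm, dist_eq_norm, ← map_sub, NNReal.coe_one, one_mul]
    have h : ‖f (x - y)‖ ^ 2 ≤ ‖x - y‖ ^ 2 := by
      rw [← i.norm_map, hif, norm_sub_sq_real, inner_smul_right, norm_smul, he, real_inner_comm]
      simp only [Real.norm_eq_abs, mul_one, sq_abs]
      nlinarith [sq_nonneg (inner ℝ e (x - y))]
    exact le_of_sq_le_sq h (norm_nonneg _)
  let U : Set (EuclideanSpace ℝ (Fin (m + n - 1))) := {w | ‖(i w).snd‖ < α * ‖(i w).fst‖}
  have hU : IsOpen U := by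
    have := i.continuous
    exact isOpen_lt (by fun_prop) (by fun_prop)
  have hUne : U.Nonempty := by
    refine ⟨f (WithLp.toLp 2 (e₁, 0)), ?_⟩
    have h1 : i (f (WithLp.toLp 2 (e₁, 0))) = WithLp.toLp 2 (e₁, 0) := by
      rw [hif, hinner]; simp
    simp only [U, mem_ofPred_eq, h1]
    simpa [he₁] using hα
  have hsub : U ⊆ f '' cone m n α := by
    intro w hw
    have hw' : ‖(i w).snd‖ < α * ‖(i w).fst‖ := hw
    set t := √((α * ‖(i w).fst‖) ^ 2 - ‖(i w).snd‖ ^ 2) with ht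
    refine ⟨i w + t • e, ?_, by rw [map_add, map_smul, hfe, hfi, smul_zero, add_zero]⟩
    have ht2 : t ^ 2 = (α * ‖(i w).fst‖) ^ 2 - ‖(i w).snd‖ ^ 2 :=
      Real.sq_sqrt (by nlinarith [norm_nonneg (i w).snd])
    have h1 : (i w + t • e).fst = (i w).fst := by simp [e]
    have h2 : (i w + t • e).snd = (i w).snd + t • e₂ := by simp [e]
    have h3 : inner ℝ (i w).snd e₂ = 0 := by rw [real_inner_comm, ← hinner, hei]
    have h4 : ‖(i w).snd + t • e₂‖ ^ 2 = (α * ‖(i w).fst‖) ^ 2 := by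
      rw [norm_add_sq_real, inner_smul_right, h3, norm_smul, he₂, mul_one, Real.norm_eq_abs,
        sq_abs, ht2]
      ring
    rw [cone, mem_ofPred_eq, h1, h2]
    exact (pow_left_inj₀ (norm_nonneg _) (by positivity) two_ne_zero).1 h4
  intro h
  have h1 : (μHE[m + n - 1] : Measure (Space m n)) (cone m n α) = 0 := by
    have := congrArg (fun ν : Measure (Space m n) => ν univ) h
    simpa [surfaceMeasure] using this
  have h2 := (measure_mono hsub).trans
    (euclideanHausdorffMeasure_image_le hlip (m + n - 1) (cone m n α))
  rw [h1, EuclideanSpace.euclideanHausdorffMeasure_eq_volume] at h2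
  exact (hU.measure_pos volume hUne).not_ge h2

/-- On the cone the norm determines |y| and |z|, so a reflection in each factor carries p to q. Such
a product preserves both the Hausdorff measure and the cone. -/
theorem exists_cone_symmetry {p q : Space m n} (hp : p ∈ cone m n α) (hq : q ∈ cone m n α)
    (h : ‖p‖ = ‖q‖) :
    ∃ R : Space m n ≃ₗᵢ[ℝ] Space m n, R p = q ∧
      (surfaceMeasure m n α).map R = surfaceMeasure m n α := by
  have h1 : ‖p.fst‖ = ‖q.fst‖ := by
    rw [norm_eq_of_mem_cone hp, norm_eq_of_mem_cone hq] at h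
    exact mul_left_cancel₀ (by positivity) h
  have h2 : ‖p.snd‖ = ‖q.snd‖ := by rw [norm_snd_of_mem_cone hp, norm_snd_of_mem_cone hq, h]
  let R : Space m n ≃ₗᵢ[ℝ] Space m n := LinearIsometryEquiv.withLpProdCongr 2
    (Submodule.reflection (Submodule.span ℝ {p.fst - q.fst})ᗮ)
    (Submodule.reflection (Submodule.span ℝ {p.snd - q.snd})ᗮ)
  have hR1 : ∀ x, (R x).fst = Submodule.reflection (Submodule.span ℝ {p.fst - q.fst})ᗮ x.fst :=
    fun x => rfl
  have hR2 : ∀ x, (R x).snd = Submodule.reflection (Submodule.span ℝ {p.snd - q.snd})ᗮ x.snd :=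
    fun x => rfl
  refine ⟨R, ?_, ?_⟩
  · have : (R p).fst = q.fst ∧ (R p).snd = q.snd :=
      ⟨by rw [hR1, Submodule.reflection_sub h1], by rw [hR2, Submodule.reflection_sub h2]⟩
    exact WithLp.ofLp_injective 2 (Prod.ext this.1 this.2)
  · have hpre : R ⁻¹' cone m n α = cone m n α := by
      ext x
      simp [cone, hR1, hR2]
    have hmp := (R.toIsometryEquiv.measurePreserving_euclideanHausdorffMeasure
      (m + n - 1)).restrict_preimage (measurableSet_cone (m := m) (n := n) (α := α))
    have := hmp.map_eq
    change Measure.map R (μHE[m + n - 1].restrict (R ⁻¹' cone m n α)) = _ at this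
    rwa [hpre] at this

end Geometry

/-! ### The kernel on the cylinder and its majorant. -/

section Kernel

/-- `|e^{t} w - e^{t'} w'|^2 = e^{t + t'} chordSq (t' - t) |w - w'|` for unit vectors `w, w'`. -/
def chordSq (τ r : ℝ) : ℝ := 2 * Real.cosh τ - 2 + r ^ 2

/-- The kernel `|x - y|^{-2a}` in logarithmic polar coordinates, up to the exponential factor. -/
def polarKernel (a τ r : ℝ) : ℝ := chordSq τ r ^ (-a)

/-- An integrable majorant of the regularized kernels. -/
def majorant (a β τ r : ℝ) : ℝ := Real.exp (β * |τ|) * min 1 (chordSq τ r) * polarKernel a τ r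

@[simp] theorem chordSq_neg (τ r : ℝ) : chordSq (-τ) r = chordSq τ r := by
  simp [chordSq]

@[simp] theorem polarKernel_neg (a τ r : ℝ) : polarKernel a (-τ) r = polarKernel a τ r := by
  simp [polarKernel]

/-- From cosh y - cosh x = 2 sinh((y+x)/2) sinh((y-x)/2) and sinh u ≥ u for u ≥ 0. The case x = 0
bounds `chordSq` below; the general case measures the thickness of the shell. -/
theorem sq_sub_sq_le_cosh {x y : ℝ} (hx : 0 ≤ x) (hxy : x ≤ y) :
    y ^ 2 - x ^ 2 ≤ 2 * Real.cosh y - 2 * Real.cosh x := by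
  have h1 : Real.cosh y = Real.cosh ((y + x) / 2 + (y - x) / 2) := by congr 1; ring
  have h2 : Real.cosh x = Real.cosh ((y + x) / 2 - (y - x) / 2) := by congr 1; ring
  rw [h1, h2, Real.cosh_add, Real.cosh_sub]
  have h3 : (y + x) / 2 ≤ Real.sinh ((y + x) / 2) := Real.self_le_sinh_iff.2 (by linarith)
  have h4 : (y - x) / 2 ≤ Real.sinh ((y - x) / 2) := Real.self_le_sinh_iff.2 (by linarith)
  have h5 := mul_le_mul h3 h4 (by linarith) (by linarith)
  nlinarith

theorem sq_add_sq_le_chordSq (τ r : ℝ) : τ ^ 2 + r ^ 2 ≤ chordSq τ r := by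
  have := sq_sub_sq_le_cosh le_rfl (abs_nonneg τ)
  rw [Real.cosh_abs, Real.cosh_zero, sq_abs] at this
  unfold chordSq
  linarith

theorem chordSq_nonneg (τ r : ℝ) : 0 ≤ chordSq τ r :=
  (by positivity : 0 ≤ τ ^ 2 + r ^ 2).trans (sq_add_sq_le_chordSq τ r)

theorem sq_le_chordSq (τ r : ℝ) : τ ^ 2 ≤ chordSq τ r := by
  nlinarith [sq_add_sq_le_chordSq τ r]

theorem one_le_chordSq {τ : ℝ} (h : 1 ≤ |τ|) (r : ℝ) : 1 ≤ chordSq τ r := by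
  have := sq_le_chordSq τ r
  rw [← sq_abs] at this
  nlinarith

theorem exp_le_chordSq {τ : ℝ} (h : 1 ≤ |τ|) (r : ℝ) :
    Real.exp |τ| / 4 ≤ chordSq τ r := by
  have h1 : Real.cosh τ = (Real.exp |τ| + Real.exp (-|τ|)) / 2 := by
    rw [← Real.cosh_abs, Real.cosh_eq]
  have h2 : Real.exp (-|τ|) = (Real.exp |τ|)⁻¹ := Real.exp_neg _
  have h3 : 2.7 ≤ Real.exp |τ| := by
    have := Real.exp_one_gt_d9
    have := Real.exp_le_exp.2 h
    linarith
  unfold chordSq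
  rw [h1]
  have h4 : 0 < Real.exp (-|τ|) := Real.exp_pos _
  nlinarith [sq_nonneg r, sq_nonneg (Real.exp |τ| - 2)]

theorem polarKernel_nonneg (a τ r : ℝ) : 0 ≤ polarKernel a τ r :=
  Real.rpow_nonneg (chordSq_nonneg _ _) _

theorem majorant_nonneg (a β τ r : ℝ) : 0 ≤ majorant a β τ r :=
  mul_nonneg (mul_nonneg (Real.exp_pos _).le (le_min zero_le_one (chordSq_nonneg _ _)))
    (polarKernel_nonneg _ _ _)

@[fun_prop]
theorem continuous_chordSq : Continuous fun z : ℝ × ℝ => chordSq z.1 z.2 := by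
  unfold chordSq; fun_prop

theorem measurable_chordSq : Measurable fun z : ℝ × ℝ => chordSq z.1 z.2 :=
  continuous_chordSq.measurable

theorem measurable_polarKernel (a : ℝ) : Measurable fun z : ℝ × ℝ => polarKernel a z.1 z.2 :=
  measurable_chordSq.pow_const _

theorem measurable_majorant (a β : ℝ) : Measurable fun z : ℝ × ℝ => majorant a β z.1 z.2 := by
  unfold majorant
  exact ((by fun_prop : Measurable fun z : ℝ × ℝ => Real.exp (β * |z.1|)).mul
    (measurable_const.min measurable_chordSq)).mul (measurable_polarKernel a)

theorem integrable_exp_neg_mul_abs {c : ℝ} (hc : 0 < c) :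
    Integrable fun τ : ℝ => Real.exp (-c * |τ|) := by
  rw [← integrableOn_univ, ← Iic_union_Ioi (a := (0 : ℝ))]
  refine IntegrableOn.union ?_ ?_
  · refine (integrableOn_exp_mul_Iic hc 0).congr_fun (fun τ hτ => ?_) measurableSet_Iic
    simp only [abs_of_nonpos (mem_Iic.1 hτ)]
    congr 1; ring
  · refine (exp_neg_integrableOn_Ioi 0 hc).congr_fun (fun τ hτ => ?_) measurableSet_Ioi
    simp only [abs_of_pos (mem_Ioi.1 hτ)]

/-- Where `chordSq` > 1, exponential decay of the kernel gives the first term; the factor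
e^{β+|a-β|} covers |τ| < 1. Elsewhere choose j with 4^{-(j+1)} < `chordSq` ≤ 4^{-j}: then |τ| and r
are at most 2^{-j}, and `chordSq` to the power 1 - a is at most 4^{(a-1)(j+1)}. -/
theorem majorant_le {a β : ℝ} (ha : 1 ≤ a) (hβ : 0 ≤ β) (τ r : ℝ) :
    ENNReal.ofReal (majorant a β τ r) ≤
      ENNReal.ofReal (4 ^ a * Real.exp (β + |a - β|) * Real.exp (-(a - β) * |τ|)) +
      ∑' j : ℕ, ENNReal.ofReal (Real.exp β * 4 ^ (a - 1) * (4 ^ (a - 1)) ^ j) *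
        ({z : ℝ × ℝ | |z.1| ≤ (1 / 2) ^ j ∧ z.2 ≤ (1 / 2) ^ j}.indicator 1 (τ, r)) := by
  rcases lt_or_ge 1 (chordSq τ r) with h | h
  · refine le_add_right (ENNReal.ofReal_le_ofReal ?_)
    have h4 : (1 : ℝ) ≤ 4 ^ a := Real.one_le_rpow (by norm_num) (by linarith)
    rw [majorant, min_eq_left h.le, mul_one, polarKernel]
    rcases le_or_gt 1 |τ| with ht | ht
    · have h1 : chordSq τ r ^ (-a) ≤ (Real.exp |τ| / 4) ^ (-a) :=
        Real.rpow_le_rpow_of_nonpos (by positivity) (exp_le_chordSq ht r) (by linarith)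
      have h2 : (Real.exp |τ| / 4) ^ (-a) = 4 ^ a * Real.exp (-a * |τ|) := by
        rw [Real.div_rpow (Real.exp_pos _).le (by norm_num), ← Real.exp_mul,
          Real.rpow_neg (by norm_num), div_inv_eq_mul]
        rw [mul_comm |τ|, mul_comm]
      calc Real.exp (β * |τ|) * chordSq τ r ^ (-a)
          ≤ Real.exp (β * |τ|) * (4 ^ a * Real.exp (-a * |τ|)) := by rw [← h2]; gcongr
        _ = 4 ^ a * 1 * Real.exp (-(a - β) * |τ|) := by
            rw [mul_left_comm, ← Real.exp_add, mul_one]; congr 2; ring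
        _ ≤ _ := by
            gcongr
            exact Real.one_le_exp (by positivity)
    · have h1 : chordSq τ r ^ (-a) ≤ 1 :=
        Real.rpow_le_one_of_one_le_of_nonpos h.le (by linarith)
      calc Real.exp (β * |τ|) * chordSq τ r ^ (-a) ≤ Real.exp (β * |τ|) * 1 := by gcongr
        _ ≤ 1 * (Real.exp (β + |a - β|) * Real.exp (-(a - β) * |τ|)) := by
            rw [mul_one, one_mul, ← Real.exp_add]
            refine Real.exp_le_exp.2 ?_
            have : (a - β) * |τ| ≤ |a - β| * 1 := by
              refine mul_le_mul (le_abs_self _) ht.le (abs_nonneg _) (abs_nonneg _)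
            nlinarith [abs_nonneg τ]
        _ ≤ 4 ^ a * (Real.exp (β + |a - β|) * Real.exp (-(a - β) * |τ|)) := by gcongr
        _ = _ := by ring
  · refine le_add_left ?_
    rcases (chordSq_nonneg τ r).eq_or_lt with h0 | h0
    · simp [majorant, ← h0]
    obtain ⟨j, hj1, hj2⟩ := exists_nat_pow_near_of_lt_one h0 h
      (by norm_num : (0 : ℝ) < 1 / 4) (by norm_num)
    refine le_trans ?_ (ENNReal.le_tsum j)
    have hq : ((1 : ℝ) / 4) ^ j = ((1 / 2) ^ j) ^ 2 := by
      rw [← pow_mul, mul_comm, pow_mul]; norm_num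
    have hs := sq_add_sq_le_chordSq τ r
    have hmem : (τ, r) ∈ {z : ℝ × ℝ | |z.1| ≤ (1 / 2) ^ j ∧ z.2 ≤ (1 / 2) ^ j} := by
      constructor
      · exact abs_le_of_sq_le_sq (by nlinarith [sq_nonneg r]) (by positivity)
      · exact le_of_sq_le_sq (by nlinarith [sq_nonneg τ]) (by positivity)
    rw [indicator_of_mem hmem, Pi.one_apply, mul_one]
    refine ENNReal.ofReal_le_ofReal ?_
    rw [majorant, min_eq_right h, polarKernel, mul_assoc]
    have ht : |τ| ≤ 1 := hmem.1.trans (pow_le_one₀ (by norm_num) (by norm_num))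
    have h1 : chordSq τ r * chordSq τ r ^ (-a) = chordSq τ r ^ (1 - a) := by
      rw [sub_eq_add_neg, Real.rpow_add h0, Real.rpow_one]
    have h2 : chordSq τ r ^ (1 - a) ≤ ((1 / 4) ^ (j + 1)) ^ (1 - a) :=
      Real.rpow_le_rpow_of_nonpos (by positivity) hj1.le (by linarith)
    have h3 : (((1 : ℝ) / 4) ^ (j + 1)) ^ (1 - a) = 4 ^ (a - 1) * (4 ^ (a - 1)) ^ j := by
      rw [← pow_succ', one_div, inv_pow, Real.inv_rpow (by positivity), ← Real.rpow_neg (by positivity),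
        ← Real.rpow_natCast, ← Real.rpow_natCast, ← Real.rpow_mul (by norm_num),
        ← Real.rpow_mul (by norm_num)]
      congr 1
      ring
    rw [h1, mul_assoc, ← h3]
    gcongr
    nlinarith [abs_nonneg τ]

end Kernel

/-- The properties of the angular measure of a cone that enter the analysis: `Γ` is a homogeneous
space of isometries and caps of radius `r` have measure `O(r^{k-1})`. -/
structure IsAngular {V : Type*} [NormedAddCommGroup V] [NormedSpace ℝ V] [MeasurableSpace V]
    (σ : Measure V) (Γ : Set V) (k : ℕ) : Prop where
  isFiniteMeasure : IsFiniteMeasure σ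
  ae_mem : ∀ᵐ w ∂σ, w ∈ Γ
  exists_isometry : ∀ p ∈ Γ, ∀ q ∈ Γ, ∃ R : V ≃ₗᵢ[ℝ] V, R p = q ∧ MeasurePreserving R σ σ
  closedBall_le : ∃ C : ENNReal, C ≠ ⊤ ∧ ∀ p ∈ Γ, ∀ r : ℝ, 0 ≤ r → r ≤ 1 →
    ENNReal.ofReal r * σ (Metric.closedBall p r) ≤ C * ENNReal.ofReal r ^ k

/-! ### Integration over the cylinder and its square. -/

section Cylinder

variable {V : Type*} [NormedAddCommGroup V] [NormedSpace ℝ V] [MeasurableSpace V] [BorelSpace V]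
  [SecondCountableTopology V] {σ : Measure V} {Γ : Set V} {k : ℕ}

theorem measurable_comp_dist {h : ℝ → ℝ → ℝ} (hh : Measurable fun z : ℝ × ℝ => h z.1 z.2) (p : V) :
    Measurable fun z : ℝ × V => h z.1 ‖p - z.2‖ :=
  hh.comp (by fun_prop : Measurable fun z : ℝ × V => (z.1, ‖p - z.2‖))

/-- The set |τ|, r ≤ 2^{-j} has measure O(2^{-jk}) by the cap bound, so the dyadic sum is dominated
by a geometric series of ratio 4^{a-1} 2^{-k}, less than 1 because 2(a-1) < k. The condition β < a
gives integrability at infinity. -/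
theorem IsAngular.integrable_majorant (hσ : IsAngular σ Γ k) {a β : ℝ} (ha : 1 ≤ a) (hβ : 0 ≤ β)
    (hβa : β < a) (hk : 2 * (a - 1) < k) {p : V} (hp : p ∈ Γ) :
    Integrable (fun z : ℝ × V => majorant a β z.1 ‖p - z.2‖) ((volume : Measure ℝ).prod σ) := by
  have := hσ.isFiniteMeasure
  obtain ⟨C, hC, hball⟩ := hσ.closedBall_le
  have hmeas := measurable_comp_dist (measurable_majorant a β) p
  refine ⟨hmeas.aestronglyMeasurable, ?_⟩
  rw [hasFiniteIntegral_iff_ofReal (.of_forall fun z => majorant_nonneg _ _ _ _)]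
  have hA : ∀ j : ℕ, MeasurableSet
      {z : ℝ × ℝ | |z.1| ≤ (1 / 2) ^ j ∧ z.2 ≤ (1 / 2) ^ j} := fun j =>
    (measurableSet_le (f := fun z : ℝ × ℝ => |z.1|) (by fun_prop) measurable_const).inter
      (measurableSet_le measurable_snd measurable_const)
  refine (lintegral_mono fun z : ℝ × V => majorant_le ha hβ z.1 ‖p - z.2‖).trans_lt ?_
  rw [lintegral_add_left (by fun_prop), ENNReal.add_lt_top]
  constructor
  · have h := ((integrable_exp_neg_mul_abs (sub_pos.2 hβa)).const_mul
      (4 ^ a * Real.exp (β + |a - β|))).comp_fst σ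
    have := h.2
    rwa [hasFiniteIntegral_iff_ofReal (.of_forall fun z => by positivity)] at this
  · have hmap : Measurable fun z : ℝ × V => (z.1, ‖p - z.2‖) := by fun_prop
    have hind : ∀ j : ℕ, Measurable fun z : ℝ × V => ({z : ℝ × ℝ | |z.1| ≤ (1 / 2) ^ j ∧
        z.2 ≤ (1 / 2) ^ j}.indicator (1 : ℝ × ℝ → ENNReal) (z.1, ‖p - z.2‖)) := fun j =>
      (measurable_one.indicator (hA j)).comp hmap
    rw [lintegral_tsum fun j => ((hind j).const_mul _).aemeasurable]
    have hj : ∀ j : ℕ, ∫⁻ z : ℝ × V, ENNReal.ofReal (Real.exp β * 4 ^ (a - 1) * (4 ^ (a - 1)) ^ j) *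
        ({z : ℝ × ℝ | |z.1| ≤ (1 / 2) ^ j ∧ z.2 ≤ (1 / 2) ^ j}.indicator 1 (z.1, ‖p - z.2‖))
        ∂((volume : Measure ℝ).prod σ) ≤
        ENNReal.ofReal (Real.exp β * 4 ^ (a - 1)) * (2 * C) *
          ENNReal.ofReal (4 ^ (a - 1) * (1 / 2) ^ k) ^ j := by
      intro j
      rw [lintegral_const_mul _ (hind j)]
      have h1 : ∀ z : ℝ × V,
          {z : ℝ × ℝ | |z.1| ≤ (1 / 2) ^ j ∧ z.2 ≤ (1 / 2) ^ j}.indicator 1 (z.1, ‖p - z.2‖) =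
          ((Icc (-(1 / 2) ^ j) ((1 / 2) ^ j)) ×ˢ Metric.closedBall p ((1 / 2) ^ j)).indicator
            (1 : ℝ × V → ENNReal) z := by
        intro z
        simp only [indicator, mem_ofPred_eq, mem_prod, mem_Icc, Metric.mem_closedBall, abs_le,
          dist_comm z.2 p, dist_eq_norm, Pi.one_apply]
      simp_rw [h1]
      rw [lintegral_indicator_one (measurableSet_Icc.prod measurableSet_closedBall),
        Measure.prod_prod, Real.volume_Icc]
      have h2 : ENNReal.ofReal ((1 / 2) ^ j - -(1 / 2) ^ j) = 2 * ENNReal.ofReal ((1 / 2) ^ j) := by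
        rw [sub_neg_eq_add, ← two_mul, ENNReal.ofReal_mul (by norm_num)]; simp
      rw [h2, mul_assoc 2]
      calc _ ≤ ENNReal.ofReal (Real.exp β * 4 ^ (a - 1) * (4 ^ (a - 1)) ^ j) *
            (2 * (C * ENNReal.ofReal ((1 / 2) ^ j) ^ k)) := by
            exact mul_le_mul' le_rfl (mul_le_mul' le_rfl (hball p hp ((1 / 2) ^ j) (by positivity)
              (pow_le_one₀ (by norm_num) (by norm_num))))
        _ = _ := by
            have hq : (0 : ℝ) ≤ 4 ^ (a - 1) := by positivity
            generalize (4 : ℝ) ^ (a - 1) = q at hq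
            have hh : (0 : ℝ) ≤ 1 / 2 := by norm_num
            rw [ENNReal.ofReal_mul (mul_nonneg (Real.exp_pos β).le hq), ENNReal.ofReal_mul hq,
              mul_pow, ENNReal.ofReal_pow hq, ENNReal.ofReal_pow hh, ENNReal.ofReal_pow hh,
              ← pow_mul, ← pow_mul, mul_comm k j]
            ring
    refine (ENNReal.tsum_le_tsum hj).trans_lt ?_
    rw [ENNReal.tsum_mul_left, ENNReal.tsum_geometric]
    refine ENNReal.mul_lt_top (ENNReal.mul_lt_top ENNReal.ofReal_lt_top
      (ENNReal.mul_lt_top (by simp) hC.lt_top)) ?_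
    rw [ENNReal.inv_lt_top, tsub_pos_iff_lt, ENNReal.ofReal_lt_one]
    have h4 : (4 : ℝ) ^ (a - 1) = 2 ^ (2 * (a - 1)) := by
      rw [Real.rpow_mul (by norm_num)]; norm_num
    have h5 : (2 : ℝ) ^ (2 * (a - 1)) < 2 ^ (k : ℝ) :=
      Real.rpow_lt_rpow_of_exponent_lt (by norm_num) hk
    rw [h4, one_div, inv_pow, ← div_eq_mul_inv, div_lt_one (by positivity)]
    rwa [Real.rpow_natCast] at h5

/-- Rotations and translations of the cylinder. -/
theorem IsAngular.exists_measurePreserving (hσ : IsAngular σ Γ k) {p w : V} (hp : p ∈ Γ)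
    (hw : w ∈ Γ) (t : ℝ) :
    ∃ Φ : ℝ × V → ℝ × V, MeasurableEmbedding Φ ∧
      MeasurePreserving Φ ((volume : Measure ℝ).prod σ) ((volume : Measure ℝ).prod σ) ∧
      ∀ z, (Φ z).1 = z.1 - t ∧ ‖p - (Φ z).2‖ = ‖w - z.2‖ := by
  have := hσ.isFiniteMeasure
  obtain ⟨R, hR, hRσ⟩ := hσ.exists_isometry w hw p hp
  refine ⟨Prod.map (fun x => x - t) R, ?_, ?_, fun z => ⟨rfl, ?_⟩⟩
  · exact ((Homeomorph.subRight t).prodCongr R.toHomeomorph).measurableEmbedding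
  · exact (measurePreserving_sub_right volume t).prod hRσ
  · simp only [Prod.map, ← hR, ← map_sub, R.norm_map]

theorem IsAngular.integrable_comp_iff (hσ : IsAngular σ Γ k) {p w : V} (hp : p ∈ Γ) (hw : w ∈ Γ)
    (t : ℝ) (h : ℝ → ℝ → ℝ) :
    Integrable (fun z : ℝ × V => h (z.1 - t) ‖w - z.2‖) ((volume : Measure ℝ).prod σ) ↔
      Integrable (fun z : ℝ × V => h z.1 ‖p - z.2‖) ((volume : Measure ℝ).prod σ) := by
  obtain ⟨Φ, hΦ, hΦm, hz⟩ := hσ.exists_measurePreserving hp hw t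
  rw [← hΦm.integrable_comp_emb hΦ (g := fun z : ℝ × V => h z.1 ‖p - z.2‖)]
  simp only [Function.comp_def, hz]

theorem IsAngular.integral_comp (hσ : IsAngular σ Γ k) {p w : V} (hp : p ∈ Γ) (hw : w ∈ Γ)
    (t : ℝ) (h : ℝ → ℝ → ℝ) :
    ∫ z : ℝ × V, h (z.1 - t) ‖w - z.2‖ ∂((volume : Measure ℝ).prod σ) =
      ∫ z : ℝ × V, h z.1 ‖p - z.2‖ ∂((volume : Measure ℝ).prod σ) := by
  obtain ⟨Φ, hΦ, hΦm, hz⟩ := hσ.exists_measurePreserving hp hw t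
  rw [← hΦm.integral_comp hΦ fun z : ℝ × V => h z.1 ‖p - z.2‖]
  simp only [hz]

theorem integral_comp_neg_fst [IsFiniteMeasure σ] (p : V) (h : ℝ → ℝ → ℝ) :
    ∫ z : ℝ × V, h (-z.1) ‖p - z.2‖ ∂((volume : Measure ℝ).prod σ) =
      ∫ z : ℝ × V, h z.1 ‖p - z.2‖ ∂((volume : Measure ℝ).prod σ) := by
  have h1 : MeasurePreserving (Prod.map Neg.neg id : ℝ × V → ℝ × V)
      ((volume : Measure ℝ).prod σ) ((volume : Measure ℝ).prod σ) :=
    (Measure.measurePreserving_neg volume).prod (MeasurePreserving.id σ)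
  have h2 : MeasurableEmbedding (Prod.map Neg.neg id : ℝ × V → ℝ × V) :=
    ((Homeomorph.neg ℝ).prodCongr (Homeomorph.refl V)).measurableEmbedding
  exact h1.integral_comp h2 fun z => h z.1 ‖p - z.2‖

theorem integrable_comp_neg_fst [IsFiniteMeasure σ] {p : V} {h : ℝ → ℝ → ℝ}
    (hh : Integrable (fun z : ℝ × V => h z.1 ‖p - z.2‖) ((volume : Measure ℝ).prod σ)) :
    Integrable (fun z : ℝ × V => h (-z.1) ‖p - z.2‖) ((volume : Measure ℝ).prod σ) := by
  have h1 : MeasurePreserving (Prod.map Neg.neg id : ℝ × V → ℝ × V)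
      ((volume : Measure ℝ).prod σ) ((volume : Measure ℝ).prod σ) :=
    (Measure.measurePreserving_neg volume).prod (MeasurePreserving.id σ)
  have h2 : MeasurableEmbedding (Prod.map Neg.neg id : ℝ × V → ℝ × V) :=
    ((Homeomorph.neg ℝ).prodCongr (Homeomorph.refl V)).measurableEmbedding
  exact (h1.integrable_comp_emb h2).2 hh

theorem IsAngular.ae_mem_prod (hσ : IsAngular σ Γ k) :
    ∀ᵐ z ∂((volume : Measure ℝ).prod σ), z.2 ∈ Γ := by
  have := hσ.isFiniteMeasure
  exact Measure.quasiMeasurePreserving_snd.ae hσ.ae_mem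

theorem measurable_kernel {h : ℝ → ℝ → ℝ} (hh : Measurable fun z : ℝ × ℝ => h z.1 z.2) :
    Measurable fun z : (ℝ × V) × (ℝ × V) => h (z.2.1 - z.1.1) ‖z.1.2 - z.2.2‖ :=
  hh.comp (by fun_prop :
    Measurable fun z : (ℝ × V) × (ℝ × V) => (z.2.1 - z.1.1, ‖z.1.2 - z.2.2‖))

/-- Convolution-type products are integrable on the square of the cylinder. -/
theorem IsAngular.integrable_mul_kernel (hσ : IsAngular σ Γ k) {p : V} (hp : p ∈ Γ)
    {b : ℝ × V → ℝ} (hb : Integrable b ((volume : Measure ℝ).prod σ)) {h : ℝ → ℝ → ℝ}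
    (hh : Measurable fun z : ℝ × ℝ => h z.1 z.2)
    (hi : Integrable (fun z : ℝ × V => h z.1 ‖p - z.2‖) ((volume : Measure ℝ).prod σ)) :
    Integrable (fun z : (ℝ × V) × (ℝ × V) => b z.1 * h (z.2.1 - z.1.1) ‖z.1.2 - z.2.2‖)
      (((volume : Measure ℝ).prod σ).prod ((volume : Measure ℝ).prod σ)) := by
  have := hσ.isFiniteMeasure
  rw [integrable_prod_iff]
  · constructor
    · filter_upwards [hσ.ae_mem_prod] with z hz
      exact ((hσ.integrable_comp_iff hp hz z.1 h).2 hi).const_mul _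
    · have h1 : ∀ᵐ z ∂((volume : Measure ℝ).prod σ),
          ‖b z‖ * (∫ y : ℝ × V, ‖h y.1 ‖p - y.2‖‖ ∂((volume : Measure ℝ).prod σ)) =
          ∫ y : ℝ × V, ‖b z * h (y.1 - z.1) ‖z.2 - y.2‖‖ ∂((volume : Measure ℝ).prod σ) := by
        filter_upwards [hσ.ae_mem_prod] with z hz
        simp_rw [norm_mul]
        rw [integral_const_mul, hσ.integral_comp hp hz z.1 fun x y => ‖h x y‖]
      exact (hb.norm.mul_const _).congr h1
  · exact (hb.aestronglyMeasurable.comp_fst).mul (measurable_kernel hh).aestronglyMeasurable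

/-- The inner integral has the same value at every base point of the link, by translation and
rotation, so it factors out as for a convolution. -/
theorem IsAngular.integral_mul_kernel (hσ : IsAngular σ Γ k) {p : V} (hp : p ∈ Γ)
    {b : ℝ × V → ℝ} (hb : Integrable b ((volume : Measure ℝ).prod σ)) {h : ℝ → ℝ → ℝ}
    (hh : Measurable fun z : ℝ × ℝ => h z.1 z.2)
    (hi : Integrable (fun z : ℝ × V => h z.1 ‖p - z.2‖) ((volume : Measure ℝ).prod σ)) :
    ∫ z : (ℝ × V) × (ℝ × V), b z.1 * h (z.2.1 - z.1.1) ‖z.1.2 - z.2.2‖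
      ∂(((volume : Measure ℝ).prod σ).prod ((volume : Measure ℝ).prod σ)) =
    (∫ z, b z ∂((volume : Measure ℝ).prod σ)) *
      ∫ z : ℝ × V, h z.1 ‖p - z.2‖ ∂((volume : Measure ℝ).prod σ) := by
  have := hσ.isFiniteMeasure
  rw [integral_prod _ (hσ.integrable_mul_kernel hp hb hh hi), ← integral_mul_const]
  refine integral_congr_ae ?_
  filter_upwards [hσ.ae_mem_prod] with z hz
  rw [integral_const_mul, hσ.integral_comp hp hz z.1 h]

/-- Swapping the two points only reverses the sign of τ. -/
theorem IsAngular.integrable_mul_kernel_snd (hσ : IsAngular σ Γ k) {p : V} (hp : p ∈ Γ)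
    {b : ℝ × V → ℝ} (hb : Integrable b ((volume : Measure ℝ).prod σ)) {h : ℝ → ℝ → ℝ}
    (hh : Measurable fun z : ℝ × ℝ => h z.1 z.2)
    (hi : Integrable (fun z : ℝ × V => h z.1 ‖p - z.2‖) ((volume : Measure ℝ).prod σ)) :
    Integrable (fun z : (ℝ × V) × (ℝ × V) => b z.2 * h (z.2.1 - z.1.1) ‖z.1.2 - z.2.2‖)
      (((volume : Measure ℝ).prod σ).prod ((volume : Measure ℝ).prod σ)) := by
  have := hσ.isFiniteMeasure
  have h1 := (hσ.integrable_mul_kernel hp hb (h := fun x y => h (-x) y)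
    (hh.comp (by fun_prop : Measurable fun z : ℝ × ℝ => (-z.1, z.2)))
    (integrable_comp_neg_fst hi)).swap
  refine h1.congr (.of_forall fun z => ?_)
  simp [norm_sub_rev]

theorem IsAngular.integral_mul_kernel_snd (hσ : IsAngular σ Γ k) {p : V} (hp : p ∈ Γ)
    {b : ℝ × V → ℝ} (hb : Integrable b ((volume : Measure ℝ).prod σ)) {h : ℝ → ℝ → ℝ}
    (hh : Measurable fun z : ℝ × ℝ => h z.1 z.2)
    (hi : Integrable (fun z : ℝ × V => h z.1 ‖p - z.2‖) ((volume : Measure ℝ).prod σ)) :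
    ∫ z : (ℝ × V) × (ℝ × V), b z.2 * h (z.2.1 - z.1.1) ‖z.1.2 - z.2.2‖
      ∂(((volume : Measure ℝ).prod σ).prod ((volume : Measure ℝ).prod σ)) =
    (∫ z, b z ∂((volume : Measure ℝ).prod σ)) *
      ∫ z : ℝ × V, h z.1 ‖p - z.2‖ ∂((volume : Measure ℝ).prod σ) := by
  have := hσ.isFiniteMeasure
  have h1 := hσ.integral_mul_kernel hp hb (h := fun x y => h (-x) y)
    (hh.comp (by fun_prop : Measurable fun z : ℝ × ℝ => (-z.1, z.2)))
    (integrable_comp_neg_fst hi)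
  rw [integral_comp_neg_fst p h] at h1
  rw [← h1, ← integral_prod_swap]
  refine integral_congr_ae (.of_forall fun z => ?_)
  simp [norm_sub_rev]

end Cylinder

/-! ### Pointwise bounds by the majorant. -/

section Pointwise

theorem abs_sinh_le (x : ℝ) : |Real.sinh x| ≤ |x| * Real.exp |x| := by
  rw [Real.abs_sinh, Real.sinh_eq]
  have h1 : Real.exp (-|x|) = Real.exp |x| * Real.exp (-(2 * |x|)) := by
    rw [← Real.exp_add]; congr 1; ring
  have h2 := Real.add_one_le_exp (-(2 * |x|))
  rw [h1]
  nlinarith [Real.exp_pos |x|]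

theorem exp_le_exp_abs_mul (γ τ : ℝ) : Real.exp (γ * τ) ≤ Real.exp (|γ| * |τ|) := by
  rw [← abs_mul]; exact Real.exp_le_exp.2 (le_abs_self _)

theorem cosh_sub_one_nonneg (x : ℝ) : 0 ≤ Real.cosh x - 1 := sub_nonneg.2 (Real.one_le_cosh x)

theorem cosh_le_exp_abs_mul (γ τ : ℝ) : Real.cosh (γ * τ) ≤ Real.exp (|γ| * |τ|) := by
  rw [Real.cosh_eq, ← neg_mul]
  have h1 := exp_le_exp_abs_mul γ τ
  have h2 := exp_le_exp_abs_mul (-γ) τ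
  rw [abs_neg] at h2
  linarith

/-- Near the diagonal, cosh u - 1 = 2 sinh²(u/2) is quadratic in τ and τ² ≤ `chordSq`; this gain
makes the Hardy constant a convergent integral. Far away the exponential bound suffices. -/
theorem cosh_sub_one_le (γ τ r : ℝ) :
    Real.cosh (γ * τ) - 1 ≤ (1 + γ ^ 2) * (Real.exp (|γ| * |τ|) * min 1 (chordSq τ r)) := by
  have hE := Real.exp_pos (|γ| * |τ|)
  have hc := chordSq_nonneg τ r
  rcases le_total 1 (chordSq τ r) with h | h
  · rw [min_eq_left h]
    nlinarith [cosh_le_exp_abs_mul γ τ, mul_nonneg (sq_nonneg γ) hE.le]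
  · rw [min_eq_right h]
    have h1 : Real.cosh (γ * τ) - 1 = 2 * Real.sinh (γ * τ / 2) ^ 2 := by
      have : γ * τ = 2 * (γ * τ / 2) := by ring
      conv_lhs => rw [this, Real.cosh_two_mul]
      nlinarith [Real.cosh_sq (γ * τ / 2)]
    have h2 : Real.sinh (γ * τ / 2) ^ 2 ≤ (γ * τ / 2) ^ 2 * Real.exp (|γ| * |τ|) := by
      have h3 := pow_le_pow_left₀ (abs_nonneg _) (abs_sinh_le (γ * τ / 2)) 2
      rw [sq_abs, mul_pow, sq_abs, ← Real.exp_nat_mul] at h3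
      refine h3.trans_eq ?_
      congr 2
      rw [abs_div, abs_mul]
      norm_num
      ring
    have h3 := sq_le_chordSq τ r
    rw [h1]
    have h4 : γ ^ 2 * τ ^ 2 * Real.exp (|γ| * |τ|) ≤
        γ ^ 2 * chordSq τ r * Real.exp (|γ| * |τ|) := by gcongr
    have h5 : 0 ≤ γ ^ 2 * chordSq τ r * Real.exp (|γ| * |τ|) := by positivity
    have h6 : 0 ≤ Real.exp (|γ| * |τ|) * chordSq τ r := by positivity
    nlinarith

theorem exp_mul_min_mul_polarKernel_le (a γ τ r : ℝ) :
    Real.exp (|γ| * |τ|) * min 1 (chordSq τ r) * polarKernel a τ r ≤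
      majorant a (|γ| + 1 / 2) τ r := by
  unfold majorant
  have := polarKernel_nonneg a τ r
  have : 0 ≤ min 1 (chordSq τ r) := le_min zero_le_one (chordSq_nonneg _ _)
  gcongr
  linarith

theorem exp_mul_polarKernel_le {ε : ℝ} (hε : 0 < ε) (hε1 : ε ≤ 1) (a γ : ℝ) {τ r : ℝ}
    (h : ε ≤ chordSq τ r) :
    Real.exp (|γ| * |τ|) * polarKernel a τ r ≤ ε⁻¹ * majorant a (|γ| + 1 / 2) τ r := by
  have h1 := exp_mul_min_mul_polarKernel_le a γ τ r
  have h2 : ε ≤ min 1 (chordSq τ r) := le_min hε1 h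
  have h3 : 0 ≤ Real.exp (|γ| * |τ|) * polarKernel a τ r :=
    mul_nonneg (Real.exp_pos _).le (polarKernel_nonneg _ _ _)
  rw [inv_mul_eq_div, le_div_iff₀ hε]
  nlinarith

/-- The spare exponent 1/2 in the majorant absorbs τ² at infinity even if γ = 0, by τ²/8 ≤
e^{|τ|/2}. The bound is for differences of slowly varying profiles. -/
theorem sq_mul_polarKernel_le (a γ τ r : ℝ) :
    τ ^ 2 * polarKernel a τ r ≤ 8 * majorant a (|γ| + 1 / 2) τ r := by
  unfold majorant
  rw [← mul_assoc]
  refine mul_le_mul_of_nonneg_right ?_ (polarKernel_nonneg _ _ _)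
  have h1 : 1 ≤ Real.exp ((|γ| + 1 / 2) * |τ|) := Real.one_le_exp (by positivity)
  rcases le_total 1 (chordSq τ r) with h | h
  · rw [min_eq_left h, mul_one]
    have h2 := Real.quadratic_le_exp_of_nonneg (x := |τ| / 2) (by positivity)
    have h3 : Real.exp (|τ| / 2) ≤ Real.exp ((|γ| + 1 / 2) * |τ|) := by
      refine Real.exp_le_exp.2 ?_
      nlinarith [mul_nonneg (abs_nonneg γ) (abs_nonneg τ)]
    rw [← sq_abs τ]
    nlinarith [abs_nonneg τ]
  · rw [min_eq_right h]
    have h2 := sq_le_chordSq τ r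
    have h3 := chordSq_nonneg τ r
    nlinarith [mul_le_mul_of_nonneg_right h1 h3]

end Pointwise

/-- The kernel `f(τ) polarKernel a τ r` cut off near the diagonal. -/
def cutKernel (a : ℝ) (f : ℝ → ℝ) (δ τ r : ℝ) : ℝ :=
  if δ < chordSq τ r then f τ * polarKernel a τ r else 0

theorem measurable_cutKernel (a : ℝ) {f : ℝ → ℝ} (hf : Measurable f) (δ : ℝ) :
    Measurable fun z : ℝ × ℝ => cutKernel a f δ z.1 z.2 :=
  Measurable.ite (measurableSet_lt measurable_const measurable_chordSq)
    ((hf.comp measurable_fst).mul (measurable_polarKernel a)) measurable_const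

/-! ### Ground state substitution and Hardy's inequality on the cylinder. -/

section Cylinder

variable {V : Type*} [NormedAddCommGroup V] [NormedSpace ℝ V] [MeasurableSpace V] [BorelSpace V]
  [SecondCountableTopology V] {σ : Measure V} {Γ : Set V} {k : ℕ} {a γ : ℝ}

/-- The Hardy constant `∫ (cosh γτ - 1) polarKernel a τ |p - w| dτ dσ(w)`. -/
def polarConstant (σ : Measure V) (a γ : ℝ) (p : V) : ℝ :=
  ∫ z : ℝ × V, (Real.cosh (γ * z.1) - 1) * polarKernel a z.1 ‖p - z.2‖ ∂((volume : Measure ℝ).prod σ)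

/-- Conditions on the exponents of the kernel. -/
structure Admissible (a γ : ℝ) (k : ℕ) : Prop where
  one_le : 1 ≤ a
  lt : |γ| + 1 / 2 < a
  lt_dim : 2 * (a - 1) < k

theorem IsAngular.integrable_majorant' (hσ : IsAngular σ Γ k) (h : Admissible a γ k) {p : V}
    (hp : p ∈ Γ) :
    Integrable (fun z : ℝ × V => majorant a (|γ| + 1 / 2) z.1 ‖p - z.2‖)
      ((volume : Measure ℝ).prod σ) :=
  hσ.integrable_majorant h.one_le (by positivity) h.lt h.lt_dim hp

theorem norm_cosh_sub_one_mul_le (a γ τ r : ℝ) :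
    ‖(Real.cosh (γ * τ) - 1) * polarKernel a τ r‖ ≤
      (1 + γ ^ 2) * majorant a (|γ| + 1 / 2) τ r := by
  have hk := polarKernel_nonneg a τ r
  rw [Real.norm_of_nonneg (mul_nonneg (cosh_sub_one_nonneg _) hk)]
  calc _ ≤ (1 + γ ^ 2) * (Real.exp (|γ| * |τ|) * min 1 (chordSq τ r)) * polarKernel a τ r :=
        mul_le_mul_of_nonneg_right (cosh_sub_one_le γ τ r) hk
    _ ≤ _ := by
        rw [mul_assoc]
        exact mul_le_mul_of_nonneg_left (exp_mul_min_mul_polarKernel_le a γ τ r) (by positivity)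

theorem IsAngular.polarConstant_eq (hσ : IsAngular σ Γ k) {p q : V} (hp : p ∈ Γ) (hq : q ∈ Γ) :
    polarConstant σ a γ p = polarConstant σ a γ q := by
  have := hσ.integral_comp hq hp 0 fun τ r => (Real.cosh (γ * τ) - 1) * polarKernel a τ r
  simpa only [sub_zero, polarConstant] using this

theorem IsAngular.integrable_cutKernel (hσ : IsAngular σ Γ k) (h : Admissible a γ k) {p : V}
    (hp : p ∈ Γ) {f : ℝ → ℝ} (hf : Measurable f) {C : ℝ}
    (hfC : ∀ τ, |f τ| ≤ C * Real.exp (|γ| * |τ|)) {δ : ℝ} (hδ : 0 < δ) :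
    Integrable (fun z : ℝ × V => cutKernel a f δ z.1 ‖p - z.2‖)
      ((volume : Measure ℝ).prod σ) := by
  have hC : 0 ≤ C := by
    have := (abs_nonneg _).trans (hfC 0)
    simpa using this
  refine ((hσ.integrable_majorant' h hp).const_mul (C * (min 1 δ)⁻¹)).mono'
    (measurable_comp_dist (measurable_cutKernel a hf δ) p).aestronglyMeasurable
    (.of_forall fun z => ?_)
  have hm : 0 < min 1 δ := lt_min one_pos hδ
  unfold cutKernel
  split_ifs with hd
  · have h1 := exp_mul_polarKernel_le hm (min_le_left _ _) a γ ((min_le_right _ _).trans hd.le)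
    rw [norm_mul, Real.norm_eq_abs, Real.norm_of_nonneg (polarKernel_nonneg _ _ _)]
    calc _ ≤ C * Real.exp (|γ| * |z.1|) * polarKernel a z.1 ‖p - z.2‖ :=
          mul_le_mul_of_nonneg_right (hfC _) (polarKernel_nonneg _ _ _)
      _ ≤ _ := by
          rw [mul_assoc, mul_assoc]
          exact mul_le_mul_of_nonneg_left h1 hC
  · rw [norm_zero]
    exact mul_nonneg (mul_nonneg hC (inv_nonneg.2 hm.le)) (majorant_nonneg _ _ _ _)

theorem abs_exp_mul_sub_one_le (γ τ : ℝ) :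
    |Real.exp (γ * τ) - 1| ≤ 1 * Real.exp (|γ| * |τ|) := by
  rw [one_mul, abs_le]
  have h1 := exp_le_exp_abs_mul γ τ
  have h2 : 1 ≤ Real.exp (|γ| * |τ|) := Real.one_le_exp (by positivity)
  have h3 := Real.exp_pos (γ * τ)
  constructor <;> linarith

/-- The cutoff depends on τ only through the even function `chordSq`, so averaging over τ and -τ
turns the exponential into a hyperbolic cosine. -/
theorem IsAngular.integral_cutKernel_exp (hσ : IsAngular σ Γ k) (h : Admissible a γ k) {p : V}
    (hp : p ∈ Γ) {δ : ℝ} (hδ : 0 < δ) :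
    ∫ z : ℝ × V, cutKernel a (fun τ => Real.exp (γ * τ) - 1) δ z.1 ‖p - z.2‖
        ∂((volume : Measure ℝ).prod σ) =
      ∫ z : ℝ × V, cutKernel a (fun τ => Real.cosh (γ * τ) - 1) δ z.1 ‖p - z.2‖
        ∂((volume : Measure ℝ).prod σ) := by
  have := hσ.isFiniteMeasure
  have hi := hσ.integrable_cutKernel h hp (f := fun τ => Real.exp (γ * τ) - 1) (by fun_prop)
    (abs_exp_mul_sub_one_le γ) hδ
  have h1 := integral_comp_neg_fst (σ := σ) p (cutKernel a (fun τ => Real.exp (γ * τ) - 1) δ)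
  have h2 : ∀ z : ℝ × V, cutKernel a (fun τ => Real.cosh (γ * τ) - 1) δ z.1 ‖p - z.2‖ =
      (1 / 2) * (cutKernel a (fun τ => Real.exp (γ * τ) - 1) δ z.1 ‖p - z.2‖ +
        cutKernel a (fun τ => Real.exp (γ * τ) - 1) δ (-z.1) ‖p - z.2‖) := by
    intro z
    simp only [cutKernel, chordSq_neg, polarKernel_neg]
    split_ifs
    · rw [Real.cosh_eq, mul_neg]; ring
    · ring
  simp_rw [h2]
  rw [integral_const_mul, integral_add hi (integrable_comp_neg_fst hi), h1]
  ring

theorem IsAngular.integral_cutKernel_exp_neg (hσ : IsAngular σ Γ k) (h : Admissible a γ k) {p : V}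
    (hp : p ∈ Γ) {δ : ℝ} (hδ : 0 < δ) :
    ∫ z : ℝ × V, cutKernel a (fun τ => Real.exp (-γ * τ) - 1) δ z.1 ‖p - z.2‖
        ∂((volume : Measure ℝ).prod σ) =
      ∫ z : ℝ × V, cutKernel a (fun τ => Real.cosh (γ * τ) - 1) δ z.1 ‖p - z.2‖
        ∂((volume : Measure ℝ).prod σ) := by
  have h' : Admissible a (-γ) k := ⟨h.one_le, by rw [abs_neg]; exact h.lt, h.lt_dim⟩
  rw [hσ.integral_cutKernel_exp h' hp hδ]
  simp only [neg_mul, Real.cosh_neg]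

theorem IsAngular.tendsto_integral_cutKernel (hσ : IsAngular σ Γ k) (h : Admissible a γ k) {p : V}
    (hp : p ∈ Γ) :
    Tendsto (fun δ : ℝ => ∫ z : ℝ × V, cutKernel a (fun τ => Real.cosh (γ * τ) - 1) δ z.1 ‖p - z.2‖
        ∂((volume : Measure ℝ).prod σ)) (𝓝[>] 0) (𝓝 (polarConstant σ a γ p)) := by
  refine tendsto_integral_filter_of_dominated_convergence _
    (.of_forall fun δ => (measurable_comp_dist (measurable_cutKernel a (by fun_prop) δ)
      p).aestronglyMeasurable) (.of_forall fun δ => .of_forall fun z => ?_)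
    ((hσ.integrable_majorant' h hp).const_mul (1 + γ ^ 2)) (.of_forall fun z => ?_)
  · unfold cutKernel
    split_ifs
    · exact norm_cosh_sub_one_mul_le _ _ _ _
    · rw [norm_zero]
      exact mul_nonneg (by positivity) (majorant_nonneg _ _ _ _)
  · rcases (chordSq_nonneg z.1 ‖p - z.2‖).eq_or_lt with h0 | h0
    -- The real power 0^{-a} is 0 by convention, so the point where the chord vanishes contributes
    -- nothing for any δ.
    · have : polarKernel a z.1 ‖p - z.2‖ = 0 := by
        rw [polarKernel, ← h0, Real.zero_rpow (by linarith [h.one_le])]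
      simp [cutKernel, this]
    · refine tendsto_const_nhds.congr' ?_
      filter_upwards [nhdsWithin_le_nhds (Iio_mem_nhds h0)] with δ hδ
      rw [cutKernel, if_pos (mem_Iio.1 hδ)]

/-- The energy density in logarithmic polar coordinates, `φ = e^{-γt} ψ`. -/
def polarEnergy (a γ : ℝ) (ψ : ℝ × V → ℝ) (z : (ℝ × V) × (ℝ × V)) : ℝ :=
  (Real.exp (γ * (z.2.1 - z.1.1)) * ψ z.1 ^ 2 + Real.exp (-γ * (z.2.1 - z.1.1)) * ψ z.2 ^ 2
    - 2 * ψ z.1 * ψ z.2) * polarKernel a (z.2.1 - z.1.1) ‖z.1.2 - z.2.2‖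

/-- The bracket is a perfect square because e^{γτ/2} and e^{-γτ/2} are reciprocal. -/
theorem polarEnergy_nonneg (ψ : ℝ × V → ℝ) (z : (ℝ × V) × (ℝ × V)) :
    0 ≤ polarEnergy a γ ψ z := by
  refine mul_nonneg ?_ (polarKernel_nonneg _ _ _)
  set x := Real.exp (γ * (z.2.1 - z.1.1) / 2) with hx
  set y := Real.exp (-γ * (z.2.1 - z.1.1) / 2) with hy
  have h1 : Real.exp (γ * (z.2.1 - z.1.1)) = x ^ 2 := by
    rw [hx, ← Real.exp_nat_mul]; congr 1; push_cast; ring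
  have h2 : Real.exp (-γ * (z.2.1 - z.1.1)) = y ^ 2 := by
    rw [hy, ← Real.exp_nat_mul]; congr 1; push_cast; ring
  have h3 : x * y = 1 := by
    rw [hx, hy, ← Real.exp_add, ← Real.exp_zero]; congr 1; ring
  rw [h1, h2]
  have : x ^ 2 * ψ z.1 ^ 2 + y ^ 2 * ψ z.2 ^ 2 - 2 * ψ z.1 * ψ z.2 =
      (x * ψ z.1 - y * ψ z.2) ^ 2 := by linear_combination (2 * ψ z.1 * ψ z.2) * h3
  rw [this]
  positivity

/-- The part of the square of the cylinder away from the diagonal. -/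
def offDiagonal (V : Type*) [NormedAddCommGroup V] (δ : ℝ) : Set ((ℝ × V) × (ℝ × V)) :=
  {z | δ < chordSq (z.2.1 - z.1.1) ‖z.1.2 - z.2.2‖}

theorem measurableSet_offDiagonal (δ : ℝ) : MeasurableSet (offDiagonal V δ) :=
  measurableSet_lt measurable_const (measurable_kernel measurable_chordSq)

/-- Ground state substitution away from the diagonal. -/
theorem IsAngular.integral_offDiagonal_polarEnergy (hσ : IsAngular σ Γ k) (h : Admissible a γ k)
    {p : V} (hp : p ∈ Γ) {ψ : ℝ × V → ℝ}
    (hψ : Integrable (fun z => ψ z ^ 2) ((volume : Measure ℝ).prod σ))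
    (hE : Integrable (polarEnergy a γ ψ)
      (((volume : Measure ℝ).prod σ).prod ((volume : Measure ℝ).prod σ))) {δ : ℝ} (hδ : 0 < δ) :
    ∫ z in offDiagonal V δ, polarEnergy a γ ψ z
        ∂(((volume : Measure ℝ).prod σ).prod ((volume : Measure ℝ).prod σ)) =
      (∫ z in offDiagonal V δ,
        (ψ z.1 - ψ z.2) ^ 2 * polarKernel a (z.2.1 - z.1.1) ‖z.1.2 - z.2.2‖
        ∂(((volume : Measure ℝ).prod σ).prod ((volume : Measure ℝ).prod σ))) +
      2 * ((∫ z, ψ z ^ 2 ∂((volume : Measure ℝ).prod σ)) *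
        ∫ z : ℝ × V, cutKernel a (fun τ => Real.cosh (γ * τ) - 1) δ z.1 ‖p - z.2‖
        ∂((volume : Measure ℝ).prod σ)) := by
  have hf1 : Measurable fun τ : ℝ => Real.exp (γ * τ) - 1 := by fun_prop
  have hf2 : Measurable fun τ : ℝ => Real.exp (-γ * τ) - 1 := by fun_prop
  have hC2 : ∀ τ : ℝ, |Real.exp (-γ * τ) - 1| ≤ 1 * Real.exp (|γ| * |τ|) := fun τ => by
    simpa only [abs_neg] using abs_exp_mul_sub_one_le (-γ) τ
  have hi1 := hσ.integrable_cutKernel h hp hf1 (abs_exp_mul_sub_one_le γ) hδ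
  have hi2 := hσ.integrable_cutKernel h hp hf2 hC2 hδ
  have hI1 := hσ.integrable_mul_kernel hp hψ (measurable_cutKernel a hf1 δ) hi1
  have hI2 := hσ.integrable_mul_kernel_snd hp hψ (measurable_cutKernel a hf2 δ) hi2
  have hJ1 := hσ.integral_mul_kernel hp hψ (measurable_cutKernel a hf1 δ) hi1
  have hJ2 := hσ.integral_mul_kernel_snd hp hψ (measurable_cutKernel a hf2 δ) hi2
  rw [hσ.integral_cutKernel_exp h hp hδ] at hJ1
  rw [hσ.integral_cutKernel_exp_neg h hp hδ] at hJ2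
  have hm := measurableSet_offDiagonal (V := V) δ
  rw [← integral_indicator hm, ← integral_indicator hm]
  -- The correction terms with e^{±γτ} - 1 need not be integrable up to the diagonal, hence the
  -- cutoff. Each of the two integrates to ∫ ψ² times the truncated Hardy constant, which accounts
  -- for the factor 2.
  have hpt : ∀ z : (ℝ × V) × (ℝ × V), (offDiagonal V δ).indicator
      (fun z => (ψ z.1 - ψ z.2) ^ 2 * polarKernel a (z.2.1 - z.1.1) ‖z.1.2 - z.2.2‖) z =
      (offDiagonal V δ).indicator (polarEnergy a γ ψ) z -
      (ψ z.1 ^ 2 * cutKernel a (fun τ => Real.exp (γ * τ) - 1) δ (z.2.1 - z.1.1) ‖z.1.2 - z.2.2‖ +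
       ψ z.2 ^ 2 * cutKernel a (fun τ => Real.exp (-γ * τ) - 1) δ (z.2.1 - z.1.1)
        ‖z.1.2 - z.2.2‖) := by
    intro z
    by_cases hz : δ < chordSq (z.2.1 - z.1.1) ‖z.1.2 - z.2.2‖
    · have hz' : z ∈ offDiagonal V δ := hz
      rw [indicator_of_mem hz', indicator_of_mem hz', cutKernel, cutKernel, if_pos hz, if_pos hz,
        polarEnergy]
      ring
    · have hz' : z ∉ offDiagonal V δ := hz
      rw [indicator_of_notMem hz', indicator_of_notMem hz', cutKernel, cutKernel, if_neg hz,
        if_neg hz]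
      ring
  simp_rw [hpt]
  rw [integral_sub (hE.indicator hm) (by exact hI1.add hI2), integral_add hI1 hI2, hJ1, hJ2]
  ring

theorem polarKernel_mul_sq_nonneg (ψ : ℝ × V → ℝ) (z : (ℝ × V) × (ℝ × V)) :
    0 ≤ (ψ z.1 - ψ z.2) ^ 2 * polarKernel a (z.2.1 - z.1.1) ‖z.1.2 - z.2.2‖ :=
  mul_nonneg (sq_nonneg _) (polarKernel_nonneg _ _ _)

/-- Hardy's inequality in logarithmic polar coordinates. -/
theorem IsAngular.polarConstant_mul_le (hσ : IsAngular σ Γ k) (h : Admissible a γ k)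
    {p : V} (hp : p ∈ Γ) {ψ : ℝ × V → ℝ}
    (hψ : Integrable (fun z => ψ z ^ 2) ((volume : Measure ℝ).prod σ))
    (hE : Integrable (polarEnergy a γ ψ)
      (((volume : Measure ℝ).prod σ).prod ((volume : Measure ℝ).prod σ))) :
    polarConstant σ a γ p * ∫ z, ψ z ^ 2 ∂((volume : Measure ℝ).prod σ) ≤
      1 / 2 * ∫ z, polarEnergy a γ ψ z
        ∂(((volume : Measure ℝ).prod σ).prod ((volume : Measure ℝ).prod σ)) := by
  refine le_of_tendsto ((hσ.tendsto_integral_cutKernel h hp).mul_const _) ?_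
  filter_upwards [self_mem_nhdsWithin] with δ hδ
  have h1 := hσ.integral_offDiagonal_polarEnergy h hp hψ hE hδ
  have h2 := setIntegral_le_integral (s := offDiagonal V δ) hE
    (.of_forall (polarEnergy_nonneg ψ))
  have h3 : 0 ≤ ∫ z in offDiagonal V δ,
        (ψ z.1 - ψ z.2) ^ 2 * polarKernel a (z.2.1 - z.1.1) ‖z.1.2 - z.2.2‖
        ∂(((volume : Measure ℝ).prod σ).prod ((volume : Measure ℝ).prod σ)) :=
    integral_nonneg fun z => polarKernel_mul_sq_nonneg ψ z
  rw [h1] at h2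
  linarith

/-- The half of the ground state identity needed for optimality. The truncated remainder is at most
the full one, and the truncated energies converge to the full energy. -/
theorem IsAngular.le_polarConstant_mul_add (hσ : IsAngular σ Γ k) (h : Admissible a γ k)
    {p : V} (hp : p ∈ Γ) {ψ : ℝ × V → ℝ}
    (hψ : Integrable (fun z => ψ z ^ 2) ((volume : Measure ℝ).prod σ))
    (hE : Integrable (polarEnergy a γ ψ)
      (((volume : Measure ℝ).prod σ).prod ((volume : Measure ℝ).prod σ)))
    (hD : Integrable (fun z : (ℝ × V) × (ℝ × V) =>
        (ψ z.1 - ψ z.2) ^ 2 * polarKernel a (z.2.1 - z.1.1) ‖z.1.2 - z.2.2‖)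
      (((volume : Measure ℝ).prod σ).prod ((volume : Measure ℝ).prod σ))) :
    1 / 2 * ∫ z, polarEnergy a γ ψ z
        ∂(((volume : Measure ℝ).prod σ).prod ((volume : Measure ℝ).prod σ)) ≤
      polarConstant σ a γ p * (∫ z, ψ z ^ 2 ∂((volume : Measure ℝ).prod σ)) +
      1 / 2 * ∫ z, (ψ z.1 - ψ z.2) ^ 2 * polarKernel a (z.2.1 - z.1.1) ‖z.1.2 - z.2.2‖
        ∂(((volume : Measure ℝ).prod σ).prod ((volume : Measure ℝ).prod σ)) := by
  have hlim : Tendsto (fun δ : ℝ => ∫ z in offDiagonal V δ, polarEnergy a γ ψ z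
        ∂(((volume : Measure ℝ).prod σ).prod ((volume : Measure ℝ).prod σ))) (𝓝[>] 0)
      (𝓝 (∫ z, polarEnergy a γ ψ z
        ∂(((volume : Measure ℝ).prod σ).prod ((volume : Measure ℝ).prod σ)))) := by
    simp_rw [← integral_indicator (measurableSet_offDiagonal (V := V) _)]
    refine tendsto_integral_filter_of_dominated_convergence (polarEnergy a γ ψ)
      (.of_forall fun δ => (hE.indicator (measurableSet_offDiagonal δ)).aestronglyMeasurable)
      (.of_forall fun δ => .of_forall fun z => ?_) hE (.of_forall fun z => ?_)
    · refine (norm_indicator_le_norm_self _ _).trans ?_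
      rw [Real.norm_of_nonneg (polarEnergy_nonneg ψ z)]
    · rcases (chordSq_nonneg (z.2.1 - z.1.1) ‖z.1.2 - z.2.2‖).eq_or_lt with h0 | h0
      · have : polarEnergy a γ ψ z = 0 := by
          rw [polarEnergy, polarKernel, ← h0, Real.zero_rpow (by linarith [h.one_le]), mul_zero]
        simp [indicator, this]
      · refine tendsto_const_nhds.congr' ?_
        filter_upwards [nhdsWithin_le_nhds (Iio_mem_nhds h0)] with δ hδ
        have hz' : z ∈ offDiagonal V δ := hδ
        rw [indicator_of_mem hz']
  refine le_of_tendsto_of_tendsto (hlim.const_mul (1 / 2))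
    (((hσ.tendsto_integral_cutKernel h hp).mul_const _).add_const _) ?_
  filter_upwards [self_mem_nhdsWithin] with δ hδ
  have h1 := hσ.integral_offDiagonal_polarEnergy h hp hψ hE hδ
  have h2 := setIntegral_le_integral (s := offDiagonal V δ) hD
    (.of_forall (polarKernel_mul_sq_nonneg ψ))
  rw [h1]
  linarith

end Cylinder

/-! ### Euclidean balls in polar coordinates and their asymmetry under τ ↦ -τ. -/

section Shell

/-- The kernel `f(τ) polarKernel a τ r` restricted to the complement of a Euclidean ball of
radius `δ`. -/
def ballKernel (a : ℝ) (f : ℝ → ℝ) (δ τ r : ℝ) : ℝ :=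
  if δ ^ 2 ≤ Real.exp τ * chordSq τ r then f τ * polarKernel a τ r else 0

theorem measurable_ballKernel (a : ℝ) {f : ℝ → ℝ} (hf : Measurable f) (δ : ℝ) :
    Measurable fun z : ℝ × ℝ => ballKernel a f δ z.1 z.2 :=
  Measurable.ite (measurableSet_le measurable_const
      ((Real.measurable_exp.comp measurable_fst).mul measurable_chordSq))
    ((hf.comp measurable_fst).mul (measurable_polarKernel a)) measurable_const

/-- The squared distance between unit vector p and e^τ w is e^τ `chordSq` τ |p-w|. Outside the ball
the kernel therefore stays uniformly away from its singularity. -/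
theorem min_le_chordSq_of_le {δ τ r : ℝ} (h : δ ^ 2 ≤ Real.exp τ * chordSq τ r) :
    min 1 (δ ^ 2 * Real.exp (-1)) ≤ chordSq τ r := by
  rcases le_total 1 |τ| with ht | ht
  · exact (min_le_left _ _).trans (one_le_chordSq ht r)
  · refine (min_le_right _ _).trans ?_
    have h1 : Real.exp τ ≤ Real.exp 1 := Real.exp_le_exp.2 ((le_abs_self τ).trans ht)
    rw [Real.exp_neg, ← div_eq_mul_inv, div_le_iff₀ (Real.exp_pos 1)]
    nlinarith [chordSq_nonneg τ r]

/-- The set where the complement of the Euclidean ball of radius `δ` is not symmetric under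
`τ ↦ -τ`. -/
def shell (δ : ℝ) : Set (ℝ × ℝ) :=
  {z | Real.exp (-|z.1|) * chordSq z.1 z.2 < δ ^ 2 ∧ δ ^ 2 ≤ Real.exp |z.1| * chordSq z.1 z.2}

theorem measurableSet_shell (δ : ℝ) : MeasurableSet (shell δ) :=
  (measurableSet_lt ((by fun_prop : Measurable fun z : ℝ × ℝ => Real.exp (-|z.1|)).mul
    measurable_chordSq) measurable_const).inter
  (measurableSet_le measurable_const ((by fun_prop : Measurable fun z : ℝ × ℝ =>
    Real.exp |z.1|).mul measurable_chordSq))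

/-- If |τ| ≥ 1, then `chordSq` ≥ e^{|τ|}/4 ≥ δ² e^{|τ|}, which contradicts the first shell
condition. Hence e^{|τ|} ≤ 3, and the two conditions give δ²/3 ≤ `chordSq` ≤ 3δ² ≤ (2δ)². -/
theorem shell_bounds {δ τ r : ℝ} (hδ : 0 < δ) (hδ1 : δ ≤ 1 / 2)
    (h : (τ, r) ∈ shell δ) :
    |τ| < 1 ∧ |τ| ≤ 2 * δ ∧ r ≤ 2 * δ ∧ δ ^ 2 / 3 ≤ chordSq τ r := by
  obtain ⟨h1, h2⟩ := h
  simp only at h1 h2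
  have hc := chordSq_nonneg τ r
  have h1' : chordSq τ r < δ ^ 2 * Real.exp |τ| := by
    rwa [Real.exp_neg, inv_mul_lt_iff₀ (Real.exp_pos _), mul_comm] at h1
  have ht : |τ| < 1 := by
    by_contra! ht
    have h3 := exp_le_chordSq ht r
    have h4 : δ ^ 2 ≤ 1 / 4 := by nlinarith
    nlinarith [mul_le_mul_of_nonneg_right h4 (Real.exp_pos |τ|).le]
  have he : Real.exp |τ| ≤ 3 := by
    have := Real.exp_le_exp.2 ht.le
    have := Real.exp_one_lt_d9
    linarith
  have h4 : chordSq τ r ≤ (2 * δ) ^ 2 := by nlinarith [sq_nonneg δ]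
  have h5 := sq_add_sq_le_chordSq τ r
  refine ⟨ht, ?_, ?_, ?_⟩
  · exact abs_le_of_sq_le_sq (by nlinarith [sq_nonneg r]) (by positivity)
  · exact le_of_sq_le_sq (by nlinarith [sq_nonneg τ]) (by positivity)
  · nlinarith

/-- The shell conditions give y² - x² ≤ `chordSq` y r - `chordSq` x r ≤ δ²(e^{|y|} - e^{-|x|}) ≤
2δ²(|x| + |y|). Dividing by |x| + |y| yields the claim. -/
theorem shell_abs_sub_le {δ x y r : ℝ} (hδ : 0 < δ) (hδ1 : δ ≤ 1 / 2)
    (hx : (x, r) ∈ shell δ) (hy : (y, r) ∈ shell δ) (hxy : |x| ≤ |y|) :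
    |y| - |x| ≤ 2 * δ ^ 2 := by
  have hy1 := (shell_bounds hδ hδ1 hy).1
  have h1 := hy.1
  have h2 := hx.2
  simp only at h1 h2
  have h3 := sq_sub_sq_le_cosh (abs_nonneg x) hxy
  have h4 : chordSq y r < δ ^ 2 * Real.exp |y| := by
    rwa [Real.exp_neg, inv_mul_lt_iff₀ (Real.exp_pos _), mul_comm] at h1
  have h5 : δ ^ 2 * Real.exp (-|x|) ≤ chordSq x r := by
    rwa [Real.exp_neg, ← div_eq_mul_inv, div_le_iff₀' (Real.exp_pos _)]
  have h6 : chordSq y r - chordSq x r = 2 * Real.cosh |y| - 2 * Real.cosh |x| := by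
    simp only [chordSq, Real.cosh_abs]; ring
  have h7 : Real.exp |y| - 1 ≤ 2 * |y| := by
    have := Real.abs_exp_sub_one_le (x := |y|) (by rw [abs_abs]; exact hy1.le)
    rw [abs_abs] at this
    exact (le_abs_self _).trans this
  have h8 : 1 - |x| ≤ Real.exp (-|x|) := by linarith [Real.add_one_le_exp (-|x|)]
  have h9 : (|y| - |x|) * (|y| + |x|) ≤ 2 * δ ^ 2 * (|y| + |x|) := by
    have h10 : Real.exp |y| - Real.exp (-|x|) ≤ 2 * |y| + |x| := by linarith
    have h11 := mul_le_mul_of_nonneg_left h10 (sq_nonneg δ)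
    nlinarith [abs_nonneg x, mul_nonneg (sq_nonneg δ) (abs_nonneg x)]
  rcases (add_nonneg (abs_nonneg y) (abs_nonneg x)).eq_or_lt with h0 | h0
  · have : |y| = 0 := by linarith [abs_nonneg x, abs_nonneg y]
    nlinarith [abs_nonneg x]
  · exact le_of_mul_le_mul_right h9 h0

/-- The positive and the negative half of a section each have diameter at most 2δ². The trivial
bound of order δ would lose a power of δ and leave δ^{-s} instead of δ^{1-s} in the error for the
cone. -/
theorem volume_shell_section_le {δ r : ℝ} (hδ : 0 < δ) (hδ1 : δ ≤ 1 / 2) :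
    volume {τ : ℝ | (τ, r) ∈ shell δ} ≤ ENNReal.ofReal (4 * δ ^ 2) := by
  have key : ∀ x y, (x, r) ∈ shell δ → (y, r) ∈ shell δ → |(|x| - |y|)| ≤ 2 * δ ^ 2 := by
    intro x y hx hy
    rcases le_total |x| |y| with h | h
    · rw [abs_sub_comm, abs_of_nonneg (sub_nonneg.2 h)]
      exact shell_abs_sub_le hδ hδ1 hx hy h
    · rw [abs_of_nonneg (sub_nonneg.2 h)]
      exact shell_abs_sub_le hδ hδ1 hy hx h
  have hpos : volume {τ : ℝ | (τ, r) ∈ shell δ ∧ 0 ≤ τ} ≤ ENNReal.ofReal (2 * δ ^ 2) := by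
    refine (Real.volume_le_diam _).trans (Metric.ediam_le fun x hx y hy => ?_)
    rw [edist_dist, Real.dist_eq]
    have := key x y hx.1 hy.1
    rw [abs_of_nonneg hx.2, abs_of_nonneg hy.2] at this
    exact ENNReal.ofReal_le_ofReal this
  have hneg : volume {τ : ℝ | (τ, r) ∈ shell δ ∧ τ ≤ 0} ≤ ENNReal.ofReal (2 * δ ^ 2) := by
    refine (Real.volume_le_diam _).trans (Metric.ediam_le fun x hx y hy => ?_)
    rw [edist_dist, Real.dist_eq]
    have := key x y hx.1 hy.1
    rw [abs_of_nonpos hx.2, abs_of_nonpos hy.2, neg_sub_neg, abs_sub_comm] at this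
    exact ENNReal.ofReal_le_ofReal this
  have hsub : {τ : ℝ | (τ, r) ∈ shell δ} ⊆
      {τ : ℝ | (τ, r) ∈ shell δ ∧ 0 ≤ τ} ∪ {τ : ℝ | (τ, r) ∈ shell δ ∧ τ ≤ 0} := by
    intro τ hτ
    rcases le_total 0 τ with h | h
    · exact Or.inl ⟨hτ, h⟩
    · exact Or.inr ⟨hτ, h⟩
  calc _ ≤ _ := measure_mono hsub
    _ ≤ _ := measure_union_le _ _
    _ ≤ ENNReal.ofReal (2 * δ ^ 2) + ENNReal.ofReal (2 * δ ^ 2) := add_le_add hpos hneg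
    _ = _ := by rw [← ENNReal.ofReal_add (by positivity) (by positivity)]; congr 1; ring

/-- The part of `ballKernel` that is not odd in `τ` lives on the shell. -/
theorem abs_ballKernel_sinh_add_le {a : ℝ} (ha : 0 ≤ a) (γ : ℝ) {δ : ℝ} (hδ : 0 < δ)
    (hδ1 : δ ≤ 1 / 2) (τ r : ℝ) :
    |ballKernel a (fun τ => Real.sinh (γ * τ)) δ τ r +
        ballKernel a (fun τ => Real.sinh (γ * τ)) δ (-τ) r| ≤
      (shell δ).indicator
        (fun _ => 2 * δ * (|γ| * Real.exp |γ|) * (δ ^ 2 / 3) ^ (-a)) (τ, r) := by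
  have hk := polarKernel_nonneg a τ r
  have hbound : (τ, r) ∈ shell δ → |Real.sinh (γ * τ) * polarKernel a τ r| ≤
      2 * δ * (|γ| * Real.exp |γ|) * (δ ^ 2 / 3) ^ (-a) := by
    intro hs
    obtain ⟨h1, h2, -, h4⟩ := shell_bounds hδ hδ1 hs
    rw [abs_mul, abs_of_nonneg hk]
    have h5 : |Real.sinh (γ * τ)| ≤ 2 * δ * (|γ| * Real.exp |γ|) := by
      refine (abs_sinh_le _).trans ?_
      have h6 : |γ * τ| ≤ |γ| := by
        rw [abs_mul]; nlinarith [abs_nonneg γ]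
      calc |γ * τ| * Real.exp |γ * τ| ≤ (|γ| * (2 * δ)) * Real.exp |γ| := by
            rw [abs_mul] at h6 ⊢
            gcongr
        _ = _ := by ring
    have h6 : polarKernel a τ r ≤ (δ ^ 2 / 3) ^ (-a) :=
      Real.rpow_le_rpow_of_nonpos (by positivity) h4 (by linarith)
    exact mul_le_mul h5 h6 hk (by positivity)
  have hc := chordSq_nonneg τ r
  have hab : (τ = |τ| ∧ -τ = -|τ|) ∨ (τ = -|τ| ∧ -τ = |τ|) := by
    rcases le_total 0 τ with h | h
    · exact Or.inl ⟨(abs_of_nonneg h).symm, by rw [abs_of_nonneg h]⟩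
    · exact Or.inr ⟨by rw [abs_of_nonpos h, neg_neg], by rw [abs_of_nonpos h]⟩
  have hexp : Real.exp (-|τ|) * chordSq τ r ≤ Real.exp |τ| * chordSq τ r := by
    gcongr
    linarith [abs_nonneg τ]
  have hshell : (τ, r) ∈ shell δ ↔
      ¬ (δ ^ 2 ≤ Real.exp (-|τ|) * chordSq τ r) ∧ δ ^ 2 ≤ Real.exp |τ| * chordSq τ r := by
    rw [not_le]; rfl
  simp only [ballKernel, chordSq_neg, polarKernel_neg, mul_neg, Real.sinh_neg]
  -- P and Q stand for the ball conditions at τ and at -τ. The odd contributions cancel when the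
  -- conditions agree, and they disagree exactly on the shell.
  have hE : ∀ P Q : Prop, [Decidable P] → [Decidable Q] →
      ((¬ (P ↔ Q)) → (τ, r) ∈ shell δ) → ((P ↔ Q) → (τ, r) ∉ shell δ) →
      |(if P then Real.sinh (γ * τ) * polarKernel a τ r else 0) +
        (if Q then -Real.sinh (γ * τ) * polarKernel a τ r else 0)| ≤
      (shell δ).indicator
        (fun _ => 2 * δ * (|γ| * Real.exp |γ|) * (δ ^ 2 / 3) ^ (-a)) (τ, r) := by
    intro P Q _ _ h1 h2
    by_cases hP : P <;> by_cases hQ : Q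
    · rw [indicator_of_notMem (h2 (by simp [hP, hQ]))]
      simp [hP, hQ]
    · have hs := h1 (by simp [hP, hQ])
      rw [indicator_of_mem hs]
      simpa only [hP, hQ, if_true, if_false, add_zero, zero_add, neg_mul, abs_neg] using hbound hs
    · have hs := h1 (by simp [hP, hQ])
      rw [indicator_of_mem hs]
      simpa only [hP, hQ, if_true, if_false, add_zero, zero_add, neg_mul, abs_neg] using hbound hs
    · rw [indicator_of_notMem (h2 (by simp [hP, hQ]))]
      simp [hP, hQ]
  apply hE
  · intro h
    rw [hshell]
    rcases hab with ⟨h1, h2⟩ | ⟨h1, h2⟩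
    · rw [h2] at h
      rw [show Real.exp τ = Real.exp |τ| by rw [← h1]] at h
      constructor
      · intro h3
        exact h ⟨fun _ => h3, fun _ => h3.trans hexp⟩
      · by_contra h3
        exact h ⟨fun h4 => absurd h4 h3, fun h4 => absurd (h4.trans hexp) h3⟩
    · rw [h2] at h
      rw [show Real.exp τ = Real.exp (-|τ|) by rw [← h1]] at h
      constructor
      · intro h3
        exact h ⟨fun _ => h3.trans hexp, fun _ => h3⟩
      · by_contra h3
        exact h ⟨fun h4 => absurd (h4.trans hexp) h3, fun h4 => absurd h4 h3⟩
  · intro h hs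
    rw [hshell] at hs
    rcases hab with ⟨h1, h2⟩ | ⟨h1, h2⟩
    · rw [h2] at h
      rw [show Real.exp τ = Real.exp |τ| by rw [← h1]] at h
      exact hs.1 (h.1 hs.2)
    · rw [h2] at h
      rw [show Real.exp τ = Real.exp (-|τ|) by rw [← h1]] at h
      exact hs.1 (h.2 hs.2)

end Shell

/-! ### The principal value on the cylinder. -/

section Cylinder

variable {V : Type*} [NormedAddCommGroup V] [NormedSpace ℝ V] [MeasurableSpace V] [BorelSpace V]
  [SecondCountableTopology V] {σ : Measure V} {Γ : Set V} {k : ℕ} {a γ : ℝ}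

theorem IsAngular.integrable_ballKernel (hσ : IsAngular σ Γ k) (h : Admissible a γ k) {p : V}
    (hp : p ∈ Γ) {f : ℝ → ℝ} (hf : Measurable f) {C : ℝ}
    (hfC : ∀ τ, |f τ| ≤ C * Real.exp (|γ| * |τ|)) {δ : ℝ} (hδ : 0 < δ) :
    Integrable (fun z : ℝ × V => ballKernel a f δ z.1 ‖p - z.2‖)
      ((volume : Measure ℝ).prod σ) := by
  have hC : 0 ≤ C := by
    have := (abs_nonneg _).trans (hfC 0)
    simpa using this
  set ε := min 1 (δ ^ 2 * Real.exp (-1)) with hε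
  have hε0 : 0 < ε := lt_min one_pos (by positivity)
  refine ((hσ.integrable_majorant' h hp).const_mul (C * ε⁻¹)).mono'
    (measurable_comp_dist (measurable_ballKernel a hf δ) p).aestronglyMeasurable
    (.of_forall fun z => ?_)
  unfold ballKernel
  split_ifs with hd
  · have h1 := exp_mul_polarKernel_le hε0 (min_le_left _ _) a γ (min_le_chordSq_of_le hd)
    rw [norm_mul, Real.norm_eq_abs, Real.norm_of_nonneg (polarKernel_nonneg _ _ _)]
    calc _ ≤ C * Real.exp (|γ| * |z.1|) * polarKernel a z.1 ‖p - z.2‖ :=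
          mul_le_mul_of_nonneg_right (hfC _) (polarKernel_nonneg _ _ _)
      _ ≤ _ := by
          rw [mul_assoc, mul_assoc]
          exact mul_le_mul_of_nonneg_left h1 hC
  · rw [norm_zero]
    exact mul_nonneg (mul_nonneg hC (inv_nonneg.2 hε0.le)) (majorant_nonneg _ _ _ _)

theorem IsAngular.tendsto_integral_ballKernel_cosh (hσ : IsAngular σ Γ k) (h : Admissible a γ k)
    {p : V} (hp : p ∈ Γ) :
    Tendsto (fun δ : ℝ => ∫ z : ℝ × V, ballKernel a (fun τ => Real.cosh (γ * τ) - 1) δ z.1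
      ‖p - z.2‖ ∂((volume : Measure ℝ).prod σ)) (𝓝[>] 0) (𝓝 (polarConstant σ a γ p)) := by
  refine tendsto_integral_filter_of_dominated_convergence _
    (.of_forall fun δ => (measurable_comp_dist (measurable_ballKernel a (by fun_prop) δ)
      p).aestronglyMeasurable) (.of_forall fun δ => .of_forall fun z => ?_)
    ((hσ.integrable_majorant' h hp).const_mul (1 + γ ^ 2)) (.of_forall fun z => ?_)
  · unfold ballKernel
    split_ifs
    · exact norm_cosh_sub_one_mul_le _ _ _ _
    · rw [norm_zero]
      exact mul_nonneg (by positivity) (majorant_nonneg _ _ _ _)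
  · rcases (chordSq_nonneg z.1 ‖p - z.2‖).eq_or_lt with h0 | h0
    · have : polarKernel a z.1 ‖p - z.2‖ = 0 := by
        rw [polarKernel, ← h0, Real.zero_rpow (by linarith [h.one_le])]
      simp [ballKernel, this]
    · refine tendsto_const_nhds.congr' ?_
      have hlim : Tendsto (fun δ : ℝ => δ ^ 2) (𝓝 0) (𝓝 0) := by
        simpa using (continuous_pow 2 : Continuous fun δ : ℝ => δ ^ 2).tendsto 0
      filter_upwards [nhdsWithin_le_nhds
        (hlim (Iio_mem_nhds (mul_pos (Real.exp_pos z.1) h0)))] with δ hδ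
      rw [ballKernel, if_pos (le_of_lt hδ)]

/-- After symmetrization in τ only the shell contributes. Its measure is O(δ^{k+1}), from sections
of length O(δ²) over a cap of measure O(δ^{k-1}), and the integrand there is O(δ^{1-2a}). -/
theorem IsAngular.exists_abs_integral_ballKernel_sinh_le (hσ : IsAngular σ Γ k)
    (h : Admissible a γ k) {p : V} (hp : p ∈ Γ) :
    ∃ C : ℝ, ∀ δ : ℝ, 0 < δ → δ ≤ 1 / 2 →
      |∫ z : ℝ × V, ballKernel a (fun τ => Real.sinh (γ * τ)) δ z.1 ‖p - z.2‖
        ∂((volume : Measure ℝ).prod σ)| ≤ C * δ ^ ((k : ℝ) + 2 - 2 * a) := by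
  have := hσ.isFiniteMeasure
  obtain ⟨C, hC, hball⟩ := hσ.closedBall_le
  refine ⟨(|γ| * Real.exp |γ|) * 3 ^ a * (C.toReal * 2 ^ (k + 1)), fun δ hδ hδ1 => ?_⟩
  have hf : ∀ τ, |Real.sinh (γ * τ)| ≤ 1 * Real.exp (|γ| * |τ|) := by
    intro τ
    rw [one_mul, Real.abs_sinh, ← abs_mul]
    exact (Real.sinh_lt_cosh _).le.trans (by
      simpa using cosh_le_exp_abs_mul 1 |γ * τ|)
  have hi := hσ.integrable_ballKernel h hp (f := fun τ => Real.sinh (γ * τ)) (by fun_prop) hf hδ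
  set S : Set (ℝ × V) := {z | (z.1, ‖p - z.2‖) ∈ shell δ} with hS
  have hSm : MeasurableSet S := (by fun_prop : Measurable fun z : ℝ × V => (z.1, ‖p - z.2‖))
    (measurableSet_shell δ)
  have hSvol : ((volume : Measure ℝ).prod σ) S ≤ C * ENNReal.ofReal (2 * δ) ^ (k + 1) := by
    rw [Measure.prod_apply_symm hSm]
    calc ∫⁻ w, volume ((fun τ : ℝ => (τ, w)) ⁻¹' S) ∂σ
        ≤ ∫⁻ w, (Metric.closedBall p (2 * δ)).indicator
            (fun _ => ENNReal.ofReal (4 * δ ^ 2)) w ∂σ := by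
          refine lintegral_mono fun w => ?_
          by_cases hw : w ∈ Metric.closedBall p (2 * δ)
          · rw [indicator_of_mem hw]
            exact volume_shell_section_le (r := ‖p - w‖) hδ hδ1
          · have : (fun τ : ℝ => (τ, w)) ⁻¹' S = ∅ := by
              refine eq_empty_of_forall_notMem fun τ hτ => hw ?_
              rw [Metric.mem_closedBall, dist_comm, dist_eq_norm]
              have hτ' : (τ, ‖p - w‖) ∈ shell δ := hτ
              exact (shell_bounds hδ hδ1 hτ').2.2.1
            rw [this, measure_empty]
            exact zero_le
      _ = ENNReal.ofReal (4 * δ ^ 2) * σ (Metric.closedBall p (2 * δ)) := by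
          rw [lintegral_indicator measurableSet_closedBall, setLIntegral_const]
      _ = ENNReal.ofReal (2 * δ) * (ENNReal.ofReal (2 * δ) * σ (Metric.closedBall p (2 * δ))) := by
          rw [← mul_assoc, ← ENNReal.ofReal_mul (by positivity)]
          congr 2; ring
      _ ≤ ENNReal.ofReal (2 * δ) * (C * ENNReal.ofReal (2 * δ) ^ k) :=
          mul_le_mul' le_rfl (hball p hp (2 * δ) (by positivity) (by linarith))
      _ = _ := by ring
  have hSreal : (((volume : Measure ℝ).prod σ) S).toReal ≤ C.toReal * (2 * δ) ^ (k + 1) := by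
    have := ENNReal.toReal_mono (ENNReal.mul_ne_top hC (ENNReal.pow_ne_top ENNReal.ofReal_ne_top)) hSvol
    rwa [ENNReal.toReal_mul, ENNReal.toReal_pow, ENNReal.toReal_ofReal (by positivity)] at this
  have hSfin : ((volume : Measure ℝ).prod σ) S ≠ ⊤ :=
    (hSvol.trans_lt (ENNReal.mul_lt_top hC.lt_top (ENNReal.pow_lt_top ENNReal.ofReal_lt_top))).ne
  have h1 := integral_comp_neg_fst (σ := σ) p (ballKernel a (fun τ => Real.sinh (γ * τ)) δ)
  have h2 : ∫ z : ℝ × V, ballKernel a (fun τ => Real.sinh (γ * τ)) δ z.1 ‖p - z.2‖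
      ∂((volume : Measure ℝ).prod σ) = 1 / 2 * ∫ z : ℝ × V,
        (ballKernel a (fun τ => Real.sinh (γ * τ)) δ z.1 ‖p - z.2‖ +
          ballKernel a (fun τ => Real.sinh (γ * τ)) δ (-z.1) ‖p - z.2‖)
      ∂((volume : Measure ℝ).prod σ) := by
    rw [integral_add hi (integrable_comp_neg_fst hi), h1]; ring
  set M := 2 * δ * (|γ| * Real.exp |γ|) * (δ ^ 2 / 3) ^ (-a) with hM
  have hM0 : 0 ≤ M := by positivity
  have h3 : |∫ z : ℝ × V,
        (ballKernel a (fun τ => Real.sinh (γ * τ)) δ z.1 ‖p - z.2‖ +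
          ballKernel a (fun τ => Real.sinh (γ * τ)) δ (-z.1) ‖p - z.2‖)
      ∂((volume : Measure ℝ).prod σ)| ≤ (((volume : Measure ℝ).prod σ) S).toReal * M := by
    rw [← Real.norm_eq_abs]
    refine (norm_integral_le_of_norm_le (g := S.indicator fun _ => M)
      ((integrable_indicator_iff hSm).2 (integrableOn_const hSfin)) (.of_forall fun z => ?_)).trans
      (le_of_eq ?_)
    · exact abs_ballKernel_sinh_add_le (by linarith [h.one_le]) γ hδ hδ1 z.1 ‖p - z.2‖
    · rw [integral_indicator hSm, setIntegral_const, smul_eq_mul, Measure.real]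
  rw [h2, abs_mul, abs_of_nonneg (by norm_num : (0 : ℝ) ≤ 1 / 2)]
  calc 1 / 2 * |_| ≤ 1 / 2 * (C.toReal * (2 * δ) ^ (k + 1) * M) := by
        gcongr
        exact h3.trans (mul_le_mul_of_nonneg_right hSreal hM0)
    _ = _ := by
        have e1 : (δ ^ 2 / 3) ^ (-a) = 3 ^ a * δ ^ (-2 * a) := by
          rw [Real.div_rpow (by positivity) (by norm_num), ← Real.rpow_natCast,
            ← Real.rpow_mul hδ.le, Real.rpow_neg (by norm_num), div_inv_eq_mul, mul_comm]
          congr 2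
          push_cast; ring
        have e2 : δ ^ ((k : ℝ) + 2 - 2 * a) = δ ^ (k + 1) * δ * δ ^ (-2 * a) := by
          rw [show (k : ℝ) + 2 - 2 * a = ((k + 1 : ℕ) : ℝ) + 1 + (-2 * a) by push_cast; ring,
            Real.rpow_add hδ, Real.rpow_add hδ, Real.rpow_one, Real.rpow_natCast]
        rw [hM, e1, e2, mul_pow]
        ring

/-- The principal value in logarithmic polar coordinates. -/
theorem IsAngular.tendsto_integral_ballKernel (hσ : IsAngular σ Γ k) (h : Admissible a γ k)
    {p : V} (hp : p ∈ Γ) :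
    Tendsto (fun δ : ℝ => ∫ z : ℝ × V, ballKernel a (fun τ => Real.exp (γ * τ) - 1) δ z.1
      ‖p - z.2‖ ∂((volume : Measure ℝ).prod σ)) (𝓝[>] 0) (𝓝 (polarConstant σ a γ p)) := by
  have hf : ∀ τ, |Real.sinh (γ * τ)| ≤ 1 * Real.exp (|γ| * |τ|) := by
    intro τ
    rw [one_mul, Real.abs_sinh, ← abs_mul]
    exact (Real.sinh_lt_cosh _).le.trans (by
      simpa using cosh_le_exp_abs_mul 1 |γ * τ|)
  have hg : ∀ τ, |Real.cosh (γ * τ) - 1| ≤ 1 * Real.exp (|γ| * |τ|) := by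
    intro τ
    rw [one_mul, abs_of_nonneg (cosh_sub_one_nonneg _)]
    linarith [cosh_le_exp_abs_mul γ τ]
  obtain ⟨C, hC⟩ := hσ.exists_abs_integral_ballKernel_sinh_le h hp
  -- For the cone, k = N - 1 and 2a = N + s, so this exponent is 1 - s.
  have hpos : 0 < (k : ℝ) + 2 - 2 * a := by linarith [h.lt_dim]
  have hsinh : Tendsto (fun δ : ℝ => ∫ z : ℝ × V, ballKernel a (fun τ => Real.sinh (γ * τ)) δ z.1
      ‖p - z.2‖ ∂((volume : Measure ℝ).prod σ)) (𝓝[>] 0) (𝓝 0) := by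
    refine squeeze_zero_norm' (a := fun δ => C * δ ^ ((k : ℝ) + 2 - 2 * a)) ?_ ?_
    · filter_upwards [self_mem_nhdsWithin,
        nhdsWithin_le_nhds (Iio_mem_nhds (by norm_num : (0 : ℝ) < 1 / 2))] with δ h1 h2
      exact hC δ h1 (le_of_lt h2)
    · have h1 := (Real.continuousAt_rpow_const 0 ((k : ℝ) + 2 - 2 * a) (Or.inr hpos.le)).tendsto
      rw [Real.zero_rpow hpos.ne'] at h1
      simpa using (h1.mono_left nhdsWithin_le_nhds).const_mul C
  have hsum := (hσ.tendsto_integral_ballKernel_cosh h hp).add hsinh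
  rw [add_zero] at hsum
  refine hsum.congr' ?_
  filter_upwards [self_mem_nhdsWithin] with δ hδ
  rw [← integral_add (hσ.integrable_ballKernel h hp (by fun_prop) hg hδ)
    (hσ.integrable_ballKernel h hp (by fun_prop) hf hδ)]
  refine integral_congr_ae (.of_forall fun z => ?_)
  simp only [ballKernel]
  split_ifs
  · rw [← Real.cosh_add_sinh]; ring
  · ring

end Cylinder

/-! ### The exponents of the problem. -/

section Exponents

/-- Half the order of the kernel, `(N + s) / 2`. -/
def kernelExponent (m n : ℕ) (s : ℝ) : ℝ := ((m : ℝ) + n + s) / 2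

/-- The Hardy exponent `(N - 2 - s) / 2`. -/
def hardyExponent (m n : ℕ) (s : ℝ) : ℝ := ((m : ℝ) + n - 2 - s) / 2

/-- Here a - γ = 1 + s and a + γ = N - 1 both exceed 1/2, and 2(a-1) = N + s - 2 is below N - 1
precisely because s < 1. -/
theorem admissible_exponents {m n : ℕ} (hm : 1 ≤ m) (hn : 1 ≤ n) {s : ℝ} (hs0 : 0 ≤ s)
    (hs1 : s < 1) : Admissible (kernelExponent m n s) (hardyExponent m n s) (m + n - 1) := by
  have h1 : (1 : ℝ) ≤ m := by exact_mod_cast hm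
  have h2 : (1 : ℝ) ≤ n := by exact_mod_cast hn
  refine ⟨by unfold kernelExponent; linarith, ?_, ?_⟩
  · unfold kernelExponent hardyExponent
    rcases abs_cases (((m : ℝ) + n - 2 - s) / 2) with ⟨h, _⟩ | ⟨h, _⟩ <;> rw [h] <;> linarith
  · rw [Nat.cast_sub (by omega), kernelExponent]
    push_cast
    linarith

theorem norm_expPolar_sub_sq {V : Type*} [NormedAddCommGroup V] [InnerProductSpace ℝ V] {w w' : V}
    (hw : ‖w‖ = 1) (hw' : ‖w'‖ = 1) (t t' : ℝ) :
    ‖Real.exp t • w - Real.exp t' • w'‖ ^ 2 =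
      Real.exp (t + t') * chordSq (t' - t) ‖w - w'‖ := by
  rw [norm_sub_sq_real, chordSq, norm_sub_sq_real, norm_smul, norm_smul, hw, hw', Real.cosh_eq,
    real_inner_smul_left, real_inner_smul_right]
  simp only [Real.norm_eq_abs, Real.abs_exp]
  rw [neg_sub, Real.exp_sub, Real.exp_sub, Real.exp_add]
  have h1 := Real.exp_ne_zero t
  have h2 := Real.exp_ne_zero t'
  field_simp
  ring

theorem inv_norm_expPolar_sub_rpow {V : Type*} [NormedAddCommGroup V] [InnerProductSpace ℝ V]
    {w w' : V} (hw : ‖w‖ = 1) (hw' : ‖w'‖ = 1) (t t' a : ℝ) :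
    (‖Real.exp t • w - Real.exp t' • w'‖ ^ (2 * a))⁻¹ =
      Real.exp (-a * (t + t')) * polarKernel a (t' - t) ‖w - w'‖ := by
  rw [Real.rpow_mul (norm_nonneg _), Real.rpow_two, norm_expPolar_sub_sq hw hw',
    Real.mul_rpow (Real.exp_pos _).le (chordSq_nonneg _ _), mul_inv, polarKernel,
    Real.rpow_neg (chordSq_nonneg _ _), ← Real.exp_mul, ← Real.exp_neg]
  congr 2
  ring

end Exponents

/-! ### The link of the cone and the Hardy constant. -/

section Cone

variable {m n : ℕ} {α s : ℝ}

/-- The intersection of the cone with the unit sphere. -/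
def coneLink (m n : ℕ) (α : ℝ) : Set (Space m n) := {p | p ∈ cone m n α ∧ ‖p‖ = 1}

/-- The angular part of the surface measure of the cone. -/
def linkMeasure (m n : ℕ) (α : ℝ) : Measure (Space m n) :=
  angularMeasure (surfaceMeasure m n α) ((m : ℝ) + n - 1)

theorem isAngular_linkMeasure (hm : 1 ≤ m) (hn : 1 ≤ n) (hα : 0 < α) :
    IsAngular (linkMeasure m n α) (coneLink m n α) (m + n - 1) := by
  have hμ := isHomogeneous_surfaceMeasure hm hn hα
  have hfin : IsFiniteMeasure (linkMeasure m n α) := hμ.isFiniteMeasure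
  refine ⟨hfin, ?_, fun p hp q hq => ?_, ?_⟩
  · refine hμ.ae_angularMeasure (P := fun w => w ∈ coneLink m n α) ?_ ?_
    · exact measurableSet_cone.inter
        (measurableSet_eq_fun (f := fun w : Space m n => ‖w‖) (by fun_prop) measurable_const)
    · filter_upwards [ae_mem_cone] with x hx h0
      refine ⟨smul_mem_cone hx _, ?_⟩
      rw [norm_smul, norm_inv, norm_norm, inv_mul_cancel₀ (norm_ne_zero_iff.2 h0)]
  · obtain ⟨R, hR, hRμ⟩ := exists_cone_symmetry hp.1 hq.1 (hp.2.trans hq.2.symm)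
    exact ⟨R, hR, measurePreserving_angularMeasure R hRμ⟩
  · obtain ⟨C, hC, hball⟩ := exists_surfaceMeasure_closedBall_le (n := n) hm hα
    have hc := coneSine_pos hα
    -- The first summand serves small radii through area growth. The second serves r ≥ `coneSine α`
    -- / 6, where finiteness of the total mass is enough.
    refine ⟨C * 3 ^ (m + n - 1) + linkMeasure m n α univ *
      ENNReal.ofReal (6 / coneSine α) ^ (m + n - 1), ?_, fun p hp r hr0 hr1 => ?_⟩
    · exact ENNReal.add_ne_top.2 ⟨ENNReal.mul_ne_top hC (by simp),
        ENNReal.mul_ne_top (measure_ne_top _ _) (ENNReal.pow_ne_top ENNReal.ofReal_ne_top)⟩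
    have h1n : (1 : ℝ) ≤ m := by exact_mod_cast hm
    rcases le_total (3 * r) (coneSine α * ‖p‖ / 2) with h | h
    · have hp0 : p ≠ 0 := norm_ne_zero_iff.1 (by rw [hp.2]; norm_num)
      calc _ ≤ surfaceMeasure m n α (Metric.closedBall p (3 * r)) :=
            hμ.mul_angularMeasure_closedBall_le
              (by linarith [(Nat.cast_nonneg n : (0 : ℝ) ≤ n)]) hr0 hr1
        _ ≤ C * ENNReal.ofReal (3 * r) ^ (m + n - 1) := hball p hp.1 hp0 _ (by positivity) h
        _ = C * 3 ^ (m + n - 1) * ENNReal.ofReal r ^ (m + n - 1) := by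
            rw [ENNReal.ofReal_mul (by norm_num), mul_pow, mul_assoc]
            simp
        _ ≤ _ := by gcongr; exact le_self_add
    · rw [hp.2, mul_one] at h
      have h1 : 1 ≤ 6 / coneSine α * r := by
        rw [div_mul_eq_mul_div, le_div_iff₀ hc]; linarith
      calc _ ≤ 1 * linkMeasure m n α univ := by
            gcongr
            · exact ENNReal.ofReal_le_one.2 hr1
            · exact subset_univ _
        _ ≤ linkMeasure m n α univ * ENNReal.ofReal (6 / coneSine α * r) ^ (m + n - 1) := by
            rw [one_mul]
            refine le_mul_of_one_le_right' (one_le_pow₀ ?_)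
            rwa [ENNReal.one_le_ofReal]
        _ = linkMeasure m n α univ * ENNReal.ofReal (6 / coneSine α) ^ (m + n - 1) *
            ENNReal.ofReal r ^ (m + n - 1) := by
            rw [ENNReal.ofReal_mul (by positivity), mul_pow, mul_assoc]
        _ ≤ _ := by gcongr; exact le_add_self

theorem linkMeasure_univ_pos (hm : 1 ≤ m) (hn : 1 ≤ n) (hα : 0 < α) :
    0 < (linkMeasure m n α).real univ := by
  have hμ := isHomogeneous_surfaceMeasure hm hn hα
  have : IsFiniteMeasure (linkMeasure m n α) := hμ.isFiniteMeasure
  have : NeZero (linkMeasure m n α) :=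
    ⟨hμ.angularMeasure_ne_zero (surfaceMeasure_ne_zero hm hn hα)⟩
  exact measureReal_univ_pos

theorem coneLink_nonempty (hm : 1 ≤ m) (hn : 1 ≤ n) (hα : 0 < α) : (coneLink m n α).Nonempty := by
  have h := isAngular_linkMeasure hm hn hα
  have : NeZero (linkMeasure m n α) :=
    ⟨(isHomogeneous_surfaceMeasure hm hn hα).angularMeasure_ne_zero
      (surfaceMeasure_ne_zero hm hn hα)⟩
  exact h.ae_mem.exists

/-- The constant `H(m, n, s)` is a principal value. -/
theorem hasPrincipalValue_hardyConstantIntegrand (hm : 1 ≤ m) (hn : 1 ≤ n) (hα : 0 < α)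
    (hs0 : 0 ≤ s) (hs1 : s < 1) {p : Space m n} (hp : p ∈ coneLink m n α) :
    HasPrincipalValue (surfaceMeasure m n α) (hardyConstantIntegrand s p) p
      (polarConstant (linkMeasure m n α) (kernelExponent m n s) (hardyExponent m n s) p) := by
  have hμ := isHomogeneous_surfaceMeasure hm hn hα
  have hσ := isAngular_linkMeasure (α := α) hm hn hα
  have had := admissible_exponents hm hn hs0 hs1
  set a := kernelExponent m n s with ha
  set γ := hardyExponent m n s with hγ
  have hf : Measurable (hardyConstantIntegrand s p : Space m n → ℝ) := by
    unfold hardyConstantIntegrand; fun_prop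
  have hpt : ∀ δ : ℝ, 0 < δ → (fun z : ℝ × Space m n => Real.exp (((m : ℝ) + n - 1) * z.1) *
      (Metric.ball p δ)ᶜ.indicator (hardyConstantIntegrand s p) (expPolar z)) =ᵐ[
        (volume : Measure ℝ).prod (linkMeasure m n α)]
      fun z => ballKernel a (fun τ => Real.exp (γ * τ) - 1) δ z.1 ‖p - z.2‖ := by
    intro δ hδ
    filter_upwards [hσ.ae_mem_prod] with z hz
    have hsq := norm_expPolar_sub_sq hp.2 hz.2 0 z.1
    have hker := inv_norm_expPolar_sub_rpow hp.2 hz.2 0 z.1 a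
    rw [Real.exp_zero, one_smul, zero_add, sub_zero] at hsq hker
    have hmem : expPolar z ∈ (Metric.ball p δ)ᶜ ↔
        δ ^ 2 ≤ Real.exp z.1 * chordSq z.1 ‖p - z.2‖ := by
      rw [← hsq, mem_compl_iff, Metric.mem_ball, not_lt, dist_comm, dist_eq_norm, expPolar,
        pow_le_pow_iff_left₀ hδ.le (norm_nonneg _) two_ne_zero]
    by_cases h : δ ^ 2 ≤ Real.exp z.1 * chordSq z.1 ‖p - z.2‖
    · rw [indicator_of_mem (hmem.2 h), ballKernel, if_pos h, hardyConstantIntegrand,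
        show (m : ℝ) + n + s = 2 * a by rw [ha, kernelExponent]; ring, div_eq_mul_inv, expPolar,
        hker, norm_smul, hz.2, mul_one, Real.norm_eq_abs, Real.abs_exp, ← Real.exp_mul]
      have e1 : z.1 * -(((m : ℝ) + n - 2 - s) / 2) = -(γ * z.1) := by
        rw [hγ, hardyExponent]; ring
      -- The volume factor e^{(N-1)τ} and the kernel factor e^{-aτ} combine to e^{γτ}, while
      -- |y|^{-γ} is e^{-γτ}; the integrand becomes (e^{γτ} - 1) K.
      have e2 : Real.exp (((m : ℝ) + n - 1) * z.1) * Real.exp (-a * z.1) = Real.exp (γ * z.1) := by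
        rw [← Real.exp_add, hγ, ha, hardyExponent, kernelExponent]; congr 1; ring
      have e3 : Real.exp (γ * z.1) * Real.exp (-(γ * z.1)) = 1 := by rw [← Real.exp_add]; simp
      rw [e1]
      linear_combination (1 - Real.exp (-(γ * z.1))) * polarKernel a z.1 ‖p - z.2‖ * e2 -
        polarKernel a z.1 ‖p - z.2‖ * e3
    · rw [indicator_of_notMem (fun h' => h (hmem.1 h')), ballKernel, if_neg h, mul_zero]
  have hballm : ∀ δ : ℝ, MeasurableSet (Metric.ball p δ)ᶜ := fun δ => measurableSet_ball.compl
  refine ⟨fun δ hδ => ?_, ?_⟩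
  · rw [← integrable_indicator_iff (hballm δ), hμ.integrable_iff (hf.indicator (hballm δ))]
    exact (hσ.integrable_ballKernel had hp (by fun_prop) (abs_exp_mul_sub_one_le γ) hδ).congr
      (hpt δ hδ).symm
  · refine (hσ.tendsto_integral_ballKernel had hp).congr' ?_
    filter_upwards [self_mem_nhdsWithin] with δ hδ
    rw [← integral_indicator (hballm δ), hμ.integral_eq (hf.indicator (hballm δ))]
    exact (integral_congr_ae (hpt δ hδ)).symm

end Cone

/-! ### Test functions are Lipschitz on the cone. -/

section Test

variable {m n : ℕ} {α s : ℝ}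

/-- The properties of test functions that enter the estimates. -/
structure IsLipschitzTest (m n : ℕ) (α : ℝ) (φ : Space m n → ℝ) (L M T : ℝ) : Prop where
  measurable : Measurable φ
  abs_sub_le : ∀ x ∈ cone m n α, ∀ y ∈ cone m n α, |φ x - φ y| ≤ L * ‖x - y‖
  abs_le : ∀ x ∈ cone m n α, |φ x| ≤ M
  eq_zero : ∀ x ∈ cone m n α, x ≠ 0 → T < |Real.log ‖x‖| → φ x = 0

theorem zero_mem_cone : (0 : Space m n) ∈ cone m n α := by simp [cone]

theorem IsTest.locallyLipschitzOn {φ : Space m n → ℝ} (hφ : IsTest m n α φ) :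
    LocallyLipschitzOn (cone m n α) φ := by
  obtain ⟨hloc, K, hK, hKc, hK0⟩ := hφ
  intro x hx
  by_cases h0 : x = 0
  · subst h0
    have hx0 : (0 : Space m n) ∉ K := fun h => (hKc h).2 rfl
    refine ⟨0, cone m n α ∩ Kᶜ, inter_mem self_mem_nhdsWithin
      (nhdsWithin_le_nhds (hK.isClosed.isOpen_compl.mem_nhds hx0)), ?_⟩
    intro y hy z hz
    simp [hK0 y ⟨hy.1, hy.2⟩, hK0 z ⟨hz.1, hz.2⟩]
  · obtain ⟨g, hg, hgφ⟩ := hloc x ⟨hx, h0⟩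
    obtain ⟨C, t, ht, hC⟩ := (hg.of_le (by exact_mod_cast le_top) :
      ContDiff ℝ 1 g).locallyLipschitz x
    refine ⟨C, t ∩ {y | φ y = g y}, inter_mem (nhdsWithin_le_nhds ht) hgφ, ?_⟩
    intro y hy z hz
    have h1 : φ y = g y := hy.2
    have h2 : φ z = g z := hz.2
    rw [h1, h2]
    exact hC hy.1 hz.1

/-- The indicator is needed because φ is arbitrary, possibly not measurable, off the cone.
Compactness of the support, which avoids the vertex, turns local into global Lipschitz bounds. -/
theorem IsTest.exists_isLipschitzTest {φ : Space m n → ℝ} (hφ : IsTest m n α φ) :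
    ∃ L M T : ℝ, IsLipschitzTest m n α ((cone m n α).indicator φ) L M T := by
  have hlip := hφ.locallyLipschitzOn
  obtain ⟨hloc, K, hK, hKc, hK0⟩ := hφ
  obtain ⟨R, hR⟩ := hK.isBounded.subset_closedBall 0
  have hzero : ∀ x ∈ cone m n α, R < ‖x‖ → φ x = 0 := by
    intro x hx hxR
    refine hK0 x ⟨hx, fun hxK => ?_⟩
    have := hR hxK
    rw [mem_closedBall_zero_iff] at this
    linarith
  have hφ0 : φ 0 = 0 := hK0 0 ⟨zero_mem_cone, fun h => (hKc h).2 rfl⟩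
  have hcomp : IsCompact (cone m n α ∩ Metric.closedBall 0 (|R| + 1)) :=
    (isCompact_closedBall _ _).inter_left isClosed_cone
  obtain ⟨L, hL⟩ := (hlip.mono inter_subset_left).exists_lipschitzOnWith_of_compact hcomp
  have hL' : ∀ x ∈ cone m n α, ‖x‖ ≤ |R| + 1 → ∀ y ∈ cone m n α, ‖y‖ ≤ |R| + 1 →
      |φ x - φ y| ≤ L * ‖x - y‖ := by
    intro x hx hxR y hy hyR
    have := hL.dist_le_mul x ⟨hx, by simpa using hxR⟩ y ⟨hy, by simpa using hyR⟩
    rwa [Real.dist_eq, dist_eq_norm] at this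
  have hM : ∀ x ∈ cone m n α, |φ x| ≤ L * (|R| + 1) := by
    intro x hx
    rcases le_or_gt ‖x‖ (|R| + 1) with h | h
    · have := hL' x hx h 0 zero_mem_cone (by simp; positivity)
      rw [hφ0, sub_zero, sub_zero] at this
      exact this.trans (by gcongr)
    · rw [hzero x hx (by linarith [le_abs_self R]), abs_zero]
      positivity
  have hLM : (L : ℝ) ≤ L + L * (|R| + 1) := le_add_of_nonneg_right (by positivity)
  -- If y lies beyond |R| + 1 and φ x ≠ 0, the points are at distance at least 1, so the supremum
  -- bound serves as a Lipschitz bound.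
  have hfar : ∀ x ∈ cone m n α, ∀ y ∈ cone m n α, |R| + 1 < ‖y‖ →
      |φ x - φ y| ≤ (L + L * (|R| + 1)) * ‖x - y‖ := by
    intro x hx y hy hyR
    have hy0 : φ y = 0 := hzero y hy (by linarith [le_abs_self R])
    rcases lt_or_ge R ‖x‖ with h | h
    · rw [hzero x hx h, hy0, sub_zero, abs_zero]
      positivity
    · have h1 : 1 ≤ ‖x - y‖ := by
        have := norm_sub_norm_le y x
        rw [norm_sub_rev] at this
        linarith [le_abs_self R]
      rw [hy0, sub_zero]
      calc |φ x| ≤ L * (|R| + 1) := hM x hx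
        _ ≤ (L + L * (|R| + 1)) * 1 := by rw [mul_one]; exact le_add_of_nonneg_left L.2
        _ ≤ _ := by gcongr
  obtain ⟨T, hT⟩ := hK.exists_bound_of_continuousOn (f := fun x : Space m n => Real.log ‖x‖)
    (continuousOn_id.norm.log fun x hx => norm_ne_zero_iff.2 (hKc hx).2)
  refine ⟨L + L * (|R| + 1), L * (|R| + 1), T, ?_, ?_, ?_, ?_⟩
  · have := hlip.continuousOn
    classical
    rw [← piecewise_eq_indicator]
    exact this.measurable_piecewise continuous_zero.continuousOn measurableSet_cone
  · intro x hx y hy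
    rw [indicator_of_mem hx, indicator_of_mem hy]
    rcases le_or_gt ‖y‖ (|R| + 1) with hyR | hyR
    · rcases le_or_gt ‖x‖ (|R| + 1) with hxR | hxR
      · exact (hL' x hx hxR y hy hyR).trans (by gcongr)
      · rw [abs_sub_comm, norm_sub_rev]
        exact hfar y hy x hx hxR
    · exact hfar x hx y hy hyR
  · intro x hx
    rw [indicator_of_mem hx]
    exact hM x hx
  · intro x hx _ hxT
    rw [indicator_of_mem hx]
    refine hK0 x ⟨hx, fun hxK => ?_⟩
    have := hT x hxK
    rw [Real.norm_eq_abs] at this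
    linarith

end Test

/-! ### Strips of the cylinder. -/

section Strip

variable {V : Type*} [MeasurableSpace V] {σ : Measure V}

/-- The indicator function of the strip `|t| ≤ T` in the cylinder. -/
def stripIndicator (V : Type*) (T : ℝ) : ℝ × V → ℝ := {z : ℝ × V | |z.1| ≤ T}.indicator 1

theorem stripIndicator_of_le {T : ℝ} {z : ℝ × V} (h : |z.1| ≤ T) : stripIndicator V T z = 1 :=
  indicator_of_mem (s := {z : ℝ × V | |z.1| ≤ T}) h 1

theorem stripIndicator_of_lt {T : ℝ} {z : ℝ × V} (h : T < |z.1|) : stripIndicator V T z = 0 :=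
  indicator_of_notMem (s := {z : ℝ × V | |z.1| ≤ T}) (not_le.2 h) 1

theorem stripIndicator_nonneg (T : ℝ) (z : ℝ × V) : 0 ≤ stripIndicator V T z :=
  indicator_nonneg (fun _ _ => zero_le_one) z

theorem measurableSet_strip (T : ℝ) : MeasurableSet {z : ℝ × V | |z.1| ≤ T} :=
  measurableSet_le (by fun_prop) measurable_const

theorem strip_eq_prod (T : ℝ) : {z : ℝ × V | |z.1| ≤ T} = Icc (-T) T ×ˢ univ := by
  ext z
  simp [abs_le]

theorem integrable_stripIndicator [IsFiniteMeasure σ] (T : ℝ) :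
    Integrable (stripIndicator V T) ((volume : Measure ℝ).prod σ) := by
  refine (integrable_indicator_iff (measurableSet_strip T)).2 (integrableOn_const ?_)
  rw [strip_eq_prod, Measure.prod_prod]
  exact ENNReal.mul_ne_top (by simp) (measure_ne_top _ _)

theorem integral_stripIndicator [IsFiniteMeasure σ] {T : ℝ} (hT : 0 ≤ T) :
    ∫ z, stripIndicator V T z ∂((volume : Measure ℝ).prod σ) = 2 * T * σ.real univ := by
  rw [stripIndicator, integral_indicator_one (measurableSet_strip T), strip_eq_prod,
    measureReal_prod_prod, Real.volume_real_Icc_of_le (by linarith)]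
  ring

end Strip

/-! ### Transfer of norm and energy from the cone to the cylinder. -/

section Reduction

variable {m n : ℕ} {α s : ℝ}

/-- The function `e^{γt} φ` in logarithmic polar coordinates. -/
def groundQuotient (γ : ℝ) (φ : Space m n → ℝ) (z : ℝ × Space m n) : ℝ :=
  Real.exp (γ * z.1) * φ (expPolar z)

theorem polarEnergy_groundQuotient (a γ : ℝ) (φ : Space m n → ℝ)
    (z : (ℝ × Space m n) × (ℝ × Space m n)) :
    polarEnergy a γ (groundQuotient γ φ) z = Real.exp (γ * (z.1.1 + z.2.1)) *
      (φ (expPolar z.1) - φ (expPolar z.2)) ^ 2 *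
        polarKernel a (z.2.1 - z.1.1) ‖z.1.2 - z.2.2‖ := by
  have e1 : Real.exp (γ * (z.2.1 - z.1.1)) * Real.exp (γ * z.1.1) ^ 2 =
      Real.exp (γ * (z.1.1 + z.2.1)) := by
    rw [← Real.exp_nat_mul, ← Real.exp_add]; congr 1; push_cast; ring
  have e2 : Real.exp (-γ * (z.2.1 - z.1.1)) * Real.exp (γ * z.2.1) ^ 2 =
      Real.exp (γ * (z.1.1 + z.2.1)) := by
    rw [← Real.exp_nat_mul, ← Real.exp_add]; congr 1; push_cast; ring
  have e3 : Real.exp (γ * z.1.1) * Real.exp (γ * z.2.1) = Real.exp (γ * (z.1.1 + z.2.1)) := by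
    rw [← Real.exp_add]; congr 1; ring
  rw [polarEnergy, groundQuotient, groundQuotient]
  congr 1
  linear_combination φ (expPolar z.1) ^ 2 * e1 + φ (expPolar z.2) ^ 2 * e2 -
    2 * φ (expPolar z.1) * φ (expPolar z.2) * e3

theorem exp_mul_weightDensity (φ : Space m n → ℝ) {z : ℝ × Space m n} (hz : ‖z.2‖ = 1) :
    Real.exp (((m : ℝ) + n - 1) * z.1) * weightDensity s φ (expPolar z) =
      groundQuotient (hardyExponent m n s) φ z ^ 2 := by
  rw [weightDensity, groundQuotient]
  have h1 : ‖expPolar z‖ = Real.exp z.1 := by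
    rw [expPolar, norm_smul, hz, mul_one, Real.norm_eq_abs, Real.abs_exp]
  rw [h1, ← Real.exp_mul, mul_pow, ← Real.exp_nat_mul, div_eq_mul_inv, ← Real.exp_neg]
  have h2 : Real.exp (((m : ℝ) + n - 1) * z.1) * Real.exp (-(z.1 * (1 + s))) =
      Real.exp ((2 : ℕ) * (hardyExponent m n s * z.1)) := by
    rw [← Real.exp_add, hardyExponent]; congr 1; push_cast; ring
  rw [← h2]
  ring

theorem exp_mul_energyDensity (φ : Space m n → ℝ) {z : (ℝ × Space m n) × (ℝ × Space m n)}
    (hz : ‖z.1.2‖ = 1) (hz' : ‖z.2.2‖ = 1) :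
    Real.exp (((m : ℝ) + n - 1) * z.1.1) * Real.exp (((m : ℝ) + n - 1) * z.2.1) *
        energyDensity s φ (expPolar z.1) (expPolar z.2) =
      polarEnergy (kernelExponent m n s) (hardyExponent m n s)
        (groundQuotient (hardyExponent m n s) φ) z := by
  have h1 := inv_norm_expPolar_sub_rpow hz hz' z.1.1 z.2.1 (kernelExponent m n s)
  have h2 : Real.exp (((m : ℝ) + n - 1) * z.1.1) * Real.exp (((m : ℝ) + n - 1) * z.2.1) *
      Real.exp (-kernelExponent m n s * (z.1.1 + z.2.1)) =
      Real.exp (hardyExponent m n s * (z.1.1 + z.2.1)) := by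
    rw [← Real.exp_add, ← Real.exp_add, hardyExponent, kernelExponent]; congr 1; ring
  rw [polarEnergy_groundQuotient, energyDensity, div_eq_mul_inv,
    show (m : ℝ) + n + s = 2 * kernelExponent m n s by rw [kernelExponent]; ring,
    show ‖expPolar z.1 - expPolar z.2‖ =
      ‖Real.exp z.1.1 • z.1.2 - Real.exp z.2.1 • z.2.2‖ from rfl, h1, ← h2]
  ring

theorem expPolar_mem_cone {z : ℝ × Space m n} (hz : z.2 ∈ coneLink m n α) :
    expPolar z ∈ cone m n α := smul_mem_cone hz.1 _

theorem log_norm_expPolar {z : ℝ × Space m n} (hz : z.2 ∈ coneLink m n α) :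
    Real.log ‖expPolar z‖ = z.1 := by
  rw [expPolar, norm_smul, hz.2, mul_one, Real.norm_eq_abs, Real.abs_exp, Real.log_exp]

theorem expPolar_ne_zero {z : ℝ × Space m n} (hz : z.2 ∈ coneLink m n α) : expPolar z ≠ 0 :=
  smul_ne_zero (Real.exp_ne_zero _) (norm_ne_zero_iff.1 (by rw [hz.2]; norm_num))

variable {φ : Space m n → ℝ} {L M T : ℝ}

theorem IsLipschitzTest.expPolar_eq_zero (hφ : IsLipschitzTest m n α φ L M T)
    {z : ℝ × Space m n} (hz : z.2 ∈ coneLink m n α) (h : T < |z.1|) : φ (expPolar z) = 0 :=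
  hφ.eq_zero _ (expPolar_mem_cone hz) (expPolar_ne_zero hz) (by rwa [log_norm_expPolar hz])

theorem IsLipschitzTest.groundQuotient_sq_le (hφ : IsLipschitzTest m n α φ L M T) (γ : ℝ)
    {z : ℝ × Space m n} (hz : z.2 ∈ coneLink m n α) :
    groundQuotient γ φ z ^ 2 ≤
      Real.exp (2 * (|γ| * T)) * M ^ 2 * stripIndicator (Space m n) T z := by
  rcases le_or_gt |z.1| T with h | h
  · rw [stripIndicator_of_le h, mul_one, groundQuotient, mul_pow, ← Real.exp_nat_mul]
    have h1 : φ (expPolar z) ^ 2 ≤ M ^ 2 := by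
      rw [← sq_abs]
      exact pow_le_pow_left₀ (abs_nonneg (φ _)) (hφ.abs_le _ (expPolar_mem_cone hz)) 2
    have h2 : γ * z.1 ≤ |γ| * T :=
      calc γ * z.1 ≤ |γ * z.1| := le_abs_self (γ * z.1)
        _ = |γ| * |z.1| := abs_mul γ z.1
        _ ≤ _ := by gcongr
    refine mul_le_mul (Real.exp_le_exp.2 ?_) h1 (sq_nonneg _) (Real.exp_pos _).le
    push_cast
    linarith
  · rw [groundQuotient, hφ.expPolar_eq_zero hz h, stripIndicator_of_lt h]
    simp

/-- For short chords use the Lipschitz bound and |x-y|² = e^{t+t'} `chordSq`, where |τ| < 1 forces t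
+ t' ≤ 2T + 1. For long chords use boundedness. -/
theorem IsLipschitzTest.sub_sq_le (hφ : IsLipschitzTest m n α φ L M T)
    {z z' : ℝ × Space m n} (hz : z.2 ∈ coneLink m n α) (hz' : z'.2 ∈ coneLink m n α)
    (hT : |z.1 + z'.1| ≤ 2 * T + |z'.1 - z.1|) :
    (φ (expPolar z) - φ (expPolar z')) ^ 2 ≤
      (4 * M ^ 2 + L ^ 2 * Real.exp (2 * T + 1)) * min 1 (chordSq (z'.1 - z.1) ‖z.2 - z'.2‖) := by
  have hc := chordSq_nonneg (z'.1 - z.1) ‖z.2 - z'.2‖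
  have hmc := expPolar_mem_cone hz
  have hmc' := expPolar_mem_cone hz'
  rcases le_or_gt 1 (chordSq (z'.1 - z.1) ‖z.2 - z'.2‖) with h | h
  · rw [min_eq_left h, mul_one]
    have h1 : |φ (expPolar z) - φ (expPolar z')| ≤ 2 * M := by
      have := abs_sub (φ (expPolar z)) (φ (expPolar z'))
      linarith [hφ.abs_le _ hmc, hφ.abs_le _ hmc']
    have h2 := pow_le_pow_left₀ (abs_nonneg _) h1 2
    rw [sq_abs] at h2
    have h3 : 0 ≤ L ^ 2 * Real.exp (2 * T + 1) := by positivity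
    linarith [mul_pow 2 M 2]
  · rw [min_eq_right h.le]
    have ht : |z'.1 - z.1| < 1 := by
      by_contra! ht
      exact absurd (one_le_chordSq ht ‖z.2 - z'.2‖) (not_le.2 h)
    have h2 := pow_le_pow_left₀ (abs_nonneg _) (hφ.abs_sub_le _ hmc _ hmc') 2
    rw [sq_abs, mul_pow, show ‖expPolar z - expPolar z'‖ =
      ‖Real.exp z.1 • z.2 - Real.exp z'.1 • z'.2‖ from rfl,
      norm_expPolar_sub_sq hz.2 hz'.2] at h2
    have h3 : Real.exp (z.1 + z'.1) ≤ Real.exp (2 * T + 1) :=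
      Real.exp_le_exp.2 (by linarith [le_abs_self (z.1 + z'.1)])
    calc _ ≤ _ := h2
      _ ≤ L ^ 2 * (Real.exp (2 * T + 1) * chordSq (z'.1 - z.1) ‖z.2 - z'.2‖) := by gcongr
      _ ≤ _ := by
          rw [← mul_assoc]
          refine mul_le_mul_of_nonneg_right (le_add_of_nonneg_left (by positivity)) hc

/-- The energy density vanishes unless one point lies in the strip |t| ≤ T. Then |t + t'| ≤ 2T +
|τ|, so the weight e^{γ(t+t')} costs a constant and e^{|γ||τ|}, which the majorant absorbs. -/
theorem IsLipschitzTest.polarEnergy_le (hφ : IsLipschitzTest m n α φ L M T) (a γ : ℝ)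
    {z : (ℝ × Space m n) × (ℝ × Space m n)} (hz : z.1.2 ∈ coneLink m n α)
    (hz' : z.2.2 ∈ coneLink m n α) :
    polarEnergy a γ (groundQuotient γ φ) z ≤
      Real.exp (|γ| * (2 * T)) * (4 * M ^ 2 + L ^ 2 * Real.exp (2 * T + 1)) *
      ((stripIndicator (Space m n) T z.1 + stripIndicator (Space m n) T z.2) *
        majorant a (|γ| + 1 / 2) (z.2.1 - z.1.1) ‖z.1.2 - z.2.2‖) := by
  have hmaj := majorant_nonneg a (|γ| + 1 / 2) (z.2.1 - z.1.1) ‖z.1.2 - z.2.2‖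
  have hs := stripIndicator_nonneg T z.1
  have hs' := stripIndicator_nonneg T z.2
  rw [polarEnergy_groundQuotient]
  by_cases h : |z.1.1| ≤ T ∨ |z.2.1| ≤ T
  · have hT : |z.1.1 + z.2.1| ≤ 2 * T + |z.2.1 - z.1.1| := by
      rcases h with h | h
      · have := abs_add_le (2 * z.1.1) (z.2.1 - z.1.1)
        rw [show 2 * z.1.1 + (z.2.1 - z.1.1) = z.1.1 + z.2.1 by ring, abs_mul, abs_two] at this
        linarith
      · have := abs_sub (2 * z.2.1) (z.2.1 - z.1.1)
        rw [show 2 * z.2.1 - (z.2.1 - z.1.1) = z.1.1 + z.2.1 by ring, abs_mul, abs_two] at this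
        linarith
    have h1 := hφ.sub_sq_le hz hz' hT
    have h2 : Real.exp (γ * (z.1.1 + z.2.1)) ≤
        Real.exp (|γ| * (2 * T)) * Real.exp (|γ| * |z.2.1 - z.1.1|) := by
      rw [← Real.exp_add, ← mul_add]
      refine Real.exp_le_exp.2 ?_
      calc _ ≤ |γ * (z.1.1 + z.2.1)| := le_abs_self _
        _ = |γ| * |z.1.1 + z.2.1| := abs_mul _ _
        _ ≤ _ := by gcongr
    have h3 : 1 ≤ stripIndicator (Space m n) T z.1 + stripIndicator (Space m n) T z.2 := by
      rcases h with h | h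
      · rw [stripIndicator_of_le h]; linarith
      · rw [stripIndicator_of_le h]; linarith
    have h4 := exp_mul_min_mul_polarKernel_le a γ (z.2.1 - z.1.1) ‖z.1.2 - z.2.2‖
    have h5 := polarKernel_nonneg a (z.2.1 - z.1.1) ‖z.1.2 - z.2.2‖
    calc _ ≤ Real.exp (|γ| * (2 * T)) * Real.exp (|γ| * |z.2.1 - z.1.1|) *
          ((4 * M ^ 2 + L ^ 2 * Real.exp (2 * T + 1)) *
            min 1 (chordSq (z.2.1 - z.1.1) ‖z.1.2 - z.2.2‖)) *
          polarKernel a (z.2.1 - z.1.1) ‖z.1.2 - z.2.2‖ := by gcongr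
      _ = Real.exp (|γ| * (2 * T)) * (4 * M ^ 2 + L ^ 2 * Real.exp (2 * T + 1)) *
          (Real.exp (|γ| * |z.2.1 - z.1.1|) * min 1 (chordSq (z.2.1 - z.1.1) ‖z.1.2 - z.2.2‖) *
            polarKernel a (z.2.1 - z.1.1) ‖z.1.2 - z.2.2‖) := by ring
      _ ≤ _ := by
          refine mul_le_mul_of_nonneg_left (h4.trans ?_) (by positivity)
          exact le_mul_of_one_le_left hmaj h3
  · push Not at h
    rw [hφ.expPolar_eq_zero hz h.1, hφ.expPolar_eq_zero hz' h.2, sub_self]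
    simp only [ne_eq, OfNat.ofNat_ne_zero, not_false_eq_true, zero_pow, mul_zero, zero_mul]
    positivity

/-- The energy and the weighted norm of `φ` on the cone are finite, and they are those of `ψ` on the
cylinder. -/
structure HasPolarForm (m n : ℕ) (s α : ℝ) (φ : Space m n → ℝ) (ψ : ℝ × Space m n → ℝ) :
    Prop where
  integrable_weight : Integrable (weightDensity s φ) (surfaceMeasure m n α)
  integrable_energy : Integrable (fun z : Space m n × Space m n => energyDensity s φ z.1 z.2)
    ((surfaceMeasure m n α).prod (surfaceMeasure m n α))
  integrable_sq : Integrable (fun z => ψ z ^ 2) ((volume : Measure ℝ).prod (linkMeasure m n α))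
  integrable_polarEnergy : Integrable (polarEnergy (kernelExponent m n s) (hardyExponent m n s) ψ)
    (((volume : Measure ℝ).prod (linkMeasure m n α)).prod
      ((volume : Measure ℝ).prod (linkMeasure m n α)))
  integral_weight : ∫ x, weightDensity s φ x ∂surfaceMeasure m n α =
    ∫ z, ψ z ^ 2 ∂((volume : Measure ℝ).prod (linkMeasure m n α))
  integral_energy : ∫ x, ∫ y, energyDensity s φ x y ∂surfaceMeasure m n α ∂surfaceMeasure m n α =
    ∫ z, polarEnergy (kernelExponent m n s) (hardyExponent m n s) ψ z
      ∂(((volume : Measure ℝ).prod (linkMeasure m n α)).prod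
        ((volume : Measure ℝ).prod (linkMeasure m n α)))

theorem sFinite_surfaceMeasure (hm : 1 ≤ m) (hn : 1 ≤ n) (hα : 0 < α) :
    SFinite (surfaceMeasure m n α) := by
  have hμ := isHomogeneous_surfaceMeasure hm hn hα
  have := hμ.isFiniteMeasure
  rw [← hμ.map_expPolar]
  infer_instance

theorem ae_mem_coneLink_prod (hm : 1 ≤ m) (hn : 1 ≤ n) (hα : 0 < α) :
    ∀ᵐ z ∂(((volume : Measure ℝ).prod (linkMeasure m n α)).prod
      ((volume : Measure ℝ).prod (linkMeasure m n α))),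
      z.1.2 ∈ coneLink m n α ∧ z.2.2 ∈ coneLink m n α := by
  have hσ := isAngular_linkMeasure hm hn hα
  have := hσ.isFiniteMeasure
  exact (Measure.quasiMeasurePreserving_fst.ae hσ.ae_mem_prod).and
    (Measure.quasiMeasurePreserving_snd.ae hσ.ae_mem_prod)

theorem measurable_groundQuotient (γ : ℝ) (hφ : Measurable φ) : Measurable (groundQuotient γ φ) :=
  (by fun_prop : Measurable fun z : ℝ × Space m n => Real.exp (γ * z.1)).mul
    (hφ.comp measurable_expPolar)

theorem measurable_polarEnergy (a γ : ℝ) {ψ : ℝ × Space m n → ℝ} (hψ : Measurable ψ) :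
    Measurable (polarEnergy a γ ψ) := by
  have hk : Measurable fun z : (ℝ × Space m n) × (ℝ × Space m n) =>
      polarKernel a (z.2.1 - z.1.1) ‖z.1.2 - z.2.2‖ := measurable_kernel (measurable_polarKernel a)
  have h1 : Measurable fun z : (ℝ × Space m n) × (ℝ × Space m n) => ψ z.1 :=
    hψ.comp measurable_fst
  have h2 : Measurable fun z : (ℝ × Space m n) × (ℝ × Space m n) => ψ z.2 :=
    hψ.comp measurable_snd
  unfold polarEnergy
  fun_prop

theorem IsLipschitzTest.integrable_polarEnergy (hφ : IsLipschitzTest m n α φ L M T) (hm : 1 ≤ m)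
    (hn : 1 ≤ n) (hα : 0 < α) (hs0 : 0 ≤ s) (hs1 : s < 1) :
    Integrable (polarEnergy (kernelExponent m n s) (hardyExponent m n s)
        (groundQuotient (hardyExponent m n s) φ))
      (((volume : Measure ℝ).prod (linkMeasure m n α)).prod
        ((volume : Measure ℝ).prod (linkMeasure m n α))) := by
  have hσ := isAngular_linkMeasure hm hn hα
  have hfin := hσ.isFiniteMeasure
  obtain ⟨p, hp⟩ := coneLink_nonempty hm hn hα
  have hmaj := hσ.integrable_majorant' (admissible_exponents hm hn hs0 hs1) hp
  have hmm := measurable_majorant (kernelExponent m n s) (|hardyExponent m n s| + 1 / 2)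
  have hmeas := measurable_polarEnergy (kernelExponent m n s) (hardyExponent m n s)
    (measurable_groundQuotient (hardyExponent m n s) hφ.measurable)
  have hle : ∀ᵐ z ∂(((volume : Measure ℝ).prod (linkMeasure m n α)).prod
      ((volume : Measure ℝ).prod (linkMeasure m n α))), _ :=
    (ae_mem_coneLink_prod hm hn hα).mono fun z hz =>
      hφ.polarEnergy_le (kernelExponent m n s) (hardyExponent m n s) hz.1 hz.2
  generalize kernelExponent m n s = a at *
  generalize hardyExponent m n s = γ at *
  have h1 := hσ.integrable_mul_kernel hp (integrable_stripIndicator T) hmm hmaj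
  have h2 := hσ.integrable_mul_kernel_snd hp (integrable_stripIndicator T) hmm hmaj
  refine ((h1.add h2).const_mul (Real.exp (|γ| * (2 * T)) *
    (4 * M ^ 2 + L ^ 2 * Real.exp (2 * T + 1)))).mono' hmeas.aestronglyMeasurable ?_
  filter_upwards [hle] with z hz
  rw [Real.norm_of_nonneg (polarEnergy_nonneg _ _), Pi.add_apply, ← add_mul]
  exact hz

theorem IsLipschitzTest.hasPolarForm (hφ : IsLipschitzTest m n α φ L M T) (hm : 1 ≤ m) (hn : 1 ≤ n)
    (hα : 0 < α) (hs0 : 0 ≤ s) (hs1 : s < 1) :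
    HasPolarForm m n s α φ (groundQuotient (hardyExponent m n s) φ) := by
  have hμ := isHomogeneous_surfaceMeasure hm hn hα
  have hσ := isAngular_linkMeasure hm hn hα
  have hfin := hσ.isFiniteMeasure
  have hsf := sFinite_surfaceMeasure hm hn hα
  have had := admissible_exponents hm hn hs0 hs1
  obtain ⟨p, hp⟩ := coneLink_nonempty hm hn hα
  have hw : Measurable (weightDensity s φ) :=
    (hφ.measurable.pow_const 2).div (measurable_norm.pow_const _)
  have he : Measurable fun z : Space m n × Space m n => energyDensity s φ z.1 z.2 :=
    (((hφ.measurable.comp measurable_fst).sub (hφ.measurable.comp measurable_snd)).pow_const 2).div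
      ((measurable_fst.sub measurable_snd).norm.pow_const _)
  have hwe : (fun z : ℝ × Space m n => Real.exp (((m : ℝ) + n - 1) * z.1) *
      weightDensity s φ (expPolar z)) =ᵐ[(volume : Measure ℝ).prod (linkMeasure m n α)]
      fun z => groundQuotient (hardyExponent m n s) φ z ^ 2 := by
    filter_upwards [hσ.ae_mem_prod] with z hz using exp_mul_weightDensity φ hz.2
  have hee : (fun z : (ℝ × Space m n) × (ℝ × Space m n) =>
      Real.exp (((m : ℝ) + n - 1) * z.1.1) * Real.exp (((m : ℝ) + n - 1) * z.2.1) *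
        energyDensity s φ (expPolar z.1) (expPolar z.2)) =ᵐ[
      ((volume : Measure ℝ).prod (linkMeasure m n α)).prod
      ((volume : Measure ℝ).prod (linkMeasure m n α))]
      polarEnergy (kernelExponent m n s) (hardyExponent m n s)
        (groundQuotient (hardyExponent m n s) φ) := by
    filter_upwards [ae_mem_coneLink_prod hm hn hα] with z hz
    exact exp_mul_energyDensity φ hz.1.2 hz.2.2
  have hsq : Integrable (fun z => groundQuotient (hardyExponent m n s) φ z ^ 2)
      ((volume : Measure ℝ).prod (linkMeasure m n α)) := by
    refine ((integrable_stripIndicator T).const_mul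
      (Real.exp (2 * (|hardyExponent m n s| * T)) * M ^ 2)).mono'
      ((measurable_groundQuotient _ hφ.measurable).pow_const 2).aestronglyMeasurable ?_
    filter_upwards [hσ.ae_mem_prod] with z hz
    rw [Real.norm_of_nonneg (sq_nonneg _)]
    exact hφ.groundQuotient_sq_le _ hz
  have hpe := hφ.integrable_polarEnergy hm hn hα hs0 hs1
  have hE : Integrable (fun z : Space m n × Space m n => energyDensity s φ z.1 z.2)
      ((surfaceMeasure m n α).prod (surfaceMeasure m n α)) :=
    (hμ.integrable_prod_iff he).2 (hpe.congr hee.symm)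
  refine ⟨(hμ.integrable_iff hw).2 (hsq.congr hwe.symm), hE, hsq, hpe, ?_, ?_⟩
  · rw [hμ.integral_eq hw]
    exact integral_congr_ae hwe
  · rw [← integral_prod _ hE, hμ.integral_prod_eq he]
    exact integral_congr_ae hee

/-- Allows φ to be changed off the cone, in particular replaced by its indicator version. -/
theorem HasPolarForm.congr {φ' : Space m n → ℝ} {ψ ψ' : ℝ × Space m n → ℝ}
    (h : HasPolarForm m n s α φ ψ) (hm : 1 ≤ m) (hn : 1 ≤ n) (hα : 0 < α)
    (hφ : ∀ x ∈ cone m n α, φ x = φ' x)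
    (hψ : ψ =ᵐ[(volume : Measure ℝ).prod (linkMeasure m n α)] ψ') :
    HasPolarForm m n s α φ' ψ' := by
  have hfin := (isAngular_linkMeasure hm hn hα).isFiniteMeasure
  have hsf := sFinite_surfaceMeasure hm hn hα
  have h1 : weightDensity s φ =ᵐ[surfaceMeasure m n α] weightDensity s φ' := by
    filter_upwards [ae_mem_cone] with x hx
    rw [weightDensity, weightDensity, hφ x hx]
  have h2 : (fun z : Space m n × Space m n => energyDensity s φ z.1 z.2) =ᵐ[
      (surfaceMeasure m n α).prod (surfaceMeasure m n α)]
      fun z => energyDensity s φ' z.1 z.2 := by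
    filter_upwards [Measure.quasiMeasurePreserving_fst.ae ae_mem_cone,
      Measure.quasiMeasurePreserving_snd.ae ae_mem_cone] with z hz hz'
    rw [energyDensity, energyDensity, hφ _ hz, hφ _ hz']
  have h3 : (fun z => ψ z ^ 2) =ᵐ[(volume : Measure ℝ).prod (linkMeasure m n α)]
      fun z => ψ' z ^ 2 := by
    filter_upwards [hψ] with z hz
    rw [hz]
  have h4 : polarEnergy (kernelExponent m n s) (hardyExponent m n s) ψ =ᵐ[
      ((volume : Measure ℝ).prod (linkMeasure m n α)).prod
        ((volume : Measure ℝ).prod (linkMeasure m n α))]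
      polarEnergy (kernelExponent m n s) (hardyExponent m n s) ψ' := by
    filter_upwards [Measure.quasiMeasurePreserving_fst.ae hψ,
      Measure.quasiMeasurePreserving_snd.ae hψ] with z hz hz'
    rw [polarEnergy, polarEnergy, hz, hz']
  have hE := h.integrable_energy.congr h2
  refine ⟨h.integrable_weight.congr h1, hE, h.integrable_sq.congr h3,
    h.integrable_polarEnergy.congr h4, ?_, ?_⟩
  · rw [← integral_congr_ae h1, h.integral_weight, integral_congr_ae h3]
  · rw [← integral_prod _ hE, ← integral_congr_ae h2, integral_prod _ h.integrable_energy,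
      h.integral_energy, integral_congr_ae h4]

theorem IsTest.hasPolarForm (hφ : IsTest m n α φ) (hm : 1 ≤ m) (hn : 1 ≤ n)
    (hα : 0 < α) (hs0 : 0 ≤ s) (hs1 : s < 1) :
    HasPolarForm m n s α φ (groundQuotient (hardyExponent m n s) φ) := by
  obtain ⟨L, M, T, h⟩ := hφ.exists_isLipschitzTest
  refine (h.hasPolarForm hm hn hα hs0 hs1).congr hm hn hα
    (fun x hx => indicator_of_mem hx φ) ?_
  filter_upwards [(isAngular_linkMeasure hm hn hα).ae_mem_prod] with z hz
  rw [groundQuotient, groundQuotient, indicator_of_mem (expPolar_mem_cone hz)]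

theorem hardyInequality_polarConstant (hm : 1 ≤ m) (hn : 1 ≤ n) (hα : 0 < α) (hs0 : 0 ≤ s)
    (hs1 : s < 1) {p : Space m n} (hp : p ∈ coneLink m n α) :
    HardyInequality m n s α
      (polarConstant (linkMeasure m n α) (kernelExponent m n s) (hardyExponent m n s) p) := by
  intro φ hφ
  have h := hφ.hasPolarForm hm hn hα hs0 hs1
  rw [h.integral_weight, h.integral_energy]
  exact (isAngular_linkMeasure hm hn hα).polarConstant_mul_le (admissible_exponents hm hn hs0 hs1)
    hp h.integrable_sq h.integrable_polarEnergy

end Reduction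

/-! ### Optimality of the constant. -/

section Optimality

variable {m n : ℕ} {α s γ ε : ℝ}

/-- The ground state `|x|^{-γ}`, cut off on the logarithmic scale `1 / ε`. -/
def truncatedGroundState (m n : ℕ) (γ : ℝ) (η : ContDiffBump (0 : ℝ)) (ε : ℝ) : Space m n → ℝ :=
  ({0}ᶜ : Set (Space m n)).indicator fun x => ‖x‖ ^ (-γ) * η (ε * Real.log ‖x‖)

theorem bump_eq_zero {η : ContDiffBump (0 : ℝ)} (hε : 0 < ε) {t : ℝ} (h : η.rOut / ε ≤ |t|) :
    η (ε * t) = 0 := by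
  refine η.zero_of_le_dist ?_
  rw [dist_zero_right, Real.norm_eq_abs, abs_mul, abs_of_pos hε]
  rwa [div_le_iff₀' hε] at h

theorem truncatedGroundState_eq_zero {η : ContDiffBump (0 : ℝ)} (hε : 0 < ε) {x : Space m n}
    (h : x ≠ 0 → η.rOut / ε ≤ |Real.log ‖x‖|) : truncatedGroundState m n γ η ε x = 0 := by
  by_cases h0 : x = 0
  · exact indicator_of_notMem (by simpa using h0) _
  · rw [truncatedGroundState, indicator_of_mem (by simpa using h0), bump_eq_zero hε (h h0),
      mul_zero]

theorem contDiff_truncatedGroundState (η : ContDiffBump (0 : ℝ)) (hε : 0 < ε) :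
    ContDiff ℝ ∞ (truncatedGroundState m n γ η ε) := by
  rw [contDiff_iff_contDiffAt]
  intro x
  by_cases h0 : x = 0
  · subst h0
    refine (contDiffAt_const (c := (0 : ℝ))).congr_of_eventuallyEq ?_
    filter_upwards [Metric.ball_mem_nhds (0 : Space m n) (Real.exp_pos (-(η.rOut / ε)))] with x hx
    refine truncatedGroundState_eq_zero hε fun hx0 => ?_
    rw [mem_ball_zero_iff] at hx
    have := (Real.log_lt_iff_lt_exp (norm_pos_iff.2 hx0)).2 hx
    rw [le_abs]
    right
    linarith
  · have h1 : ContDiffAt ℝ ∞ (fun x : Space m n => ‖x‖) x := contDiffAt_norm ℝ h0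
    have h2 : ‖x‖ ≠ 0 := norm_ne_zero_iff.2 h0
    have h3 : ContDiffAt ℝ ∞ (fun x : Space m n => ‖x‖ ^ (-γ) * η (ε * Real.log ‖x‖)) x :=
      (h1.rpow_const_of_ne h2).mul
        (η.contDiff.contDiffAt.comp x (contDiffAt_const.mul (h1.log h2)))
    refine h3.congr_of_eventuallyEq ?_
    filter_upwards [isOpen_compl_singleton.mem_nhds h0] with y hy
    exact indicator_of_mem hy _

theorem isTest_truncatedGroundState (η : ContDiffBump (0 : ℝ)) (hε : 0 < ε) :
    IsTest m n α (truncatedGroundState m n γ η ε) := by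
  refine ⟨fun x _ => ⟨_, contDiff_truncatedGroundState η hε, Filter.EventuallyEq.rfl⟩,
    cone m n α ∩ (Metric.closedBall 0 (Real.exp (η.rOut / ε)) \
      Metric.ball 0 (Real.exp (-(η.rOut / ε)))), ?_, ?_, ?_⟩
  · exact ((isCompact_closedBall _ _).diff Metric.isOpen_ball).inter_left isClosed_cone
  · rintro x ⟨hx, hx'⟩
    refine ⟨hx, ?_⟩
    rintro rfl
    exact hx'.2 (Metric.mem_ball_self (Real.exp_pos _))
  · rintro x ⟨hx, hx'⟩
    refine truncatedGroundState_eq_zero hε fun h0 => ?_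
    have hpos := norm_pos_iff.2 h0
    by_contra! h
    rw [abs_lt] at h
    refine hx' ⟨hx, ?_, ?_⟩
    · rw [mem_closedBall_zero_iff]
      exact ((Real.log_lt_iff_lt_exp hpos).1 h.2).le
    · rw [mem_ball_zero_iff, not_lt]
      exact ((Real.lt_log_iff_exp_lt hpos).1 h.1).le

theorem groundQuotient_truncatedGroundState (η : ContDiffBump (0 : ℝ)) {z : ℝ × Space m n}
    (hz : z.2 ∈ coneLink m n α) :
    groundQuotient γ (truncatedGroundState m n γ η ε) z = η (ε * z.1) := by
  have h1 : ‖expPolar z‖ = Real.exp z.1 := by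
    rw [expPolar, norm_smul, hz.2, mul_one, Real.norm_eq_abs, Real.abs_exp]
  rw [groundQuotient, truncatedGroundState,
    indicator_of_mem (by simpa using expPolar_ne_zero hz), log_norm_expPolar hz, h1,
    ← Real.exp_mul, ← mul_assoc, ← Real.exp_add, show γ * z.1 + z.1 * -γ = 0 by ring,
    Real.exp_zero, one_mul]

/-- The Lipschitz bound gives ε² τ², and the difference vanishes unless one point lies in a strip of
length of order 1/ε. The integral is therefore O(ε). -/
theorem bump_sub_sq_mul_le {η : ContDiffBump (0 : ℝ)} {K : NNReal} (hη : LipschitzWith K η)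
    (hε : 0 < ε) (a γ : ℝ) (z : (ℝ × Space m n) × (ℝ × Space m n)) :
    (η (ε * z.1.1) - η (ε * z.2.1)) ^ 2 * polarKernel a (z.2.1 - z.1.1) ‖z.1.2 - z.2.2‖ ≤
      8 * K ^ 2 * ε ^ 2 *
        ((stripIndicator (Space m n) (η.rOut / ε) z.1 +
          stripIndicator (Space m n) (η.rOut / ε) z.2) *
        majorant a (|γ| + 1 / 2) (z.2.1 - z.1.1) ‖z.1.2 - z.2.2‖) := by
  have hmaj := majorant_nonneg a (|γ| + 1 / 2) (z.2.1 - z.1.1) ‖z.1.2 - z.2.2‖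
  have hs := stripIndicator_nonneg (η.rOut / ε) z.1
  have hs' := stripIndicator_nonneg (η.rOut / ε) z.2
  by_cases h : |z.1.1| ≤ η.rOut / ε ∨ |z.2.1| ≤ η.rOut / ε
  · have h3 : 1 ≤ stripIndicator (Space m n) (η.rOut / ε) z.1 +
        stripIndicator (Space m n) (η.rOut / ε) z.2 := by
      rcases h with h | h
      · rw [stripIndicator_of_le h]; linarith
      · rw [stripIndicator_of_le h]; linarith
    have h1 : (η (ε * z.1.1) - η (ε * z.2.1)) ^ 2 ≤ K ^ 2 * ε ^ 2 * (z.2.1 - z.1.1) ^ 2 := by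
      have h2 := hη.dist_le_mul (ε * z.1.1) (ε * z.2.1)
      rw [Real.dist_eq, Real.dist_eq, ← mul_sub, abs_mul, abs_of_pos hε] at h2
      have h4 := pow_le_pow_left₀ (abs_nonneg _) h2 2
      rw [sq_abs, mul_pow, mul_pow, sq_abs] at h4
      linarith [sub_sq_comm z.1.1 z.2.1]
    calc _ ≤ K ^ 2 * ε ^ 2 * (z.2.1 - z.1.1) ^ 2 *
          polarKernel a (z.2.1 - z.1.1) ‖z.1.2 - z.2.2‖ :=
          mul_le_mul_of_nonneg_right h1 (polarKernel_nonneg _ _ _)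
      _ = K ^ 2 * ε ^ 2 * ((z.2.1 - z.1.1) ^ 2 *
          polarKernel a (z.2.1 - z.1.1) ‖z.1.2 - z.2.2‖) := by ring
      _ ≤ K ^ 2 * ε ^ 2 * (8 * majorant a (|γ| + 1 / 2) (z.2.1 - z.1.1) ‖z.1.2 - z.2.2‖) :=
          mul_le_mul_of_nonneg_left (sq_mul_polarKernel_le _ _ _ _) (by positivity)
      _ = 8 * K ^ 2 * ε ^ 2 * majorant a (|γ| + 1 / 2) (z.2.1 - z.1.1) ‖z.1.2 - z.2.2‖ := by ring
      _ ≤ _ := by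
          gcongr
          exact le_mul_of_one_le_left hmaj h3
  · push Not at h
    rw [bump_eq_zero hε h.1.le, bump_eq_zero hε h.2.le, sub_self]
    simp only [ne_eq, OfNat.ofNat_ne_zero, not_false_eq_true, zero_pow, zero_mul]
    positivity

theorem strip_le_integral_bump_sq {σ : Measure (Space m n)} [IsFiniteMeasure σ]
    (η : ContDiffBump (0 : ℝ)) (hε : 0 < ε)
    (hi : Integrable (fun z : ℝ × Space m n => η (ε * z.1) ^ 2) ((volume : Measure ℝ).prod σ)) :
    2 * (η.rIn / ε) * σ.real univ ≤
      ∫ z : ℝ × Space m n, η (ε * z.1) ^ 2 ∂((volume : Measure ℝ).prod σ) := by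
  rw [← integral_stripIndicator (div_pos η.rIn_pos hε).le]
  refine integral_mono (integrable_stripIndicator _) hi fun z => ?_
  rcases le_or_gt |z.1| (η.rIn / ε) with h | h
  · have h1 : η (ε * z.1) = 1 := by
      refine η.one_of_mem_closedBall ?_
      rw [mem_closedBall_zero_iff, Real.norm_eq_abs, abs_mul, abs_of_pos hε]
      rwa [le_div_iff₀' hε] at h
    simp only
    rw [stripIndicator_of_le h, h1, one_pow]
  · simp only
    rw [stripIndicator_of_lt h]
    positivity

/-- Testing with η(εt), half the remainder is at most 32 K² S M₀ ε, where S is the mass of the link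
and M₀ the integral of the majorant, while ∫ ψ² ≥ 2S/ε. The quotient is 16 K² M₀ ε². -/
theorem exists_le_polarConstant_add (hm : 1 ≤ m) (hn : 1 ≤ n) (hα : 0 < α) (hs0 : 0 ≤ s)
    (hs1 : s < 1) {p : Space m n} (hp : p ∈ coneLink m n α) {c : ℝ}
    (hc : HardyInequality m n s α c) :
    ∃ C : ℝ, ∀ ε : ℝ, 0 < ε → c ≤ polarConstant (linkMeasure m n α) (kernelExponent m n s)
      (hardyExponent m n s) p + C * ε ^ 2 := by
  have hσ := isAngular_linkMeasure hm hn hα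
  have hfin := hσ.isFiniteMeasure
  have had := admissible_exponents hm hn hs0 hs1
  have hS := linkMeasure_univ_pos hm hn hα
  have hmaj := hσ.integrable_majorant' had hp
  have hmm := measurable_majorant (kernelExponent m n s) (|hardyExponent m n s| + 1 / 2)
  -- Equal to 1 on [-1, 1] and supported in [-2, 2]: hence the strips of half-width 1/ε in the lower
  -- bound and 2/ε in the upper bound.
  let η : ContDiffBump (0 : ℝ) := ⟨1, 2, one_pos, one_lt_two⟩
  obtain ⟨K, hK⟩ := (η.contDiff (n := 1)).lipschitzWith_of_hasCompactSupport
    η.hasCompactSupport one_ne_zero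
  have hform : ∀ ε : ℝ, 0 < ε → HasPolarForm m n s α
      (truncatedGroundState m n (hardyExponent m n s) η ε) fun z => η (ε * z.1) := by
    intro ε hε
    refine ((isTest_truncatedGroundState η hε).hasPolarForm hm hn hα hs0 hs1).congr hm hn hα
      (fun _ _ => rfl) ?_
    filter_upwards [hσ.ae_mem_prod] with z hz using groundQuotient_truncatedGroundState η hz
  have hineq : ∀ ε : ℝ, 0 < ε → c * (∫ z : ℝ × Space m n, η (ε * z.1) ^ 2
        ∂((volume : Measure ℝ).prod (linkMeasure m n α))) ≤
      1 / 2 * ∫ z, polarEnergy (kernelExponent m n s) (hardyExponent m n s)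
        (fun z : ℝ × Space m n => η (ε * z.1)) z
        ∂(((volume : Measure ℝ).prod (linkMeasure m n α)).prod
          ((volume : Measure ℝ).prod (linkMeasure m n α))) := by
    intro ε hε
    have := hc _ (isTest_truncatedGroundState (γ := hardyExponent m n s) η hε)
    rwa [(hform ε hε).integral_weight, (hform ε hε).integral_energy] at this
  have hsq := fun ε hε => (hform ε hε).integrable_sq
  have hpe := fun ε hε => (hform ε hε).integrable_polarEnergy
  clear hform hc
  generalize kernelExponent m n s = a at *
  generalize hardyExponent m n s = γ at *
  set M₀ := ∫ z : ℝ × Space m n, majorant a (|γ| + 1 / 2) z.1 ‖p - z.2‖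
    ∂((volume : Measure ℝ).prod (linkMeasure m n α)) with hM₀
  have hM₀0 : 0 ≤ M₀ := integral_nonneg fun z => majorant_nonneg _ _ _ _
  refine ⟨16 * K ^ 2 * M₀, fun ε hε => ?_⟩
  set S := (linkMeasure m n α).real univ with hSdef
  have h1 := hσ.integrable_mul_kernel hp (integrable_stripIndicator (2 / ε)) hmm hmaj
  have h2 := hσ.integrable_mul_kernel_snd hp (integrable_stripIndicator (2 / ε)) hmm hmaj
  have hle := bump_sub_sq_mul_le (m := m) (n := n) hK hε a γ
  have hg := (h1.add h2).const_mul (8 * K ^ 2 * ε ^ 2 : ℝ)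
  have hD : Integrable (fun z : (ℝ × Space m n) × (ℝ × Space m n) =>
      (η (ε * z.1.1) - η (ε * z.2.1)) ^ 2 * polarKernel a (z.2.1 - z.1.1) ‖z.1.2 - z.2.2‖)
      (((volume : Measure ℝ).prod (linkMeasure m n α)).prod
        ((volume : Measure ℝ).prod (linkMeasure m n α))) := by
    refine hg.mono' ?_ (.of_forall fun z => ?_)
    · have h3 : Continuous η := η.continuous
      exact ((by fun_prop : Measurable fun z : (ℝ × Space m n) × (ℝ × Space m n) =>
        (η (ε * z.1.1) - η (ε * z.2.1)) ^ 2).mul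
          (measurable_kernel (measurable_polarKernel a))).aestronglyMeasurable
    · rw [Real.norm_of_nonneg (mul_nonneg (sq_nonneg _) (polarKernel_nonneg _ _ _)), Pi.add_apply,
        ← add_mul]
      exact hle z
  have hDle : ∫ z : (ℝ × Space m n) × (ℝ × Space m n),
      (η (ε * z.1.1) - η (ε * z.2.1)) ^ 2 * polarKernel a (z.2.1 - z.1.1) ‖z.1.2 - z.2.2‖
      ∂(((volume : Measure ℝ).prod (linkMeasure m n α)).prod
        ((volume : Measure ℝ).prod (linkMeasure m n α))) ≤
      8 * K ^ 2 * ε ^ 2 * (2 * (2 * (2 / ε) * S * M₀)) := by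
    have e1 := hσ.integral_mul_kernel hp (integrable_stripIndicator (2 / ε)) hmm hmaj
    have e2 := hσ.integral_mul_kernel_snd hp (integrable_stripIndicator (2 / ε)) hmm hmaj
    rw [integral_stripIndicator (by positivity)] at e1 e2
    refine (integral_mono hD hg fun z => ?_).trans (le_of_eq ?_)
    · simp only [Pi.add_apply]
      rw [← add_mul]
      exact hle z
    · rw [integral_const_mul]
      simp only [Pi.add_apply]
      rw [integral_add h1 h2, e1, e2]
      ring
  have hup := hσ.le_polarConstant_mul_add had hp (hsq ε hε) (hpe ε hε) hD
  have hlow : 2 * (1 / ε) * S ≤ _ := strip_le_integral_bump_sq η hε (hsq ε hε)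
  have hI := hineq ε hε
  set I := ∫ z : ℝ × Space m n, η (ε * z.1) ^ 2
    ∂((volume : Measure ℝ).prod (linkMeasure m n α)) with hIdef
  have hkey : (c - polarConstant (linkMeasure m n α) a γ p) * I ≤
      1 / 2 * (8 * K ^ 2 * ε ^ 2 * (2 * (2 * (2 / ε) * S * M₀))) := by linarith
  by_contra! hcon
  have hcpos : 0 ≤ c - polarConstant (linkMeasure m n α) a γ p := by
    have : 0 ≤ 16 * (K : ℝ) ^ 2 * M₀ * ε ^ 2 := by positivity
    linarith
  have h5 : (16 * K ^ 2 * M₀ * ε ^ 2) * (2 * (1 / ε) * S) <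
      (c - polarConstant (linkMeasure m n α) a γ p) * (2 * (1 / ε) * S) :=
    mul_lt_mul_of_pos_right (by linarith) (by positivity)
  have h6 := mul_le_mul_of_nonneg_left hlow hcpos
  have h7 : (1 / 2 * (8 * K ^ 2 * ε ^ 2 * (2 * (2 * (2 / ε) * S * M₀))) : ℝ) =
      (16 * K ^ 2 * M₀ * ε ^ 2) * (2 * (1 / ε) * S) := by ring
  linarith

/-- The constant in Hardy's inequality is optimal. -/
theorem le_polarConstant_of_hardyInequality (hm : 1 ≤ m) (hn : 1 ≤ n) (hα : 0 < α) (hs0 : 0 ≤ s)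
    (hs1 : s < 1) {p : Space m n} (hp : p ∈ coneLink m n α) {c : ℝ}
    (hc : HardyInequality m n s α c) :
    c ≤ polarConstant (linkMeasure m n α) (kernelExponent m n s) (hardyExponent m n s) p := by
  obtain ⟨C, hC⟩ := exists_le_polarConstant_add hm hn hα hs0 hs1 hp hc
  have hlim : Tendsto (fun ε : ℝ => polarConstant (linkMeasure m n α) (kernelExponent m n s)
      (hardyExponent m n s) p + C * ε ^ 2) (𝓝[>] 0) (𝓝 (polarConstant (linkMeasure m n α)
        (kernelExponent m n s) (hardyExponent m n s) p + C * 0 ^ 2)) :=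
    ((by fun_prop : Continuous fun ε : ℝ => polarConstant (linkMeasure m n α)
      (kernelExponent m n s) (hardyExponent m n s) p + C * ε ^ 2).tendsto 0).mono_left
        nhdsWithin_le_nhds
  have := ge_of_tendsto hlim (eventually_mem_nhdsWithin.mono fun ε hε => hC ε hε)
  simpa using this

end Optimality

end NonlocalCone

end

open NonlocalCone in
theorem mainTheorem2 (m n : ℕ) (hm : 1 ≤ m) (hn : 1 ≤ n) (s : ℝ) (hs0 : 0 ≤ s) (hs1 : s < 1)
    (α : ℝ) (hα : IsOpening m n s α) :
    (∀ φ : Space m n → ℝ, IsTest m n α φ →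
      Integrable (weightDensity s φ) (surfaceMeasure m n α) ∧
      Integrable (fun z : Space m n × Space m n => energyDensity s φ z.1 z.2)
        ((surfaceMeasure m n α).prod (surfaceMeasure m n α))) ∧
    ∃ H : ℝ,
      (∀ p ∈ cone m n α, ‖p‖ = 1 →
        HasPrincipalValue (surfaceMeasure m n α) (hardyConstantIntegrand s p) p H) ∧
      HardyInequality m n s α H ∧
      ∀ c : ℝ, HardyInequality m n s α c → c ≤ H := by
  have hα0 := hα.1
  -- Any base point of the link may define H, since `IsAngular.polarConstant_eq` gives the same
  -- value at all of them.
  obtain ⟨q, hq⟩ := coneLink_nonempty hm hn hα0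
  refine ⟨fun φ hφ => ?_, polarConstant (linkMeasure m n α) (kernelExponent m n s)
    (hardyExponent m n s) q, fun p hp hp1 => ?_,
    hardyInequality_polarConstant hm hn hα0 hs0 hs1 hq,
    fun c hc => le_polarConstant_of_hardyInequality hm hn hα0 hs0 hs1 hq hc⟩
  · have h := hφ.hasPolarForm hm hn hα0 hs0 hs1
    exact ⟨h.integrable_weight, h.integrable_energy⟩
  · have hp' : p ∈ coneLink m n α := ⟨hp, hp1⟩
    rw [(isAngular_linkMeasure hm hn hα0).polarConstant_eq hq hp']
    exact hasPrincipalValue_hardyConstantIntegrand hm hn hα0 hs0 hs1 hp'
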